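/- Let $q\in\mathbb{C}^*$ be not a root of unity, fix a square root $q^{1/2}$, let $k_\pm\in\mathbb{C}^*$ and $\rho=k_+k_-(q+q^{-1})^2$. Write $[X,Y]_q=qXY-q^{-1}YX$, $[m]_q=\frac{q^m-q^{-m}}{q-q^{-1}}$, $c(x)=x-x^{-1}$ and $U(x)=\frac{qx^2+q^{-1}x^{-2}}{q+q^{-1}}$. **The algebra.** $\mathcal{A}_q$ is the associative unital $\mathbb{C}$-algebra generated by $\mathsf{W}_{-k},\mathsf{W}_{k+1},\mathsf{G}_{k+1},\tilde{\mathsf{G}}_{k+1}$ ($k\in\mathbb{N}$), whose generating functions $$\mathcal{W}_+(u)=\sum_{k\ge0}\mathsf{W}_{-k}U^{-k-1},\quad \mathcal{W}_-(u)=\sum_{k\ge0}\mathsf{W}_{k+1}U^{-k-1},\quad \mathcal{G}_+(u)=\sum_{k\ge0}\mathsf{G}_{k+1}U^{-k-1},\quad \mathcal{G}_-(u)=\sum_{k\ge0}\tilde{\mathsf{G}}_{k+1}U^{-k-1}$$ with $U=U(u)$, $V=U(v)$ satisfy the following relations, coefficient by coefficient in $U^{-1},V^{-1}$ (for all choices of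 the signs $\pm$ and $\epsilon$): $$[\mathcal{W}_\pm(u),\mathcal{W}_\pm(v)]=0,\quad [\mathcal{W}_+(u),\mathcal{W}_-(v)]+[\mathcal{W}_-(u),\mathcal{W}_+(v)]=0,\quad [\mathcal{G}_\epsilon(u),\mathcal{W}_\pm(v)]+[\mathcal{W}_\pm(u),\mathcal{G}_\epsilon(v)]=0,$$ $$[\mathcal{G}_\pm(u),\mathcal{G}_\pm(v)]=0,\quad [\mathcal{G}_+(u),\mathcal{G}_-(v)]+[\mathcal{G}_-(u),\mathcal{G}_+(v)]=0,$$ $$(U-V)[\mathcal{W}_\pm(u),\mathcal{W}_\mp(v)]=\tfrac{q-q^{-1}}{\rho(q+q^{-1})}\big(\mathcal{G}_\pm(u)\mathcal{G}_\mp(v)-\mathcal{G}_\pm(v)\mathcal{G}_\mp(u)\big)+\tfrac{1}{q+q^{-1}}\big(\mathcal{G}_\pm(u)-\mathcal{G}_\mp(u)+\mathcal{G}_\mp(v)-\mathcal{G}_\pm(v)\big),$$ $$\mathcal{W}_\pm(u)\mathcal{W}_\pm(v)-\mathcal{W}_\mp(u)\mathcal{W}_\mp(v)+\tfrac{1}{\rho(q^2-q^{-2})}[\mathcal{G}_\pm(u),\mathcal{G}_\mp(v)]+\tfrac{1-UV}{U-V}\big(\mathcal{W}_\pm(u)\mathcal{W}_\mp(v)-\mathcal{W}_\pm(v)\mathcal{W}_\mp(u)\big)=0,$$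 $$U[\mathcal{G}_\mp(v),\mathcal{W}_\pm(u)]_q-V[\mathcal{G}_\mp(u),\mathcal{W}_\pm(v)]_q-(q-q^{-1})\big(\mathcal{W}_\mp(u)\mathcal{G}_\mp(v)-\mathcal{W}_\mp(v)\mathcal{G}_\mp(u)\big)+\rho\big(U\mathcal{W}_\pm(u)-V\mathcal{W}_\pm(v)-\mathcal{W}_\mp(u)+\mathcal{W}_\mp(v)\big)=0,$$ $$U[\mathcal{W}_\mp(u),\mathcal{G}_\mp(v)]_q-V[\mathcal{W}_\mp(v),\mathcal{G}_\mp(u)]_q-(q-q^{-1})\big(\mathcal{W}_\pm(u)\mathcal{G}_\mp(v)-\mathcal{W}_\pm(v)\mathcal{G}_\mp(u)\big)+\rho\big(U\mathcal{W}_\mp(u)-V\mathcal{W}_\mp(v)-\mathcal{W}_\pm(u)+\mathcal{W}_\pm(v)\big)=0.$$ **Spectral parameters.** All series are Laurent series in $u^{-1}$, and every rational function of $u$ is expanded in $u^{-1}$. For $x=au$ or $x=au^{-1}$ with $a\in\mathbb{C}^*$, $\mathcal{W}_\pm(x)$ and $\mathcal{G}_\pm(x)$ are obtained by putting $U(x)$,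 expanded in $u^{-1}$, in place of $U$. The fundamental K-operator is $$\mathcal{K}^{(\frac12)}(x)=\begin{pmatrix} xq\,\mathcal{W}_+(x)-x^{-1}q^{-1}\mathcal{W}_-(x) & \frac{1}{k_-(q+q^{-1})}\mathcal{G}_+(x)+\frac{k_+(q+q^{-1})}{q-q^{-1}}\\ \frac{1}{k_+(q+q^{-1})}\mathcal{G}_-(x)+\frac{k_-(q+q^{-1})}{q-q^{-1}} & xq\,\mathcal{W}_-(x)-x^{-1}q^{-1}\mathcal{W}_+(x)\end{pmatrix}.$$ **R-matrices.** Let $j\in\frac12\mathbb{N}_+$, let $\mathbb{C}^{2j+1}$ have the basis $|j,j\rangle,|j,j-1\rangle,\dots,|j,-j\rangle$, let $B_{j,m}=\sqrt{[j+m]_q[j-m+1]_q}$, and let $\pi^j(F)|j,m\rangle=B_{j,m}|j,m-1\rangle$, $\pi^j(E)|j,m-1\rangle=B_{j,m}|j,m\rangle$, $\pi^j(H)|j,m\rangle=2m|j,m\rangle$ (the first two being zero on the other basis vectors). On $\mathbb{C}^2\otimes\mathbb{C}^{2j+1}$ put $$R^{(\frac12,j)}(x)=\prod_{k=0}^{2j-2}c(xq^{j-\frac12-k})\Big((q-q^{-1})\big(\sigma_+\otimes\pi^j(F)+\sigma_-\otimes\pi^j(E)\big)+xq^{\frac12(\mathbb{I}+\sigma_z\otimes\pi^j(H))}-x^{-1}q^{-\frac12(\mathbb{I}+\sigma_z\otimes\pi^j(H))}\Big).$$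 **Fusion maps.** $\mathcal{E}^{(j+\frac12)}:\mathbb{C}^{2j+2}\to\mathbb{C}^2\otimes\mathbb{C}^{2j+1}$ is $$\mathcal{E}^{(j+\frac12)}|j+\tfrac12,j+\tfrac12-i\rangle=e_i\,|{\uparrow}\rangle\otimes|j,j-i\rangle+f_i\,|{\downarrow}\rangle\otimes|j,j-i+1\rangle,\qquad 0\le i\le 2j+1,$$ $$e_i=\prod_{p=0}^{i-1}\frac{B_{j,j-p}}{B_{j+\frac12,j+\frac12-p}}\ (0\le i\le 2j),\quad e_{2j+1}=0,\qquad f_0=0,\quad f_i=\frac{[i]_q\,e_{i-1}}{B_{j+\frac12,j+\frac32-i}}\ (1\le i\le 2j+1),$$ and $\mathcal{F}^{(j+\frac12)}:\mathbb{C}^2\otimes\mathbb{C}^{2j+1}\to\mathbb{C}^{2j+2}$ is its left inverse whose matrix elements from $|{\uparrow}\rangle\otimes|j,j-i\rangle$ and $|{\downarrow}\rangle\otimes|j,j-i+1\rangle$ to $|j+\frac12,j+\frac12-i\rangle$ are $\frac{e_i}{e_i^2+f_i^2}$ and $\frac{f_i}{e_i^2+f_i^2}$ respectively, all others being zero. **Fused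 K-operators.** With $X_1=X\otimes\mathbb{I}$, $X_2=\mathbb{I}\otimes X$ and $\widehat{\mathcal{K}}^{(\frac12)}=\mathcal{K}^{(\frac12)}$, define for $j\in\frac12\mathbb{N}_+$ $$\mathcal{K}^{(j+\frac12)}(x)=\mathcal{F}^{(j+\frac12)}\mathcal{K}^{(\frac12)}_1(xq^{-j})R^{(\frac12,j)}(x^2q^{-j+\frac12})\mathcal{K}^{(j)}_2(xq^{\frac12})\mathcal{E}^{(j+\frac12)},$$ $$\widehat{\mathcal{K}}^{(j+\frac12)}(x)=\mathcal{F}^{(j+\frac12)}\widehat{\mathcal{K}}^{(j)}_2(xq^{-\frac12})R^{(\frac12,j)}(x^2q^{j-\frac12})\widehat{\mathcal{K}}^{(\frac12)}_1(xq^{j})\mathcal{E}^{(j+\frac12)},$$ and let the quantum determinant be $$\Gamma(x)=\mathrm{tr}_{12}\big(\mathcal{P}^-\,\mathcal{K}^{(\frac12)}_1(x)\,R^{(\frac12,\frac12)}(qx^2)\,\mathcal{K}^{(\frac12)}_2(xq)\big),\qquad \mathcal{P}^-=\tfrac12(1-\mathcal{P}),$$ where $\mathcal{P}$ is the flip of $\mathbb{C}^2\otimes\mathbb{C}^2$.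 **Proposition (unitarity).** For every $j\in\frac12\mathbb{N}_+$, in $\mathcal{A}_q((u^{-1}))\otimes\mathrm{End}(\mathbb{C}^{2j+1})$, $$\mathcal{K}^{(j)}(u)\,\widehat{\mathcal{K}}^{(j)}(u^{-1})=\left(\prod_{k=0}^{2j-1}\frac{\Gamma(uq^{-j-\frac12+k})}{c(u^{-2}q^{2j-1-2k})}\right)\left(\prod_{k=0}^{2j-2}\ \prod_{\ell=0}^{2j-k-2}c(u^2q^{2j-1-2k-\ell})\,c(u^{-2}q^{1-k+\ell})\right)\mathbb{I}_{2j+1}=\widehat{\mathcal{K}}^{(j)}(u^{-1})\,\mathcal{K}^{(j)}(u).$$ Moreover $\mathcal{K}^{(j)}(u)$ is invertible in $\mathcal{A}_q((u^{-1}))\otimes\mathrm{End}(\mathbb{C}^{2j+1})$, and its inverse lies in $\mathcal{A}_q[[u^{-1}]]\otimes\mathrm{End}(\mathbb{C}^{2j+1})$. -/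

import Mathlib

open scoped Kronecker

noncomputable section

namespace FusedK

/-! ### The algebra `A_q`

Throughout, `s` is a chosen square root `q^{1/2}` of `q`, so that `q = s ^ 2`, and half-integer
powers of `q` are integer powers of `s`. -/

/-- The deformation parameter `q`, in terms of its chosen square root `s = q^{1/2}`. -/
def qq (s : ℂ) : ℂ := s ^ 2

/-- `ρ = k₊ k₋ (q + q⁻¹)²`. -/
def rho (s kp km : ℂ) : ℂ := kp * km * (qq s + (qq s)⁻¹) ^ 2

/-- The alternating generators. `W true k` is `W_{-k}`, `W false k` is `W_{k+1}`,
`G true k` is `G_{k+1}` and `G false k` is `G̃_{k+1}`  (`k = 0, 1, 2, …`). The Boolean is the sign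
`±` of the generating function in which the generator occurs. -/
inductive Gen : Type
  | W (e : Bool) (k : ℕ) : Gen
  | G (e : Bool) (k : ℕ) : Gen

/-- The free associative unital complex algebra on the alternating generators. -/
abbrev Free : Type := FreeAlgebra ℂ Gen

/-- Formal power series over the free algebra in two central variables `U⁻¹` (the variable of the
inner ring) and `V⁻¹` (the variable of the outer ring). -/
abbrev Ser : Type := PowerSeries (PowerSeries Free)

/-- The variable `U⁻¹`. -/
def Ui : Ser := PowerSeries.C PowerSeries.X

/-- The variable `V⁻¹`. -/
def Vi : Ser := PowerSeries.X

/-- The generating function `W_±(u) = ∑_k W U^{-k-1}`. -/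
def Wu (e : Bool) : Ser :=
  PowerSeries.C (PowerSeries.X * PowerSeries.mk fun k => FreeAlgebra.ι ℂ (Gen.W e k))

/-- The generating function `G_±(u) = ∑_k G U^{-k-1}`. -/
def Gu (e : Bool) : Ser :=
  PowerSeries.C (PowerSeries.X * PowerSeries.mk fun k => FreeAlgebra.ι ℂ (Gen.G e k))

/-- The generating function `W_±(v) = ∑_k W V^{-k-1}`. -/
def Wv (e : Bool) : Ser :=
  PowerSeries.X * PowerSeries.mk fun k => PowerSeries.C (FreeAlgebra.ι ℂ (Gen.W e k))

/-- The generating function `G_±(v) = ∑_k G V^{-k-1}`. -/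
def Gv (e : Bool) : Ser :=
  PowerSeries.X * PowerSeries.mk fun k => PowerSeries.C (FreeAlgebra.ι ℂ (Gen.G e k))

/-- The commutator `[X, Y]`. -/
def comm {S : Type*} [Ring S] (X Y : S) : S := X * Y - Y * X

/-- The `q`-commutator `[X, Y]_q = q X Y - q⁻¹ Y X`. -/
def qcomm {S : Type*} [Ring S] [Module ℂ S] (q : ℂ) (X Y : S) : S :=
  q • (X * Y) - q⁻¹ • (Y * X)

/-- The defining relations of `A_q` for the generating functions, each written as a series that has
to vanish; `e` is the sign `±` and `!e` the opposite sign. They are the explicit form of the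
reflection equation. Relations that contain `U`, `V` are multiplied by `U⁻¹ V⁻¹`, and the seventh
one, which contains `(1 - U V) / (U - V)`, by `U⁻¹ V⁻¹ (U - V)`. -/
inductive IsRelator (s kp km : ℂ) : Ser → Prop
  | r1 (e : Bool) : IsRelator s kp km (comm (Wu e) (Wv e))
  | r2 : IsRelator s kp km (comm (Wu true) (Wv false) + comm (Wu false) (Wv true))
  | r3 (d e : Bool) : IsRelator s kp km (comm (Gu d) (Wv e) + comm (Wu e) (Gv d))
  | r4 (e : Bool) : IsRelator s kp km (comm (Gu e) (Gv e))
  | r5 : IsRelator s kp km (comm (Gu true) (Gv false) + comm (Gu false) (Gv true))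
  | r6 (e : Bool) : IsRelator s kp km
      ((Vi - Ui) * comm (Wu e) (Wv (!e))
        - Ui * Vi *
          (((qq s - (qq s)⁻¹) / (rho s kp km * (qq s + (qq s)⁻¹))) •
              (Gu e * Gv (!e) - Gv e * Gu (!e))
            + (1 / (qq s + (qq s)⁻¹)) • (Gu e - Gu (!e) + Gv (!e) - Gv e)))
  | r7 (e : Bool) : IsRelator s kp km
      ((Vi - Ui) *
          (Wu e * Wv e - Wu (!e) * Wv (!e)
            + (1 / (rho s kp km * (qq s ^ 2 - (qq s)⁻¹ ^ 2))) • comm (Gu e) (Gv (!e)))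
        + (Ui * Vi - 1) * (Wu e * Wv (!e) - Wv e * Wu (!e)))
  | r8 (e : Bool) : IsRelator s kp km
      (Vi * qcomm (qq s) (Gv (!e)) (Wu e) - Ui * qcomm (qq s) (Gu (!e)) (Wv e)
        - (qq s - (qq s)⁻¹) • (Ui * Vi * (Wu (!e) * Gv (!e) - Wv (!e) * Gu (!e)))
        + rho s kp km • (Vi * Wu e - Ui * Wv e - Ui * Vi * Wu (!e) + Ui * Vi * Wv (!e)))
  | r9 (e : Bool) : IsRelator s kp km
      (Vi * qcomm (qq s) (Wu (!e)) (Gv (!e)) - Ui * qcomm (qq s) (Wv (!e)) (Gu (!e))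
        - (qq s - (qq s)⁻¹) • (Ui * Vi * (Wu e * Gv (!e) - Wv e * Gu (!e)))
        + rho s kp km • (Vi * Wu (!e) - Ui * Wv (!e) - Ui * Vi * Wu e + Ui * Vi * Wv e))

/-- Every coefficient of every relator is set to zero. -/
inductive Rel (s kp km : ℂ) : Free → Free → Prop
  | coeff (f : Ser) (hf : IsRelator s kp km f) (i j : ℕ) :
      Rel s kp km (PowerSeries.coeff i (PowerSeries.coeff j f)) 0

/-- The algebra `A_q` (the alternating central extension of the `q`-Onsager algebra). -/
abbrev Aq (s kp km : ℂ) : Type := RingQuot (Rel s kp km)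

/-- The generators `W_{-k}` (`e = true`) and `W_{k+1}` (`e = false`) of `A_q`. -/
def genW (s kp km : ℂ) (e : Bool) (k : ℕ) : Aq s kp km :=
  RingQuot.mkAlgHom ℂ (Rel s kp km) (FreeAlgebra.ι ℂ (Gen.W e k))

/-- The generators `G_{k+1}` (`e = true`) and `G̃_{k+1}` (`e = false`) of `A_q`. -/
def genG (s kp km : ℂ) (e : Bool) (k : ℕ) : Aq s kp km :=
  RingQuot.mkAlgHom ℂ (Rel s kp km) (FreeAlgebra.ι ℂ (Gen.G e k))

/-! ### Laurent series in `u⁻¹`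

The variable of all Laurent series below is `u⁻¹`. A spectral parameter is an element of
`ℂ((u⁻¹))`; only the monomials `a u` and `a u⁻¹` with `a ≠ 0` (and, for the R-matrices, `a u²` and
`a u⁻²`) are ever used. All rational functions are expanded in `u⁻¹`, that is, they are computed in
the field `ℂ((u⁻¹))`. -/

/-- The field `ℂ((u⁻¹))`. -/
abbrev Sc : Type := LaurentSeries ℂ

/-- The ring `A_q((u⁻¹))`. -/
abbrev AqL (s kp km : ℂ) : Type := LaurentSeries (Aq s kp km)

/-- The spectral parameter `u` itself. -/
def u : Sc := HahnSeries.single (-1) 1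

/-- A complex constant as an element of `ℂ((u⁻¹))`. -/
def cst (a : ℂ) : Sc := HahnSeries.C a

/-- The inclusion `ℂ((u⁻¹)) ⊆ A_q((u⁻¹))`. -/
def toAq (s kp km : ℂ) (f : Sc) : AqL s kp km := f.map (algebraMap ℂ (Aq s kp km))

/-- `c(x) = x - x⁻¹`. -/
def c (x : Sc) : Sc := x - x⁻¹

/-- `U(x) = (q x² + q⁻¹ x⁻²) / (q + q⁻¹)`. -/
def U (s : ℂ) (x : Sc) : Sc :=
  (cst (qq s) * x ^ 2 + cst (qq s)⁻¹ * (x ^ 2)⁻¹) / cst (qq s + (qq s)⁻¹)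

/-- The series `∑_k w_k y^{k+1}` in `A_q((u⁻¹))`, for `y` a scalar series without constant term and
without positive powers of `u`: only the terms with `k < n` contribute to the coefficient of
`u^{-n}`. It is applied to `y = U(x)⁻¹`, where `x` is `a u` or `a u⁻¹`, so that `y` starts with
`u⁻²`. -/
def genAt (s kp km : ℂ) (w : ℕ → Aq s kp km) (y : Sc) : AqL s kp km :=
  HahnSeries.ofPowerSeries ℤ (Aq s kp km) (PowerSeries.mk fun n =>
    ∑ k ∈ Finset.range n, ((y ^ (k + 1)).coeff (n : ℤ)) • w k)

/-- `W_±(x)`. -/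
def Wx (s kp km : ℂ) (e : Bool) (x : Sc) : AqL s kp km :=
  genAt s kp km (genW s kp km e) (U s x)⁻¹

/-- `G_±(x)`. -/
def Gx (s kp km : ℂ) (e : Bool) (x : Sc) : AqL s kp km :=
  genAt s kp km (genG s kp km e) (U s x)⁻¹

/-- The fundamental K-operator `K^{(1/2)}(x)`. -/
def Khalf (s kp km : ℂ) (x : Sc) : Matrix (Fin 2) (Fin 2) (AqL s kp km) :=
  let q := qq s
  let sc : Sc → AqL s kp km := toAq s kp km
  !![sc (cst q * x) * Wx s kp km true x - sc ((cst q * x)⁻¹) * Wx s kp km false x,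
     sc (cst (1 / (km * (q + q⁻¹)))) * Gx s kp km true x
       + sc (cst (kp * (q + q⁻¹) / (q - q⁻¹)));
     sc (cst (1 / (kp * (q + q⁻¹)))) * Gx s kp km false x
       + sc (cst (km * (q + q⁻¹) / (q - q⁻¹))),
     sc (cst q * x) * Wx s kp km false x - sc ((cst q * x)⁻¹) * Wx s kp km true x]

/-! ### Fusion maps and R-matrices

A spin `j` is encoded by `n = 2j`. The space `ℂ^{2j+1}` has the basis
`|j, j⟩, |j, j-1⟩, …, |j, -j⟩`, indexed by `p : Fin (n + 1)` (`p` stands for `|j, j-p⟩`), and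
`ℂ² ⊗ ℂ^{2j+1}` has the product basis, indexed by `Fin 2 × Fin (n + 1)` (`0` is `↑`, `1` is `↓`). -/

/-- The `q`-number `[m]_q`. -/
def qnum (s : ℂ) (m : ℤ) : ℂ := (qq s ^ m - qq s ^ (-m)) / (qq s - (qq s)⁻¹)

/-- The coefficient `B_{j,j-p} = √([2j-p]_q [p+1]_q)` with `n = 2j`, for the principal branch of
the square root. It is also equal to the coefficient `A_{j,j-p-1}`. -/
def B (s : ℂ) (n p : ℕ) : ℂ := (qnum s (n - p) * qnum s (p + 1)) ^ (1 / 2 : ℂ)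

/-- The matrix `π^j(F)`: `F |j,m⟩ = B_{j,m} |j,m-1⟩`. -/
def piF (s : ℂ) (n : ℕ) : Matrix (Fin (n + 1)) (Fin (n + 1)) ℂ :=
  Matrix.of fun a b => if (a : ℕ) = b + 1 then B s n b else 0

/-- The matrix `π^j(E)`: `E |j,m⟩ = A_{j,m} |j,m+1⟩`. -/
def piE (s : ℂ) (n : ℕ) : Matrix (Fin (n + 1)) (Fin (n + 1)) ℂ :=
  Matrix.of fun a b => if (b : ℕ) = a + 1 then B s n a else 0

/-- The entry of `𝓔^{(j+1/2)}` that sends `|j+1/2, j+1/2-i⟩` to `↑ ⊗ |j, j-i⟩`. -/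
def eUp (s : ℂ) (n i : ℕ) : ℂ := ∏ p ∈ Finset.range i, B s n p / B s (n + 1) p

/-- The entry of `𝓔^{(j+1/2)}` that sends `|j+1/2, j+1/2-m⟩` to `↓ ⊗ |j, j-(m-1)⟩`, for `m ≥ 1`. -/
def eDown (s : ℂ) (n m : ℕ) : ℂ := qnum s m * eUp s n (m - 1) / B s (n + 1) (m - 1)

/-- The intertwiner `𝓔^{(j+1/2)} : ℂ^{2j+2} → ℂ² ⊗ ℂ^{2j+1}`, `n = 2j`. -/
def calE (s : ℂ) (n : ℕ) : Matrix (Fin 2 × Fin (n + 1)) (Fin (n + 2)) ℂ :=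
  Matrix.of fun a b =>
    if a.1 = 0 then (if (b : ℕ) = a.2 then eUp s n b else 0)
    else (if (b : ℕ) = a.2 + 1 then eDown s n b else 0)

/-- The non-zero entry of `𝓕^{(j+1/2)}` in row `|j+1/2, j+1/2-r⟩` and a column `↓ ⊗ …`,
for `1 ≤ r ≤ 2j+1`. -/
def fDown (s : ℂ) (n r : ℕ) : ℂ :=
  if r = n + 1 then (eDown s n r)⁻¹
  else eDown s n r / (eUp s n r ^ 2 + eDown s n r ^ 2)

/-- The non-zero entry of `𝓕^{(j+1/2)}` in row `|j+1/2, j+1/2-r⟩` and a column `↑ ⊗ …`,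
for `0 ≤ r ≤ 2j`. -/
def fUp (s : ℂ) (n r : ℕ) : ℂ :=
  if r = 0 then 1 else (1 - fDown s n r * eDown s n r) / eUp s n r

/-- The pseudo-inverse `𝓕^{(j+1/2)} : ℂ² ⊗ ℂ^{2j+1} → ℂ^{2j+2}` of `𝓔^{(j+1/2)}`, `n = 2j`. -/
def calF (s : ℂ) (n : ℕ) : Matrix (Fin (n + 2)) (Fin 2 × Fin (n + 1)) ℂ :=
  Matrix.of fun b a =>
    if a.1 = 0 then (if (b : ℕ) = a.2 then fUp s n b else 0)
    else (if (b : ℕ) = a.2 + 1 then fDown s n b else 0)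

/-- `σ₊`. -/
def sigmaP : Matrix (Fin 2) (Fin 2) ℂ := !![0, 1; 0, 0]

/-- `σ₋`. -/
def sigmaM : Matrix (Fin 2) (Fin 2) ℂ := !![0, 0; 1, 0]

/-- The diagonal entry of `(𝕀 + σ_z ⊗ π^j(H))`, where `π^j(H) |j,j-p⟩ = (2j - 2p) |j,j-p⟩`. -/
def hexp (n : ℕ) (a : Fin 2 × Fin (n + 1)) : ℤ :=
  1 + (if a.1 = 0 then 1 else -1) * ((n : ℤ) - 2 * (a.2 : ℕ))

/-- The R-matrix `R^{(1/2,j)}(x)`, `n = 2j ≥ 1`: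
`∏_{k=0}^{2j-2} c(x q^{j-1/2-k})` times
`(q-q⁻¹)(σ₊ ⊗ π^j(F) + σ₋ ⊗ π^j(E)) + x q^{(𝕀+σ_z⊗π^j(H))/2} - x⁻¹ q^{-(𝕀+σ_z⊗π^j(H))/2}`. -/
def Rhalf (s : ℂ) (n : ℕ) (x : Sc) : Matrix (Fin 2 × Fin (n + 1)) (Fin 2 × Fin (n + 1)) Sc :=
  (∏ k ∈ Finset.range (n - 1), c (cst (s ^ ((n : ℤ) - 1 - 2 * k)) * x)) •
    (((qq s - (qq s)⁻¹) • (sigmaP ⊗ₖ piF s n + sigmaM ⊗ₖ piE s n)).map cst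
      + Matrix.diagonal fun a => x * cst (s ^ hexp n a) - x⁻¹ * cst (s ^ (-hexp n a)))

/-! ### Fused K-operators -/

/-- `X₁ = X ⊗ 𝕀` for an operator `X` on `ℂ²`. -/
def leg1 {S : Type*} [Ring S] (n : ℕ) (X : Matrix (Fin 2) (Fin 2) S) :
    Matrix (Fin 2 × Fin (n + 1)) (Fin 2 × Fin (n + 1)) S :=
  X ⊗ₖ (1 : Matrix (Fin (n + 1)) (Fin (n + 1)) S)

/-- `X₂ = 𝕀 ⊗ X` for an operator `X` on `ℂ^{2j+1}`. -/
def leg2 {S : Type*} [Ring S] (n : ℕ) (X : Matrix (Fin (n + 1)) (Fin (n + 1)) S) :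
    Matrix (Fin 2 × Fin (n + 1)) (Fin 2 × Fin (n + 1)) S :=
  (1 : Matrix (Fin 2) (Fin 2) S) ⊗ₖ X

/-- A matrix of complex numbers as a matrix over `A_q((u⁻¹))`. -/
def liftC {m k : Type*} (s kp km : ℂ) (X : Matrix m k ℂ) : Matrix m k (AqL s kp km) :=
  X.map fun a => toAq s kp km (cst a)

/-- A matrix over `ℂ((u⁻¹))` as a matrix over `A_q((u⁻¹))`. -/
def liftS {m k : Type*} (s kp km : ℂ) (X : Matrix m k Sc) : Matrix m k (AqL s kp km) :=
  X.map (toAq s kp km)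

/-- The fused K-operator `K^{(j)}(x)`, `n = 2j`:
`K^{(j+1/2)}(x) = 𝓕 K₁^{(1/2)}(x q^{-j}) R^{(1/2,j)}(x² q^{-j+1/2}) K₂^{(j)}(x q^{1/2}) 𝓔`.
The value at `n = 0` (spin zero) is the identity and is not used. -/
def Kop (s kp km : ℂ) : (n : ℕ) → Sc → Matrix (Fin (n + 1)) (Fin (n + 1)) (AqL s kp km)
  | 0, _ => 1
  | 1, x => Khalf s kp km x
  | n + 2, x =>
      liftC s kp km (calF s (n + 1))
        * leg1 (n + 1) (Khalf s kp km (x * cst (s ^ (-((n : ℤ) + 1)))))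
        * liftS s kp km (Rhalf s (n + 1) (x ^ 2 * cst (s ^ (-((n : ℤ) + 1) + 1))))
        * leg2 (n + 1) (Kop s kp km (n + 1) (x * cst s))
        * liftC s kp km (calE s (n + 1))

/-- The operator `K̂^{(j)}(x)` fused in the opposite order, `n = 2j`:
`K̂^{(j+1/2)}(x) = 𝓕 K̂₂^{(j)}(x q^{-1/2}) R^{(1/2,j)}(x² q^{j-1/2}) K̂₁^{(1/2)}(x q^j) 𝓔`. -/
def Khat (s kp km : ℂ) : (n : ℕ) → Sc → Matrix (Fin (n + 1)) (Fin (n + 1)) (AqL s kp km)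
  | 0, _ => 1
  | 1, x => Khalf s kp km x
  | n + 2, x =>
      liftC s kp km (calF s (n + 1))
        * leg2 (n + 1) (Khat s kp km (n + 1) (x * cst s⁻¹))
        * liftS s kp km (Rhalf s (n + 1) (x ^ 2 * cst (s ^ (((n : ℤ) + 1) - 1))))
        * leg1 (n + 1) (Khalf s kp km (x * cst (s ^ ((n : ℤ) + 1))))
        * liftC s kp km (calE s (n + 1))

/-- The projector `P⁻ = (1 - P) / 2` on `ℂ² ⊗ ℂ²`, where `P` is the flip. -/
def projM : Matrix (Fin 2 × Fin 2) (Fin 2 × Fin 2) ℂ :=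
  (1 / 2 : ℂ) • (1 - Matrix.of fun a b => if a = b.swap then 1 else 0)

/-- The quantum determinant `Γ(x) = tr₁₂ (P⁻ K₁^{(1/2)}(x) R^{(1/2,1/2)}(q x²) K₂^{(1/2)}(x q))`. -/
def Gam (s kp km : ℂ) (x : Sc) : AqL s kp km :=
  Matrix.trace (liftC s kp km projM
    * leg1 1 (Khalf s kp km x)
    * liftS s kp km (Rhalf s 1 (cst (qq s) * x ^ 2))
    * leg2 1 (Khalf s kp km (x * cst (qq s))))

/-- The first factor `∏_{k=0}^{2j-1} Γ(u q^{-j-1/2+k}) / c(u^{-2} q^{2j-1-2k})` of the unitarity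
scalar (the factors are multiplied in increasing order of `k`), `n = 2j`. -/
def gammaProd (s kp km : ℂ) (n : ℕ) : AqL s kp km :=
  ((List.range n).map fun k =>
    Gam s kp km (u * cst (s ^ (-(n : ℤ) - 1 + 2 * k)))
      * toAq s kp km (c ((u ^ 2)⁻¹ * cst (qq s ^ ((n : ℤ) - 1 - 2 * k))))⁻¹).prod

/-- The second factor
`∏_{k=0}^{2j-2} ∏_{ℓ=0}^{2j-k-2} c(u² q^{2j-1-2k-ℓ}) c(u^{-2} q^{1-k+ℓ})` of the unitarity scalar,
`n = 2j`. -/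
def cProd (s : ℂ) (n : ℕ) : Sc :=
  ∏ k ∈ Finset.range (n - 1), ∏ l ∈ Finset.range (n - 1 - k),
    c (u ^ 2 * cst (qq s ^ ((n : ℤ) - 1 - 2 * k - l)))
      * c ((u ^ 2)⁻¹ * cst (qq s ^ ((1 : ℤ) - k + l)))

/-- A matrix over `A_q[[u⁻¹]]` as a matrix over `A_q((u⁻¹))`. -/
def liftP {m k : Type*} (s kp km : ℂ) (X : Matrix m k (PowerSeries (Aq s kp km))) :
    Matrix m k (AqL s kp km) :=
  X.map (HahnSeries.ofPowerSeries ℤ (Aq s kp km))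

end FusedK

end

/-! Write `n = 2j` and `q = s²`. Unitarity is proved by induction on `n`. For spin 1/2 the relations
of `A_q`, taken at two points, give the reflection equation for the fundamental K-operator
(`RelAt.reflection`). Taken at `x` and `x⁻¹`, they also say that `K(x) K(x⁻¹) = K(x⁻¹) K(x)` is the
scalar `γ(x) = Γ(x q⁻¹) / c(x⁻²)` (`Generic.Khalf_mul_inv`).

In the inductive step `K(u) K̂(u⁻¹)` has the form `𝓕 (K₁ R K₂) 𝓔 𝓕 (K̂₂ R' K̂₁) 𝓔`. If the middle `𝓔
𝓕` can be dropped, the product collapses from the inside: `K₂ K̂₂` is a scalar by induction, `R R'`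
by unitarity of the R-matrix, and `K₁ K̂₁` by the case of spin 1/2. Dropping `𝓔 𝓕` is allowed once
`K̂₂ R' K̂₁` preserves the image of `𝓔`; for the product in the other order, `K₁ R K₂` has to
preserve it. This image is both the kernel of the Lax operator at `s^{-(n+1)}` and the image of the
Lax operator at `s^{n+1}` (`Gauge.exists_sub_eq_mul`, `Gauge.exists_eq_mul`). The reflection
equation at exactly these ratios of spectral parameters intertwines the product with its reversal
through the degenerate Lax operator, and so forces the invariance. What is needed is therefore the
reflection equation between the fundamental and the fused K-operators (`Generic.reflects_Kop`,
`Generic.reflects_Khat`), which itself follows by induction from the Yang–Baxter equation and the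
fusion of Lax operators.

The collapse also needs the scalars to be central. The reflection equation shows that `γ(x)`
commutes with `K(y)`. Taking `y = u^{-m}` with `m` growing replaces an independent second spectral
parameter and separates the generators of `A_q` one at a time (`Generic.commute_C_of_genAt`), so
that `γ` is central (`Generic.gam_mul_comm`).

For the inverse, degrees in `u⁻¹` are counted. The series `γ` has an invertible constant term, hence
the unitarity scalar has an inverse without terms below degree `n(n-1)`, while `K̂(u⁻¹)` has no
terms below degree `-n(n-1)`. Their product is the inverse of `K(u)` and has no positive powers of
`u` (`Generic.exists_inverse_Kop`).

All R-matrix identities are checked in a basis without square roots and carried to the given basis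
by a diagonal change of basis (`Generic.gauge`). -/

noncomputable section

namespace FusedK

/-! ### Reflection equation and quantum determinant for spin 1/2 -/

section Base

variable {k A : Type*} [Field k] [Ring A] [Algebra k A]

/-- The defining relations of `A_q` between the values of the generating functions at two points,
with the off-diagonal entries of the K-operator in place of the series `G_±`. -/
structure RelAt (q U V : k) (wp wm b c wp' wm' b' c' : A) : Prop where
  wpwp : wp * wp' - wp' * wp = 0
  wmwm : wm * wm' - wm' * wm = 0
  wpwm : wp * wm' - wm' * wp + (wm * wp' - wp' * wm) = 0
  bwp : b * wp' - wp' * b + (wp * b' - b' * wp) = 0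
  bwm : b * wm' - wm' * b + (wm * b' - b' * wm) = 0
  cwp : c * wp' - wp' * c + (wp * c' - c' * wp) = 0
  cwm : c * wm' - wm' * c + (wm * c' - c' * wm) = 0
  bb : b * b' - b' * b = 0
  cc : c * c' - c' * c = 0
  bc : b * c' - c' * b + (c * b' - b' * c) = 0
  six : (U - V) • (wp * wm' - wm' * wp) - ((q - q⁻¹) / (q + q⁻¹)) • (b * c' - b' * c) = 0
  seven : (U - V) • (wp * wp' - wm * wm' + (1 / ((q - q⁻¹) * (q + q⁻¹))) • (b * c' - c' * b))
    + (1 - U * V) • (wp * wm' - wp' * wm) = 0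
  eightp : U • (q • (c' * wp) - q⁻¹ • (wp * c')) - V • (q • (c * wp') - q⁻¹ • (wp' * c))
    - (q - q⁻¹) • (wm * c' - wm' * c) = 0
  eightm : U • (q • (b' * wm) - q⁻¹ • (wm * b')) - V • (q • (b * wm') - q⁻¹ • (wm' * b))
    - (q - q⁻¹) • (wp * b' - wp' * b) = 0
  ninep : U • (q • (wm * c') - q⁻¹ • (c' * wm)) - V • (q • (wm' * c) - q⁻¹ • (c * wm'))
    - (q - q⁻¹) • (wp * c' - wp' * c) = 0
  ninem : U • (q • (wp * b') - q⁻¹ • (b' * wp)) - V • (q • (wp' * b) - q⁻¹ • (b * wp'))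
    - (q - q⁻¹) • (wm * b' - wm' * b) = 0

/-- The R-matrix of the six-vertex model. -/
def sixVertex (q x : k) : Matrix (Fin 2 × Fin 2) (Fin 2 × Fin 2) k :=
  Matrix.of fun a b =>
    if a = b then (if a.1 = a.2 then q * x - (q * x)⁻¹ else x - x⁻¹)
    else if a = b.swap then q - q⁻¹ else 0

/-- The 2 × 2 K-operator with spectral parameter `x`. -/
def kmat (q x : k) (wp wm b c : A) : Matrix (Fin 2) (Fin 2) A :=
  !![(q * x) • wp - (q * x)⁻¹ • wm, b; c, (q * x) • wm - (q * x)⁻¹ • wp]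

/-- The function `U(x)`. -/
def ufun (q x : k) : k := (q * x ^ 2 + q⁻¹ * (x ^ 2)⁻¹) / (q + q⁻¹)

-- Each of the sixteen entries is a linear combination of the relations, with coefficients that are
-- Laurent polynomials in `q`, `x`, `y`. The displayed coefficients solve the linear systems
-- obtained by comparing noncommutative monomials; `match_scalars` makes this comparison and leaves
-- identities of rational functions.
set_option maxHeartbeats 4000000 in
theorem RelAt.reflection {q x y : k} (hq : q ≠ 0) (hq1 : q ^ 2 + 1 ≠ 0) (hq2 : q ^ 2 - 1 ≠ 0)
    (hx : x ≠ 0) (hy : y ≠ 0) {wp wm b c wp' wm' b' c' : A}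
    (h : RelAt q (ufun q x) (ufun q y) wp wm b c wp' wm' b' c') :
    (sixVertex q (x / y)).map (algebraMap k A) * leg1 1 (kmat q x wp wm b c)
        * (sixVertex q (x * y)).map (algebraMap k A) * leg2 1 (kmat q y wp' wm' b' c')
      = leg2 1 (kmat q y wp' wm' b' c') * (sixVertex q (x * y)).map (algebraMap k A)
        * leg1 1 (kmat q x wp wm b c) * (sixVertex q (x / y)).map (algebraMap k A) := by
  have h1 : ∀ (a : k) (z : A), algebraMap k A a * z = a • z := fun a z => (Algebra.smul_def a z).symm
  have h2 : ∀ (a : k) (z : A), z * algebraMap k A a = a • z := fun a z => by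
    rw [Algebra.smul_def, Algebra.commutes]
  ext ⟨i, j⟩ ⟨i', j'⟩
  fin_cases i <;> fin_cases j <;> fin_cases i' <;> fin_cases j' <;>
    simp [Matrix.mul_apply, Fintype.sum_prod_type, leg1, leg2, kmat, sixVertex, h1, h2,
      Matrix.one_apply, -map_sub, -map_mul, -map_inv₀, add_mul, mul_sub, sub_mul]
  · linear_combination (norm := skip) (x⁻¹ * y - x * y⁻¹ * q ^ 2 - x * y ^ 3 * q ^ 2 + x ^ 3 * y *
      q ^ 4) • h.wpwp + (x⁻¹ * y * q⁻¹ ^ 2 + x⁻¹ * y - x * y⁻¹ - x * y⁻¹ * q ^ 2) • h.six + (x⁻¹ ^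
      3 * y⁻¹ * q⁻¹ ^ 4 - x⁻¹ * y⁻¹ ^ 3 * q⁻¹ ^ 2 - x⁻¹ * y * q⁻¹ ^ 2 + x * y⁻¹) • h.wmwm + (-x⁻¹
      ^ 3 * y * q⁻¹ ^ 2 + x⁻¹ * y⁻¹ + x⁻¹ * y ^ 3 - x * y * q ^ 2) • h.wpwm
    match_scalars <;> (try unfold ufun) <;> field_simp <;> ring
  · linear_combination (norm := skip) (-x⁻¹ * q⁻¹ ^ 3 + x⁻¹ * q⁻¹ - x * y⁻¹ ^ 2 * q - x * y ^ 2 *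
      q) • h.bwp + (x⁻¹ * y⁻¹ ^ 2 * q⁻¹ + x⁻¹ * y ^ 2 * q⁻¹ - x * q + x * q ^ 3) • h.bwm + (x⁻¹ *
      q⁻¹ ^ 2 + x⁻¹) • h.eightm + (x + x * q ^ 2) • h.ninem
    match_scalars <;> (try unfold ufun) <;> field_simp <;> ring
  · linear_combination (norm := skip) (x⁻¹ ^ 2 * y + y⁻¹ * q⁻¹ ^ 2 - y⁻¹ * q ^ 2 + x ^ 2 * y * q ^
      2) • h.bwp + (-x⁻¹ ^ 2 * y⁻¹ * q⁻¹ ^ 2 + y * q⁻¹ ^ 2 - y * q ^ 2 - x ^ 2 * y⁻¹) • h.bwm +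
      (-y⁻¹ * q⁻¹ - y⁻¹ * q) • h.eightm + (-y * q⁻¹ - y * q) • h.ninem
    match_scalars <;> (try unfold ufun) <;> field_simp <;> ring
  · linear_combination (norm := skip) (x⁻¹ ^ 2 * q⁻¹ - y⁻¹ ^ 2 * q - y ^ 2 * q⁻¹ + x ^ 2 * q) • h.bb
    match_scalars <;> field_simp <;> ring
  · linear_combination (norm := skip) (x⁻¹ * q⁻¹ - x⁻¹ * q - x * y⁻¹ ^ 2 * q - x * y ^ 2 * q) •
      h.cwp + (-x - x * q ^ 2) • h.eightp + (-x⁻¹ * q⁻¹ ^ 2 - x⁻¹) • h.ninep + (x⁻¹ * y⁻¹ ^ 2 *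
      q⁻¹ + x⁻¹ * y ^ 2 * q⁻¹ + x * q⁻¹ - x * q) • h.cwm
    match_scalars <;> (try unfold ufun) <;> field_simp <;> ring
  · linear_combination (norm := skip) (x⁻¹ * y⁻¹ * q⁻¹ ^ 4 - x⁻¹ * y⁻¹ * 2 * q⁻¹ ^ 2 + x * y⁻¹ ^ 3
      + x * y - x ^ 3 * y⁻¹) • h.wpwp + (-x⁻¹ * y⁻¹ * q⁻¹ ^ 2 - x⁻¹ * y⁻¹ + x * y + x * y * q ^ 2)
      • h.six + (-x⁻¹ ^ 3 * y + x⁻¹ * y⁻¹ + x⁻¹ * y ^ 3 - x * y * 2 * q ^ 2 + x * y * q ^ 4) •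
      h.wmwm + (x⁻¹ ^ 3 * y⁻¹ * q⁻¹ ^ 2 - x⁻¹ * y⁻¹ ^ 3 * q⁻¹ ^ 2 - x⁻¹ * y * q⁻¹ ^ 2 + x * y⁻¹ *
      2 - x * y⁻¹ * q ^ 2) • h.wpwm + (x⁻¹ * y⁻¹ * q⁻¹ ^ 2 - x⁻¹ * y⁻¹ - x * y + x * y * q ^ 2) •
      h.bc
    match_scalars <;> (try unfold ufun) <;> field_simp <;> ring
  · linear_combination (norm := skip) (x⁻¹ ^ 2 * q⁻¹ ^ 3 - x⁻¹ ^ 2 * q⁻¹ - y⁻¹ ^ 2 * q⁻¹ ^ 3 + y⁻¹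
      ^ 2 * q + x ^ 2 * q⁻¹ - x ^ 2 * q) • h.wpwp + (-q⁻¹ ^ 3 - q⁻¹ + q + q ^ 3) • h.seven + (-x⁻¹
      ^ 2 * q⁻¹ + x⁻¹ ^ 2 * q + y ^ 2 * q⁻¹ - y ^ 2 * q ^ 3 - x ^ 2 * q + x ^ 2 * q ^ 3) • h.wmwm
      + (-x⁻¹ ^ 2 * y ^ 2 * q⁻¹ + x⁻¹ ^ 2 * y ^ 2 * q + q⁻¹ - q ^ 3 - x ^ 2 * y ^ 2 * q + x ^ 2 *
      y ^ 2 * q ^ 3) • h.wpwm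
    match_scalars <;> (try unfold ufun) <;> field_simp <;> ring
  · linear_combination (norm := skip) (-x⁻¹ ^ 2 * y⁻¹ * q⁻¹ ^ 2 - x ^ 2 * y⁻¹) • h.bwp + (x⁻¹ ^ 2
      * y + x ^ 2 * y * q ^ 2) • h.bwm + (y * q⁻¹ + y * q) • h.eightm + (y⁻¹ * q⁻¹ + y⁻¹ * q) •
      h.ninem
    match_scalars <;> (try unfold ufun) <;> field_simp <;> ring
  · linear_combination (norm := skip) (x⁻¹ ^ 2 * y + x ^ 2 * y * q ^ 2) • h.cwp + (y * q⁻¹ + y *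
      q) • h.eightp + (y⁻¹ * q⁻¹ + y⁻¹ * q) • h.ninep + (-x⁻¹ ^ 2 * y⁻¹ * q⁻¹ ^ 2 - x ^ 2 * y⁻¹) •
      h.cwm
    match_scalars <;> (try unfold ufun) <;> field_simp <;> ring
  · linear_combination (norm := skip) (-x⁻¹ ^ 2 * q⁻¹ + x⁻¹ ^ 2 * q + y ^ 2 * q⁻¹ - y ^ 2 * q ^ 3
      - x ^ 2 * q + x ^ 2 * q ^ 3) • h.wpwp + (q⁻¹ ^ 3 + q⁻¹ - q - q ^ 3) • h.seven + (x⁻¹ ^ 2 *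
      q⁻¹ ^ 3 - x⁻¹ ^ 2 * q⁻¹ - y⁻¹ ^ 2 * q⁻¹ ^ 3 + y⁻¹ ^ 2 * q + x ^ 2 * q⁻¹ - x ^ 2 * q) •
      h.wmwm + (x⁻¹ ^ 2 * y⁻¹ ^ 2 * q⁻¹ ^ 3 - x⁻¹ ^ 2 * y⁻¹ ^ 2 * q⁻¹ - q⁻¹ ^ 3 + q + x ^ 2 * y⁻¹
      ^ 2 * q⁻¹ - x ^ 2 * y⁻¹ ^ 2 * q) • h.wpwm + (x⁻¹ ^ 2 * q⁻¹ - y⁻¹ ^ 2 * q⁻¹ - y ^ 2 * q + x ^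
      2 * q) • h.bc
    match_scalars <;> (try unfold ufun) <;> field_simp <;> ring
  · linear_combination (norm := skip) (-x⁻¹ ^ 3 * y + x⁻¹ * y⁻¹ + x⁻¹ * y ^ 3 - x * y * 2 * q ^ 2
      + x * y * q ^ 4) • h.wpwp + (x⁻¹ * y⁻¹ * q⁻¹ ^ 2 + x⁻¹ * y⁻¹ - x * y - x * y * q ^ 2) •
      h.six + (x⁻¹ * y⁻¹ * q⁻¹ ^ 4 - x⁻¹ * y⁻¹ * 2 * q⁻¹ ^ 2 + x * y⁻¹ ^ 3 + x * y - x ^ 3 * y⁻¹)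
      • h.wmwm + (-x⁻¹ * y * q⁻¹ ^ 2 + x⁻¹ * y * 2 - x * y⁻¹ * q ^ 2 - x * y ^ 3 * q ^ 2 + x ^ 3 *
      y * q ^ 2) • h.wpwm
    match_scalars <;> (try unfold ufun) <;> field_simp <;> ring
  · linear_combination (norm := skip) (x⁻¹ * y⁻¹ ^ 2 * q⁻¹ + x⁻¹ * y ^ 2 * q⁻¹ + x * q⁻¹ - x * q)
      • h.bwp + (x⁻¹ * q⁻¹ - x⁻¹ * q - x * y⁻¹ ^ 2 * q - x * y ^ 2 * q) • h.bwm + (-x - x * q ^ 2)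
      • h.eightm + (-x⁻¹ * q⁻¹ ^ 2 - x⁻¹) • h.ninem
    match_scalars <;> (try unfold ufun) <;> field_simp <;> ring
  · linear_combination (norm := skip) (x⁻¹ ^ 2 * q⁻¹ - y⁻¹ ^ 2 * q - y ^ 2 * q⁻¹ + x ^ 2 * q) • h.cc
    match_scalars <;> field_simp <;> ring
  · linear_combination (norm := skip) (-x⁻¹ ^ 2 * y⁻¹ * q⁻¹ ^ 2 + y * q⁻¹ ^ 2 - y * q ^ 2 - x ^ 2
      * y⁻¹) • h.cwp + (-y⁻¹ * q⁻¹ - y⁻¹ * q) • h.eightp + (-y * q⁻¹ - y * q) • h.ninep + (x⁻¹ ^ 2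
      * y + y⁻¹ * q⁻¹ ^ 2 - y⁻¹ * q ^ 2 + x ^ 2 * y * q ^ 2) • h.cwm
    match_scalars <;> (try unfold ufun) <;> field_simp <;> ring
  · linear_combination (norm := skip) (x⁻¹ * y⁻¹ ^ 2 * q⁻¹ + x⁻¹ * y ^ 2 * q⁻¹ - x * q + x * q ^
      3) • h.cwp + (x⁻¹ * q⁻¹ ^ 2 + x⁻¹) • h.eightp + (x + x * q ^ 2) • h.ninep + (-x⁻¹ * q⁻¹ ^ 3
      + x⁻¹ * q⁻¹ - x * y⁻¹ ^ 2 * q - x * y ^ 2 * q) • h.cwm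
    match_scalars <;> (try unfold ufun) <;> field_simp <;> ring
  · linear_combination (norm := skip) (x⁻¹ ^ 3 * y⁻¹ * q⁻¹ ^ 4 - x⁻¹ * y⁻¹ ^ 3 * q⁻¹ ^ 2 - x⁻¹ * y
      * q⁻¹ ^ 2 + x * y⁻¹) • h.wpwp + (-x⁻¹ * y * q⁻¹ ^ 2 - x⁻¹ * y + x * y⁻¹ + x * y⁻¹ * q ^ 2) •
      h.six + (x⁻¹ * y - x * y⁻¹ * q ^ 2 - x * y ^ 3 * q ^ 2 + x ^ 3 * y * q ^ 4) • h.wmwm + (-x⁻¹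
      * y⁻¹ * q⁻¹ ^ 2 + x * y⁻¹ ^ 3 + x * y - x ^ 3 * y⁻¹ * q ^ 2) • h.wpwm + (x⁻¹ * y * q⁻¹ ^ 2 -
      x⁻¹ * y - x * y⁻¹ + x * y⁻¹ * q ^ 2) • h.bc
    match_scalars <;> (try unfold ufun) <;> field_simp <;> ring

/-- The quantum determinant at `x q⁻¹`, divided by `c (x⁻²)`. -/
def qdet (q x : k) (wp wm b c wp' wm' b' c' : A) : A :=
  ((x ^ 2)⁻¹ - x ^ 2)⁻¹ •
    Matrix.trace (((1 / 2 : k) • (1 - Matrix.of fun a b => if a = b.swap then 1 else 0) :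
        Matrix (Fin 2 × Fin 2) (Fin 2 × Fin 2) k).map (algebraMap k A)
      * leg1 1 (kmat q (x * q⁻¹) wp' wm' b' c')
      * (sixVertex q (q * (x * q⁻¹) ^ 2)).map (algebraMap k A)
      * leg2 1 (kmat q x wp wm b c))

-- The relations between the points `x` and `x⁻¹` cancel the off-diagonal entries and bring both
-- diagonal entries to the trace formula. The primed series are attached to `x * q⁻¹` in `qdet` and
-- to `x⁻¹` here; this is consistent because `U(x q⁻¹) = U(x⁻¹)`. The condition on `x ^ 4` makes `x²
-- - x⁻²` invertible.
set_option maxHeartbeats 4000000 in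
theorem RelAt.kmat_mul_kmat_inv {q x : k} (h2 : (2 : k) ≠ 0) (hq : q ≠ 0) (hq1 : q ^ 2 + 1 ≠ 0)
    (hq2 : q ^ 2 - 1 ≠ 0) (hx : x ≠ 0) (hx4 : x ^ 4 - 1 ≠ 0) {wp wm b c wp' wm' b' c' : A}
    (h : RelAt q (ufun q x) (ufun q x⁻¹) wp wm b c wp' wm' b' c') :
    kmat q x wp wm b c * kmat q x⁻¹ wp' wm' b' c'
      = Matrix.scalar (Fin 2) (qdet q x wp wm b c wp' wm' b' c') := by
  have h1 : ∀ (a : k) (z : A), algebraMap k A a * z = a • z := fun a z => (Algebra.smul_def a z).symm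
  have h2 : ∀ (a : k) (z : A), z * algebraMap k A a = a • z := fun a z => by
    rw [Algebra.smul_def, Algebra.commutes]
  have hx4' : 1 - x ^ 4 ≠ 0 := fun h0 => hx4 (by linear_combination -h0)
  ext i j
  fin_cases i <;> fin_cases j <;>
    simp [Matrix.mul_apply, Matrix.trace, Fintype.sum_prod_type, leg1, leg2, kmat, sixVertex, qdet,
      h1, h2, Matrix.one_apply, -map_sub, -map_mul, -map_inv₀, -map_div₀, add_mul, mul_sub,
      sub_mul]
  · linear_combination (norm := skip) ((1/2 * q⁻¹ ^ 2 + 1/2 * q ^ 2)) • h.wpwp + ((-1/2) * (q +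
      q⁻¹) * (q - q⁻¹)⁻¹) • h.six + ((1/2 * q⁻¹ + 1/2 * q) * ((q - q⁻¹) * (x ^ 2 - x⁻¹ ^ 2))⁻¹ *
      (q + q⁻¹) * (q - q⁻¹)) • h.seven + ((1/2 * q⁻¹ ^ 2 + 1/2 * q ^ 2)) • h.wmwm + ((-x⁻¹ ^ 2)) •
      h.wpwm
    match_scalars <;> (try unfold ufun) <;> field_simp <;> ring
  · linear_combination (norm := skip) ((-x⁻¹ * q⁻¹ ^ 2 - x ^ 3) * ((q - q⁻¹) * (x ^ 2 - x⁻¹ ^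
      2))⁻¹) • h.bwp + ((x⁻¹ ^ 3 + x * q ^ 2) * ((q - q⁻¹) * (x ^ 2 - x⁻¹ ^ 2))⁻¹) • h.bwm +
      ((x⁻¹) * ((q - q⁻¹) * (x ^ 2 - x⁻¹ ^ 2))⁻¹ * (q + q⁻¹)) • h.eightm + ((x) * ((q - q⁻¹) * (x
      ^ 2 - x⁻¹ ^ 2))⁻¹ * (q + q⁻¹)) • h.ninem
    match_scalars <;> (try unfold ufun) <;> field_simp <;> ring
  · linear_combination (norm := skip) ((x⁻¹ ^ 3 + x * q ^ 2) * ((q - q⁻¹) * (x ^ 2 - x⁻¹ ^ 2))⁻¹)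
      • h.cwp + ((x⁻¹) * ((q - q⁻¹) * (x ^ 2 - x⁻¹ ^ 2))⁻¹ * (q + q⁻¹)) • h.eightp + ((x) * ((q -
      q⁻¹) * (x ^ 2 - x⁻¹ ^ 2))⁻¹ * (q + q⁻¹)) • h.ninep + ((-x⁻¹ * q⁻¹ ^ 2 - x ^ 3) * ((q - q⁻¹)
      * (x ^ 2 - x⁻¹ ^ 2))⁻¹) • h.cwm
    match_scalars <;> (try unfold ufun) <;> field_simp <;> ring
  · linear_combination (norm := skip) ((1/2 * q⁻¹ ^ 2 + 1/2 * q ^ 2)) • h.wpwp + ((1/2) * (q +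
      q⁻¹) * (q - q⁻¹)⁻¹) • h.six + ((-1/2 * q⁻¹ - 1/2 * q) * ((q - q⁻¹) * (x ^ 2 - x⁻¹ ^ 2))⁻¹ *
      (q + q⁻¹) * (q - q⁻¹)) • h.seven + ((1/2 * q⁻¹ ^ 2 + 1/2 * q ^ 2)) • h.wmwm + ((-x ^ 2)) •
      h.wpwm + ((1)) • h.bc
    match_scalars <;> (try unfold ufun) <;> field_simp <;> ring

-- The scalar is the same for both orders of the factors, which later makes the inverse two-sided.
set_option maxHeartbeats 4000000 in
theorem RelAt.kmat_inv_mul_kmat {q x : k} (h2 : (2 : k) ≠ 0) (hq : q ≠ 0) (hq1 : q ^ 2 + 1 ≠ 0)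
    (hq2 : q ^ 2 - 1 ≠ 0) (hx : x ≠ 0) (hx4 : x ^ 4 - 1 ≠ 0) {wp wm b c wp' wm' b' c' : A}
    (h : RelAt q (ufun q x) (ufun q x⁻¹) wp wm b c wp' wm' b' c') :
    kmat q x⁻¹ wp' wm' b' c' * kmat q x wp wm b c
      = Matrix.scalar (Fin 2) (qdet q x wp wm b c wp' wm' b' c') := by
  have h1 : ∀ (a : k) (z : A), algebraMap k A a * z = a • z := fun a z => (Algebra.smul_def a z).symm
  have h2 : ∀ (a : k) (z : A), z * algebraMap k A a = a • z := fun a z => by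
    rw [Algebra.smul_def, Algebra.commutes]
  have hx4' : 1 - x ^ 4 ≠ 0 := fun h0 => hx4 (by linear_combination -h0)
  ext i j
  fin_cases i <;> fin_cases j <;>
    simp [Matrix.mul_apply, Matrix.trace, Fintype.sum_prod_type, leg1, leg2, kmat, sixVertex, qdet,
      h1, h2, Matrix.one_apply, -map_sub, -map_mul, -map_inv₀, -map_div₀, add_mul, mul_sub,
      sub_mul]
  · linear_combination (norm := skip) ((-1/2) * (q + q⁻¹) * (q - q⁻¹)) • h.wpwp + ((1/2) * (q +
      q⁻¹) * (q - q⁻¹)⁻¹) • h.six + ((1/2 * q⁻¹ + 1/2 * q) * ((q - q⁻¹) * (x ^ 2 - x⁻¹ ^ 2))⁻¹ *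
      (q + q⁻¹) * (q - q⁻¹)) • h.seven + ((1/2) * (q + q⁻¹) * (q - q⁻¹)) • h.wmwm
    match_scalars <;> (try unfold ufun) <;> field_simp <;> ring
  · linear_combination (norm := skip) ((-x⁻¹ ^ 3 - x * q⁻¹ ^ 2) * ((q - q⁻¹) * (x ^ 2 - x⁻¹ ^
      2))⁻¹) • h.bwp + ((x⁻¹ * q ^ 2 + x ^ 3) * ((q - q⁻¹) * (x ^ 2 - x⁻¹ ^ 2))⁻¹) • h.bwm + ((x)
      * ((q - q⁻¹) * (x ^ 2 - x⁻¹ ^ 2))⁻¹ * (q + q⁻¹)) • h.eightm + ((x⁻¹) * ((q - q⁻¹) * (x ^ 2 -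
      x⁻¹ ^ 2))⁻¹ * (q + q⁻¹)) • h.ninem
    match_scalars <;> (try unfold ufun) <;> field_simp <;> ring
  · linear_combination (norm := skip) ((x⁻¹ * q ^ 2 + x ^ 3) * ((q - q⁻¹) * (x ^ 2 - x⁻¹ ^ 2))⁻¹)
      • h.cwp + ((x) * ((q - q⁻¹) * (x ^ 2 - x⁻¹ ^ 2))⁻¹ * (q + q⁻¹)) • h.eightp + ((x⁻¹) * ((q -
      q⁻¹) * (x ^ 2 - x⁻¹ ^ 2))⁻¹ * (q + q⁻¹)) • h.ninep + ((-x⁻¹ ^ 3 - x * q⁻¹ ^ 2) * ((q - q⁻¹)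
      * (x ^ 2 - x⁻¹ ^ 2))⁻¹) • h.cwm
    match_scalars <;> (try unfold ufun) <;> field_simp <;> ring
  · linear_combination (norm := skip) ((1/2) * (q + q⁻¹) * (q - q⁻¹)) • h.wpwp + ((-1/2) * (q +
      q⁻¹) * (q - q⁻¹)⁻¹) • h.six + ((-1/2 * q⁻¹ - 1/2 * q) * ((q - q⁻¹) * (x ^ 2 - x⁻¹ ^ 2))⁻¹ *
      (q + q⁻¹) * (q - q⁻¹)) • h.seven + ((-1/2) * (q + q⁻¹) * (q - q⁻¹)) • h.wmwm
    match_scalars <;> (try unfold ufun) <;> field_simp <;> ring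

end Base

set_option linter.unusedSectionVars false

/-! ### Operators on tensor factors -/

section Legs

variable {k A : Type*} [Field k] [Ring A] [Algebra k A]
variable {a b d b' d' : Type*} [Fintype a] [Fintype b] [Fintype d] [Fintype b'] [Fintype d']
  [DecidableEq a] [DecidableEq b] [DecidableEq d]

/-- An operator on the first two factors of a triple tensor product. -/
def site01 {S : Type*} [Zero S] (d : Type*) [DecidableEq d] (M : Matrix (a × b) (a × b) S) :
    Matrix (a × b × d) (a × b × d) S :=
  Matrix.of fun i j => if i.2.2 = j.2.2 then M (i.1, i.2.1) (j.1, j.2.1) else 0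

/-- An operator on the outer two factors of a triple tensor product. -/
def site02 {S : Type*} [Zero S] (b : Type*) [DecidableEq b] (M : Matrix (a × d) (a × d) S) :
    Matrix (a × b × d) (a × b × d) S :=
  Matrix.of fun i j => if i.2.1 = j.2.1 then M (i.1, i.2.2) (j.1, j.2.2) else 0

/-- An operator on the second factor of a tensor product. -/
def site2 {S : Type*} [Zero S] (a : Type*) [DecidableEq a] (M : Matrix b d S) :
    Matrix (a × b) (a × d) S :=
  Matrix.of fun i j => if i.1 = j.1 then M i.2 j.2 else 0

/-- An operator on the first factor of a tensor product. -/
def site1 {S : Type*} [Zero S] (d : Type*) [DecidableEq d] (M : Matrix a b S) :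
    Matrix (a × d) (b × d) S :=
  Matrix.of fun i j => if i.2 = j.2 then M i.1 j.1 else 0

theorem leg1_eq {S : Type*} [Ring S] (n : ℕ) (X : Matrix (Fin 2) (Fin 2) S) :
    leg1 n X = site1 (Fin (n + 1)) X := by
  ext i j; simp [leg1, site1, Matrix.one_apply]

theorem leg2_eq {S : Type*} [Ring S] (n : ℕ) (X : Matrix (Fin (n + 1)) (Fin (n + 1)) S) :
    leg2 n X = site2 (Fin 2) X := by
  ext i j; simp [leg2, site2, Matrix.one_apply]

variable {S : Type*} [Ring S]

theorem site01_mul (M N : Matrix (a × b) (a × b) S) :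
    site01 d (M * N) = site01 d M * site01 d N := by
  ext i j; by_cases h : i.2.2 = j.2.2 <;>
    simp [site01, Matrix.mul_apply, Fintype.sum_prod_type, h]

theorem site02_mul (M N : Matrix (a × d) (a × d) S) :
    site02 b (M * N) = site02 b M * site02 b N := by
  ext i j; by_cases h : i.2.1 = j.2.1 <;>
    simp [site02, Matrix.mul_apply, Fintype.sum_prod_type, h]

theorem site2_mul (M : Matrix b d S) (N : Matrix d d' S) :
    site2 a (M * N) = site2 a M * site2 a N := by
  ext i j; by_cases h : i.1 = j.1 <;>
    simp [site2, Matrix.mul_apply, Fintype.sum_prod_type, h]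

theorem site1_mul (M : Matrix a b S) (N : Matrix b d' S) [DecidableEq d'] :
    site1 d (M * N) = site1 d M * site1 d N := by
  ext i j; by_cases h : i.2 = j.2 <;>
    simp [site1, Matrix.mul_apply, Fintype.sum_prod_type, h]

theorem site2_one : site2 a (1 : Matrix b b S) = 1 := by
  ext ⟨i, j⟩ ⟨i', j'⟩
  by_cases h : i = i' <;> by_cases h' : j = j' <;> simp [site2, Matrix.one_apply, h, h']

theorem site01_site1 (X : Matrix a a S) : site01 d (site1 b X) = site1 (b × d) X := by
  ext ⟨i, j, l⟩ ⟨i', j', l'⟩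
  by_cases h : j = j' <;> by_cases h' : l = l' <;> simp [site01, site1, h, h']

theorem site02_site1 (X : Matrix a a S) : site02 b (site1 d X) = site1 (b × d) X := by
  ext ⟨i, j, l⟩ ⟨i', j', l'⟩
  by_cases h : j = j' <;> by_cases h' : l = l' <;> simp [site02, site1, h, h']

theorem site01_site2 (X : Matrix b b S) : site01 d (site2 a X) = site2 a (site1 d X) := by
  ext ⟨i, j, l⟩ ⟨i', j', l'⟩
  by_cases h : i = i' <;> by_cases h' : l = l' <;> simp [site01, site1, site2, h, h']

theorem site02_site2 (X : Matrix d d S) : site02 b (site2 a X) = site2 a (site2 b X) := by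
  ext ⟨i, j, l⟩ ⟨i', j', l'⟩
  by_cases h : i = i' <;> by_cases h' : j = j' <;> simp [site02, site2, h, h']

section Map
variable {T : Type*} [Ring T] (f : S →+* T)

theorem site01_map (M : Matrix (a × b) (a × b) S) :
    (site01 d M).map f = site01 d (M.map f) := by
  ext i j; by_cases h : i.2.2 = j.2.2 <;> simp [site01, h]

theorem site02_map (M : Matrix (a × d) (a × d) S) :
    (site02 b M).map f = site02 b (M.map f) := by
  ext i j; by_cases h : i.2.1 = j.2.1 <;> simp [site02, h]

theorem site2_map (M : Matrix b d S) : (site2 a M).map f = site2 a (M.map f) := by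
  ext i j; by_cases h : i.1 = j.1 <;> simp [site2, h]

end Map

/-- Scalar operators on one factor commute with operators on the other one. -/
theorem site1_mul_site2_scalar (X : Matrix a a A) (Y : Matrix b d k) :
    site1 b X * site2 a (Y.map (algebraMap k A)) = site2 a (Y.map (algebraMap k A)) * site1 d X := by
  ext i j
  simp [site1, site2, Matrix.mul_apply, Fintype.sum_prod_type, Algebra.commutes]

theorem site02_scalar_mul_site1 (M : Matrix (a × d) (a × d) k) (Y : Matrix b b A) :
    site02 b (M.map (algebraMap k A)) * site2 a (site1 d Y)
      = site2 a (site1 d Y) * site02 b (M.map (algebraMap k A)) := by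
  ext i j
  simp [site1, site2, site02, Matrix.mul_apply, Fintype.sum_prod_type, Algebra.commutes]

theorem site01_scalar_mul_site2 (M : Matrix (a × b) (a × b) k) (Y : Matrix d d A) :
    site01 d (M.map (algebraMap k A)) * site2 a (site2 b Y)
      = site2 a (site2 b Y) * site01 d (M.map (algebraMap k A)) := by
  ext i j
  simp [site2, site01, Matrix.mul_apply, Fintype.sum_prod_type, Algebra.commutes]

end Legs

/-! ### Fusion of reflection equations in the abstract -/

section Chain

variable {M : Type*} [Monoid M]

/-- Reflection equation for a product of two K-operators, in the first order. -/
theorem reflection_chain {K0 K1 K2 P P' Q Q' S : M}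
    (h1 : P * K0 * P' * K1 = K1 * P' * K0 * P) (h2 : Q * K0 * Q' * K2 = K2 * Q' * K0 * Q)
    (y1 : P * Q' * S = S * Q' * P) (y2 : Q * P' * S = S * P' * Q)
    (c1 : Q' * K1 = K1 * Q') (c2 : Q * K1 = K1 * Q) (c3 : P * K2 = K2 * P)
    (c4 : P' * K2 = K2 * P') (c5 : S * K0 = K0 * S) :
    (Q * P) * K0 * (P' * Q') * (K1 * S * K2) = (K1 * S * K2) * (P' * Q') * K0 * (Q * P) := by
  -- `K0` is reflected off `K1` and then off `K2`; the two Yang–Baxter relations reorder the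
  -- R-matrices after the first and before the second reflection.
  calc (Q * P) * K0 * (P' * Q') * (K1 * S * K2)
      = Q * P * K0 * P' * (Q' * K1) * S * K2 := by simp only [mul_assoc]
    _ = Q * (P * K0 * P' * K1) * Q' * S * K2 := by rw [c1]; simp only [mul_assoc]
    _ = (Q * K1) * P' * K0 * (P * Q' * S) * K2 := by rw [h1]; simp only [mul_assoc]
    _ = K1 * Q * P' * (K0 * S) * Q' * (P * K2) := by rw [c2, y1]; simp only [mul_assoc]
    _ = K1 * (Q * P' * S) * K0 * Q' * K2 * P := by rw [← c5, c3]; simp only [mul_assoc]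
    _ = K1 * S * P' * (Q * K0 * Q' * K2) * P := by rw [y2]; simp only [mul_assoc]
    _ = K1 * S * (P' * K2) * Q' * K0 * Q * P := by rw [h2]; simp only [mul_assoc]
    _ = _ := by rw [c4]; simp only [mul_assoc]

/-- Reflection equation for a product of two K-operators, in the opposite order. -/
theorem reflection_chain_op {K0 K1 K2 P P' Q Q' S : M}
    (h1 : P * K0 * P' * K1 = K1 * P' * K0 * P) (h2 : Q * K0 * Q' * K2 = K2 * Q' * K0 * Q)
    (y1 : P * Q' * S = S * Q' * P) (y2 : Q * P' * S = S * P' * Q)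
    (c1 : Q' * K1 = K1 * Q') (c2 : Q * K1 = K1 * Q) (c3 : P * K2 = K2 * P)
    (c4 : P' * K2 = K2 * P') (c5 : S * K0 = K0 * S) :
    (P * Q) * K0 * (Q' * P') * (K2 * S * K1) = (K2 * S * K1) * (Q' * P') * K0 * (P * Q) := by
  -- Every hypothesis is invariant under reversal of products up to exchanging its two sides, while
  -- the conclusion turns into the one for the opposite order.
  have := reflection_chain (M := Mᵐᵒᵖ) (K0 := .op K0) (K1 := .op K1) (K2 := .op K2) (P := .op P)
    (P' := .op P') (Q := .op Q) (Q' := .op Q') (S := .op S)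
    (by simpa [← MulOpposite.op_mul, mul_assoc] using h1.symm)
    (by simpa [← MulOpposite.op_mul, mul_assoc] using h2.symm)
    (by simpa [← MulOpposite.op_mul, mul_assoc] using y1.symm)
    (by simpa [← MulOpposite.op_mul, mul_assoc] using y2.symm)
    (by rw [← MulOpposite.op_mul, ← MulOpposite.op_mul, c1])
    (by rw [← MulOpposite.op_mul, ← MulOpposite.op_mul, c2])
    (by rw [← MulOpposite.op_mul, ← MulOpposite.op_mul, c3])
    (by rw [← MulOpposite.op_mul, ← MulOpposite.op_mul, c4])
    (by rw [← MulOpposite.op_mul, ← MulOpposite.op_mul, c5])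
  have := congrArg MulOpposite.unop this
  simpa [mul_assoc] using this.symm

end Chain

section Fusion

variable {k A : Type*} [Field k] [Ring A] [Algebra k A]
variable {a b d e : Type*} [Fintype a] [Fintype b] [Fintype d] [Fintype e]
  [DecidableEq a] [DecidableEq b] [DecidableEq d] [DecidableEq e]

theorem map_smul_algebraMap {m n : Type*} (c : k) (M : Matrix m n k) :
    (c • M).map (algebraMap k A) = c • M.map (algebraMap k A) := by
  ext i j; simp [Algebra.smul_def]

/-- The reflection equation with R-matrices `P`, `P'` for the K-operators `K` and `K'`. -/
def Reflects (P P' : Matrix (a × b) (a × b) k) (K : Matrix a a A) (K' : Matrix b b A) : Prop :=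
  P.map (algebraMap k A) * site1 b K * P'.map (algebraMap k A) * site2 a K'
    = site2 a K' * P'.map (algebraMap k A) * site1 b K * P.map (algebraMap k A)

/-- On the image of `E` the operators `T`, `T'`, `X` act as `γ L`, `γ' L'`, `Y`, and `K` commutes
with `E` since `E` has scalar entries on the other leg. Pushing `E` to the left through both sides
gives `γ γ' E (...)`; the left inverse `F` then removes `E`, and the nonzero factor is divided out.
-/
theorem Reflects.restrict {T T' : Matrix (a × b × d) (a × b × d) k} {L L' : Matrix (a × e) (a × e) k}
    {E : Matrix (b × d) e k} {F : Matrix e (b × d) k} {γ γ' : k} {K : Matrix a a A}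
    {X : Matrix (b × d) (b × d) A} {Y : Matrix e e A} (hFE : F * E = 1)
    (hT : T * site2 a E = γ • (site2 a E * L)) (hT' : T' * site2 a E = γ' • (site2 a E * L'))
    (hγ : γ ≠ 0) (hγ' : γ' ≠ 0) (h : Reflects T T' K X)
    (hX : X * E.map (algebraMap k A) = E.map (algebraMap k A) * Y) :
    Reflects L L' K Y := by
  let φ := algebraMap k A
  have hT1 : T.map φ * (site2 a E).map φ = γ • ((site2 a E).map φ * L.map φ) := by
    rw [← Matrix.map_mul, ← Matrix.map_mul, hT, map_smul_algebraMap]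
  have hT1' : T'.map φ * (site2 a E).map φ = γ' • ((site2 a E).map φ * L'.map φ) := by
    rw [← Matrix.map_mul, ← Matrix.map_mul, hT', map_smul_algebraMap]
  have hK : site1 (b × d) K * (site2 a E).map φ = (site2 a E).map φ * site1 e K := by
    rw [site2_map]; exact site1_mul_site2_scalar K E
  have hX1 : site2 a X * (site2 a E).map φ = (site2 a E).map φ * site2 a Y := by
    rw [site2_map, ← site2_mul, hX, site2_mul]
  have hFE1 : (site2 a F).map φ * (site2 a E).map φ = 1 := by
    rw [← Matrix.map_mul, ← site2_mul, hFE, site2_one]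
    simp [φ]
  have key := congrArg (fun Z => (γ * γ')⁻¹ • ((site2 a F).map φ * (Z * (site2 a E).map φ))) h
  have l1 : T.map φ * site1 (b × d) K * T'.map φ * site2 a X * (site2 a E).map φ
      = (γ * γ') • ((site2 a E).map φ * (L.map φ * site1 e K * L'.map φ * site2 a Y)) := by
    calc _ = T.map φ * (site1 (b × d) K * (T'.map φ * (site2 a X * (site2 a E).map φ))) := by
          simp only [Matrix.mul_assoc]
      _ = T.map φ * (site1 (b × d) K * ((T'.map φ * (site2 a E).map φ) * site2 a Y)) := by
          rw [hX1, Matrix.mul_assoc]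
      _ = γ' • (T.map φ * ((site1 (b × d) K * (site2 a E).map φ) * (L'.map φ * site2 a Y))) := by
          rw [hT1']; simp only [Matrix.mul_assoc, Matrix.smul_mul, Matrix.mul_smul]
      _ = γ' • ((T.map φ * (site2 a E).map φ) * (site1 e K * (L'.map φ * site2 a Y))) := by
          rw [hK]; simp only [Matrix.mul_assoc]
      _ = _ := by
          rw [hT1]; simp only [Matrix.mul_assoc, Matrix.smul_mul, smul_smul, mul_comm]
  have l2 : site2 a X * T'.map φ * site1 (b × d) K * T.map φ * (site2 a E).map φ
      = (γ * γ') • ((site2 a E).map φ * (site2 a Y * L'.map φ * site1 e K * L.map φ)) := by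
    calc _ = site2 a X * (T'.map φ * (site1 (b × d) K * (T.map φ * (site2 a E).map φ))) := by
          simp only [Matrix.mul_assoc]
      _ = γ • (site2 a X * (T'.map φ * ((site1 (b × d) K * (site2 a E).map φ) * L.map φ))) := by
          rw [hT1]; simp only [Matrix.mul_assoc, Matrix.mul_smul]
      _ = γ • (site2 a X * ((T'.map φ * (site2 a E).map φ) * (site1 e K * L.map φ))) := by
          rw [hK]; simp only [Matrix.mul_assoc]
      _ = (γ * γ') • ((site2 a X * (site2 a E).map φ) * (L'.map φ * (site1 e K * L.map φ))) := by
          rw [hT1']; simp only [Matrix.mul_assoc, Matrix.mul_smul, Matrix.smul_mul, smul_smul]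
      _ = _ := by rw [hX1]; simp only [Matrix.mul_assoc]
  have hne : γ * γ' ≠ 0 := mul_ne_zero hγ hγ'
  simp only [φ] at l1 l2 hFE1
  simp only [l1, l2, Matrix.mul_smul, smul_smul, inv_mul_cancel₀ hne, one_smul,
    ← Matrix.mul_assoc, φ, hFE1, Matrix.one_mul] at key
  simpa only [Reflects, Matrix.mul_assoc] using key

variable {K0 : Matrix a a A} {K1 : Matrix b b A} {K2 : Matrix d d A}
  {P P' : Matrix (a × b) (a × b) k} {Q Q' : Matrix (a × d) (a × d) k} {S : Matrix (b × d) (b × d) k}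

/-- The chain identities on three legs, carrying `K0`, `K1`, `K2`. The first conclusion serves the
operators `K`, the second one the operators `K̂` fused in the opposite order. Commutation of
operators on disjoint legs holds because one factor of each such pair has central entries; no
relation between `K1` and `K2` is needed. -/
theorem Reflects.fuse (h1 : Reflects P P' K0 K1) (h2 : Reflects Q Q' K0 K2)
    (y1 : site01 d P * site02 b Q' * site2 a S = site2 a S * site02 b Q' * site01 d P)
    (y2 : site02 b Q * site01 d P' * site2 a S = site2 a S * site01 d P' * site02 b Q) :
    Reflects (site02 b Q * site01 d P) (site01 d P' * site02 b Q') K0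
        (site1 d K1 * S.map (algebraMap k A) * site2 b K2) ∧
      Reflects (site01 d P * site02 b Q) (site02 b Q' * site01 d P') K0
        (site2 b K2 * S.map (algebraMap k A) * site1 d K1) := by
  let φ := algebraMap k A
  have e1 : (site01 d P).map φ * site1 (b × d) K0 * (site01 d P').map φ * site2 a (site1 d K1)
      = site2 a (site1 d K1) * (site01 d P').map φ * site1 (b × d) K0 * (site01 d P).map φ := by
    have := congrArg (site01 d) h1
    simpa only [site01_mul, site01_site1, site01_site2, ← site01_map] using this
  have e2 : (site02 b Q).map φ * site1 (b × d) K0 * (site02 b Q').map φ * site2 a (site2 b K2)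
      = site2 a (site2 b K2) * (site02 b Q').map φ * site1 (b × d) K0 * (site02 b Q).map φ := by
    have := congrArg (site02 b) h2
    simpa only [site02_mul, site02_site1, site02_site2, ← site02_map] using this
  have z1 := congrArg (fun Z => Z.map φ) y1
  have z2 := congrArg (fun Z => Z.map φ) y2
  simp only [Matrix.map_mul] at z1 z2
  have c1 : ∀ M : Matrix (a × d) (a × d) k, (site02 b M).map φ * site2 a (site1 d K1)
      = site2 a (site1 d K1) * (site02 b M).map φ := fun M => by
    rw [site02_map]; exact site02_scalar_mul_site1 M K1
  have c3 : ∀ M : Matrix (a × b) (a × b) k, (site01 d M).map φ * site2 a (site2 b K2)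
      = site2 a (site2 b K2) * (site01 d M).map φ := fun M => by
    rw [site01_map]; exact site01_scalar_mul_site2 M K2
  have c5 : (site2 a S).map φ * site1 (b × d) K0 = site1 (b × d) K0 * (site2 a S).map φ := by
    rw [site2_map]; exact (site1_mul_site2_scalar K0 S).symm
  constructor
  · have := reflection_chain e1 e2 z1 z2 (c1 Q') (c1 Q) (c3 P) (c3 P') c5
    simpa only [Reflects, Matrix.map_mul, site2_mul, ← site2_map, φ] using this
  · have := reflection_chain_op e1 e2 z1 z2 (c1 Q') (c1 Q) (c3 P) (c3 P') c5
    simpa only [Reflects, Matrix.map_mul, site2_mul, ← site2_map, φ] using this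

end Fusion

/-! ### Lax operators and fusion maps in a basis without square roots -/

section Shift

variable {k : Type*} [Field k]

/-- The matrix that sends the `b`-th basis vector to `f b` times the `(b + d)`-th one. -/
def shift (m n : ℕ) (d : ℤ) (f : ℤ → k) : Matrix (Fin (m + 1)) (Fin (n + 1)) k :=
  Matrix.of fun a b => if (a : ℤ) = b + d then f b else 0

/-- The hypothesis says that the intermediate index leaves `0, …, l` only where the coefficient
vanishes, so truncation to finite matrices loses nothing. -/
theorem shift_mul {m l n : ℕ} {d d' : ℤ} {f g : ℤ → k}
    (h : ∀ b : ℤ, 0 ≤ b → b ≤ n → g b ≠ 0 → 0 ≤ b + d' ∧ b + d' ≤ l) :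
    shift m l d f * shift l n d' g = shift m n (d' + d) fun b => f (b + d') * g b := by
  ext i j
  simp only [Matrix.mul_apply, shift, Matrix.of_apply]
  by_cases hg : g j = 0
  · simp [hg]
  · obtain ⟨h0, h1⟩ := h j (by omega) (by omega) hg
    rw [Finset.sum_eq_single (⟨((j : ℤ) + d').toNat, by omega⟩ : Fin (l + 1))]
    · have : (((⟨((j : ℤ) + d').toNat, by omega⟩ : Fin (l + 1)) : ℕ) : ℤ) = j + d' := by
        simp; omega
      simp [this, add_assoc]
    · intro r _ hr
      have : ¬ ((r : ℤ) = j + d') := fun h' => hr (Fin.ext (by simp; omega))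
      simp [this]
    · simp

end Shift

section Lax

variable {k : Type*} [Field k]

/-- `s ^ (2 m) - s ^ (-2 m)`, that is `(q - q⁻¹) [m]_q`. -/
def nq (s : k) (m : ℤ) : k := (s ^ m) ^ 2 - ((s ^ m) ^ 2)⁻¹

/-- The coefficients of the Lax operator in a basis of weight vectors that contains no square
roots. -/
def laxCoef (s : k) (n : ℕ) (y : k) (a a' : Fin 2) (b : ℤ) : k :=
  if a = a' then
    if a = 0 then y * (s * s ^ n / (s ^ b) ^ 2) - (y * (s * s ^ n / (s ^ b) ^ 2))⁻¹
    else y * (s * (s ^ b) ^ 2 / s ^ n) - (y * (s * (s ^ b) ^ 2 / s ^ n))⁻¹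
  else if a = 0 then nq s (n - b) else nq s b

/-- The 2 × 2 blocks of the Lax operator. -/
def laxBlock (s : k) (n : ℕ) (y : k) (a a' : Fin 2) : Matrix (Fin (n + 1)) (Fin (n + 1)) k :=
  shift n n ((a' : ℤ) - (a : ℤ)) (laxCoef s n y a a')

/-- The operator with given blocks. -/
def ofBlocks {α β m n : Type*} (Q : α → β → Matrix m n k) : Matrix (α × m) (β × n) k :=
  Matrix.of fun i j => Q i.1 j.1 i.2 j.2

/-- The Lax operator, without its normalisation factor, in a basis without square roots. -/
def lax (s : k) (n : ℕ) (y : k) : Matrix (Fin 2 × Fin (n + 1)) (Fin 2 × Fin (n + 1)) k :=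
  ofBlocks (laxBlock s n y)

/-- The coefficients of the fusion map. -/
def fuseCoef (s : k) (n : ℕ) (a : Fin 2) (b : ℤ) : k :=
  if a = 0 then nq s (n + 1 - b) else nq s b

/-- The blocks of the fusion map. -/
def fuseBlock (s : k) (n : ℕ) (a : Fin 2) : Matrix (Fin (n + 1)) (Fin (n + 2)) k :=
  shift n (n + 1) (-(a : ℤ)) (fuseCoef s n a)

/-- The fusion map in a basis without square roots. -/
def fuse (s : k) (n : ℕ) : Matrix (Fin 2 × Fin (n + 1)) (Fin (n + 2)) k :=
  Matrix.of fun i j => fuseBlock s n i.1 i.2 j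

theorem nq_zero (s : k) : nq s 0 = 0 := by simp [nq]

/-- There are no boundary terms: the raising and lowering coefficients contain `nq s 0 = 0` exactly
where they would leave the representation. The same remark covers the two lemmas that follow. -/
theorem laxBlock_mul (s : k) (n : ℕ) (x y : k) (a c d b : Fin 2) :
    laxBlock s n x a c * laxBlock s n y d b
      = shift n n ((b : ℤ) - d + (c - a))
          fun p => laxCoef s n x a c (p + ((b : ℤ) - d)) * laxCoef s n y d b p := by
  apply shift_mul
  intro p h0 h1 h
  fin_cases d <;> fin_cases b <;> simp_all
  · by_contra hh
    obtain rfl : p = n := by omega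
    exact h (by simp [laxCoef, nq_zero])
  · by_contra hh
    obtain rfl : p = 0 := by omega
    exact h (by simp [laxCoef, nq_zero])

theorem laxBlock_mul_fuseBlock (s : k) (n : ℕ) (x : k) (a c d : Fin 2) :
    laxBlock s n x a c * fuseBlock s n d
      = shift n (n + 1) (-(d : ℤ) + (c - a))
          fun p => laxCoef s n x a c (p + -(d : ℤ)) * fuseCoef s n d p := by
  apply shift_mul
  intro p h0 h1 h
  fin_cases d <;> simp_all
  · by_contra hh
    obtain rfl : p = n + 1 := by omega
    exact h (by simp [fuseCoef, nq_zero])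
  · by_contra hh
    obtain ⟨rfl⟩ | ⟨rfl⟩ : p = 0 ∨ p = n + 2 := by omega
    · exact h (by simp [fuseCoef, nq_zero])
    · omega

theorem fuseBlock_mul_laxBlock (s : k) (n : ℕ) (x : k) (a d b : Fin 2) :
    fuseBlock s n a * laxBlock s (n + 1) x d b
      = shift n (n + 1) ((b : ℤ) - d + -a)
          fun p => fuseCoef s n a (p + ((b : ℤ) - d)) * laxCoef s (n + 1) x d b p := by
  apply shift_mul
  intro p h0 h1 h
  fin_cases d <;> fin_cases b <;> simp_all
  · by_contra hh
    obtain rfl : p = n + 1 := by omega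
    exact h (by simp [laxCoef, nq_zero])
  · by_contra hh
    obtain rfl : p = 0 := by omega
    exact h (by simp [laxCoef, nq_zero])

/-- Unitarity of the Lax operator. The scalar vanishes at `y = s ^ (n + 1)` and at its inverse;
these are the two degeneration points on which fusion rests. -/
theorem lax_mul_lax_inv {s y : k} (hs : s ≠ 0) (hy : y ≠ 0) (n : ℕ) :
    lax s n y * lax s n y⁻¹
      = ((y * s ^ (n + 1) - (y * s ^ (n + 1))⁻¹)
          * (y⁻¹ * s ^ (n + 1) - (y⁻¹ * s ^ (n + 1))⁻¹)) • 1 := by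
  ext ⟨a, p⟩ ⟨b, r⟩
  have : (lax s n y * lax s n y⁻¹) (a, p) (b, r)
      = ∑ c, (laxBlock s n y a c * laxBlock s n y⁻¹ c b) p r := by
    simp [lax, ofBlocks, Matrix.mul_apply, Fintype.sum_prod_type]
  rw [this]
  simp only [laxBlock_mul, Fin.sum_univ_two, shift, Matrix.of_apply, Matrix.smul_apply,
    Matrix.one_apply, Prod.mk.injEq]
  have hn : s ^ n ≠ 0 := pow_ne_zero _ hs
  have hr : s ^ (r : ℕ) ≠ 0 := pow_ne_zero _ hs
  fin_cases a <;> fin_cases b <;>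
    simp [laxCoef, nq, zpow_add₀ hs, zpow_sub₀ hs, ← Fin.ext_iff, pow_succ]
  -- By weight conservation each entry involves one basis index only, so it is a rational identity
  -- in which `s ^ n` and `s ^ r` may be treated as independent variables. The later checks of this
  -- kind work in the same way.
  all_goals
    generalize s ^ n = ν at *
    generalize s ^ (r : ℕ) = β at *
    split_ifs
    · field_simp
      ring
    · simp

theorem site01_mul_site02_mul_site2 (P : Matrix (Fin 2 × Fin 2) (Fin 2 × Fin 2) k)
    {m : ℕ} (Q S : Fin 2 → Fin 2 → Matrix (Fin m) (Fin m) k) (a b a' b' : Fin 2) (p p' : Fin m) :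
    (site01 (Fin m) P * site02 (Fin 2) (ofBlocks Q)
        * site2 (Fin 2) (ofBlocks S)) (a, b, p) (a', b', p')
      = ∑ c, ∑ d, P (a, b) (c, d) * (Q c a' * S d b') p p' := by
  simp only [Matrix.mul_assoc]
  simp [ofBlocks, site01, site02, site2, Matrix.mul_apply, Fintype.sum_prod_type]

theorem site2_mul_site02_mul_site01 (P : Matrix (Fin 2 × Fin 2) (Fin 2 × Fin 2) k)
    {m : ℕ} (Q S : Fin 2 → Fin 2 → Matrix (Fin m) (Fin m) k) (a b a' b' : Fin 2) (p p' : Fin m) :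
    (site2 (Fin 2) (ofBlocks S)
        * site02 (Fin 2) (ofBlocks Q) * site01 (Fin m) P)
          (a, b, p) (a', b', p')
      = ∑ c, ∑ d, (S b d * Q a c) p p' * P (c, d) (a', b') := by
  simp [ofBlocks, site01, site02, site2, Matrix.mul_apply, Fintype.sum_prod_type]

theorem yangBaxter_lax {s x y : k} (hs : s ≠ 0) (hx : x ≠ 0) (hy : y ≠ 0) (n : ℕ) :
    site01 (Fin (n + 1)) (sixVertex (s ^ 2) x) * site02 (Fin 2) (lax s n y)
        * site2 (Fin 2) (lax s n (y / x))
      = site2 (Fin 2) (lax s n (y / x)) * site02 (Fin 2) (lax s n y)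
        * site01 (Fin (n + 1)) (sixVertex (s ^ 2) x) := by
  ext ⟨a, b, p⟩ ⟨a', b', r⟩
  unfold lax
  rw [site01_mul_site02_mul_site2, site2_mul_site02_mul_site01]
  simp only [laxBlock_mul, Fin.sum_univ_two, shift, Matrix.of_apply]
  have hn : s ^ n ≠ 0 := pow_ne_zero _ hs
  have hr : s ^ (r : ℕ) ≠ 0 := pow_ne_zero _ hs
  fin_cases a <;> fin_cases b <;> fin_cases a' <;> fin_cases b' <;>
    simp [sixVertex, laxCoef, nq, zpow_add₀ hs, zpow_sub₀ hs, ← Fin.ext_iff]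
  all_goals
    generalize s ^ n = ν at *
    generalize s ^ (r : ℕ) = β at *
    split_ifs
    · field_simp <;> ring
    · simp

theorem site01_mul_site02_mul_fuse (P : Matrix (Fin 2 × Fin 2) (Fin 2 × Fin 2) k)
    {m m' : ℕ} (Q : Fin 2 → Fin 2 → Matrix (Fin m) (Fin m) k) (E : Fin 2 → Matrix (Fin m) (Fin m') k)
    (a b a' : Fin 2) (p : Fin m) (p' : Fin m') :
    (site01 (Fin m) P * site02 (Fin 2) (ofBlocks Q)
        * site2 (Fin 2) (Matrix.of fun i j => E i.1 i.2 j : Matrix (Fin 2 × Fin m) (Fin m') k))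
          (a, b, p) (a', p')
      = ∑ c, ∑ d, P (a, b) (c, d) * (Q c a' * E d) p p' := by
  simp only [Matrix.mul_assoc]
  simp [ofBlocks, site01, site02, site2, Matrix.mul_apply, Fintype.sum_prod_type]

theorem site02_mul_site01_mul_fuse (P : Matrix (Fin 2 × Fin 2) (Fin 2 × Fin 2) k)
    {m m' : ℕ} (Q : Fin 2 → Fin 2 → Matrix (Fin m) (Fin m) k) (E : Fin 2 → Matrix (Fin m) (Fin m') k)
    (a b a' : Fin 2) (p : Fin m) (p' : Fin m') :
    (site02 (Fin 2) (ofBlocks Q) * site01 (Fin m) P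
        * site2 (Fin 2) (Matrix.of fun i j => E i.1 i.2 j : Matrix (Fin 2 × Fin m) (Fin m') k))
          (a, b, p) (a', p')
      = ∑ c, ∑ d, P (c, b) (a', d) * (Q a c * E d) p p' := by
  simp only [Matrix.mul_assoc]
  simp [ofBlocks, site01, site02, site2, Matrix.mul_apply, Fintype.sum_prod_type, Finset.mul_sum,
    mul_add, Finset.sum_add_distrib, mul_left_comm, add_assoc, add_left_comm]

theorem fuse_mul_ofBlocks {m m' : ℕ} (E : Fin 2 → Matrix (Fin m) (Fin m') k)
    (Q : Fin 2 → Fin 2 → Matrix (Fin m') (Fin m') k) (a b a' : Fin 2) (p : Fin m) (p' : Fin m') :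
    (site2 (Fin 2) (Matrix.of fun i j => E i.1 i.2 j : Matrix (Fin 2 × Fin m) (Fin m') k)
        * ofBlocks Q) (a, b, p) (a', p') = (E b * Q a a') p p' := by
  simp [ofBlocks, site2, Matrix.mul_apply, Fintype.sum_prod_type]

/-- Fusion in the auxiliary space: at these shifted parameters the product of a spin-1/2 and a
spin-`n/2` operator preserves the image of `fuse` and acts there as the operator of spin `(n+1)/2`.
The scalar must be nonzero when this is used in `Reflects.restrict`, which restricts the admissible
ratios of parameters. -/
theorem site01_mul_site02_fuse {s y : k} (hs : s ≠ 0) (hy : y ≠ 0) (n : ℕ) :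
    site01 (Fin (n + 1)) (sixVertex (s ^ 2) (y / s ^ n)) * site02 (Fin 2) (lax s n (y * s))
        * site2 (Fin 2) (fuse s n)
      = (y * s ^ 2 / s ^ n - (y * s ^ 2 / s ^ n)⁻¹)
        • (site2 (Fin 2) (fuse s n) * lax s (n + 1) y) := by
  ext ⟨a, b, p⟩ ⟨a', r⟩
  unfold lax fuse
  rw [site01_mul_site02_mul_fuse, Matrix.smul_apply, fuse_mul_ofBlocks]
  simp only [laxBlock_mul_fuseBlock, fuseBlock_mul_laxBlock, Fin.sum_univ_two, shift,
    Matrix.of_apply]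
  have hn : s ^ n ≠ 0 := pow_ne_zero _ hs
  have hr : s ^ (r : ℕ) ≠ 0 := pow_ne_zero _ hs
  fin_cases a <;> fin_cases b <;> fin_cases a' <;>
    simp [sixVertex, laxCoef, fuseCoef, nq, zpow_add₀ hs, zpow_sub₀ hs, pow_succ s n]
  all_goals
    generalize s ^ n = ν at *
    generalize s ^ (r : ℕ) = β at *
    split_ifs
    · field_simp <;> ring
    · simp

/-- The same fusion with the factors in the other order, for which the parameter shifts are inverted
and the scalar is a different one. -/
theorem site02_mul_site01_fuse {s y : k} (hs : s ≠ 0) (hy : y ≠ 0) (n : ℕ) :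
    site02 (Fin 2) (lax s n (y / s)) * site01 (Fin (n + 1)) (sixVertex (s ^ 2) (y * s ^ n))
        * site2 (Fin 2) (fuse s n)
      = (y * s ^ n - (y * s ^ n)⁻¹) • (site2 (Fin 2) (fuse s n) * lax s (n + 1) y) := by
  ext ⟨a, b, p⟩ ⟨a', r⟩
  unfold lax fuse
  rw [site02_mul_site01_mul_fuse, Matrix.smul_apply, fuse_mul_ofBlocks]
  simp only [laxBlock_mul_fuseBlock, fuseBlock_mul_laxBlock, Fin.sum_univ_two, shift,
    Matrix.of_apply]
  have hn : s ^ n ≠ 0 := pow_ne_zero _ hs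
  have hr : s ^ (r : ℕ) ≠ 0 := pow_ne_zero _ hs
  fin_cases a <;> fin_cases b <;> fin_cases a' <;>
    simp [sixVertex, laxCoef, fuseCoef, nq, zpow_add₀ hs, zpow_sub₀ hs, pow_succ s n]
  all_goals
    generalize s ^ n = ν at *
    generalize s ^ (r : ℕ) = β at *
    split_ifs
    · field_simp <;> ring
    · simp

/-- The Lax operator at the lower degeneration point annihilates the image of the fusion map. -/
theorem lax_mul_fuse_eq_zero {s : k} (hs : s ≠ 0) (n : ℕ) :
    lax s n (s ^ (n + 1))⁻¹ * fuse s n = 0 := by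
  ext ⟨a, p⟩ r
  have : (lax s n (s ^ (n + 1))⁻¹ * fuse s n) (a, p) r
      = ∑ c, (laxBlock s n (s ^ (n + 1))⁻¹ a c * fuseBlock s n c) p r := by
    simp [lax, fuse, ofBlocks, Matrix.mul_apply, Fintype.sum_prod_type]
  rw [this]
  simp only [laxBlock_mul_fuseBlock, Fin.sum_univ_two, shift, Matrix.of_apply]
  have hn : s ^ n ≠ 0 := pow_ne_zero _ hs
  have hr : s ^ (r : ℕ) ≠ 0 := pow_ne_zero _ hs
  fin_cases a <;>
    simp [laxCoef, fuseCoef, nq, zpow_add₀ hs, zpow_sub₀ hs, pow_succ s n]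
  all_goals
    generalize s ^ n = ν at *
    generalize s ^ (r : ℕ) = β at *
    split_ifs
    · field_simp
      ring
    · simp

/-- The right factor of the Lax operator at its upper degeneration point. -/
def laxFactor (k : Type*) [Field k] (n : ℕ) : Matrix (Fin (n + 2)) (Fin 2 × Fin (n + 1)) k :=
  Matrix.of fun i j => shift (n + 1) n (j.1 : ℤ) (fun _ => 1) i j.2

/-- At this point the column `(a', r)` depends on the total weight `r + a'` only, so the operator
factors through a space of dimension `n + 2`; the left factor is the fusion map. -/
theorem lax_eq_fuse_mul {s : k} (hs : s ≠ 0) (n : ℕ) :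
    lax s n (s ^ (n + 1)) = fuse s n * laxFactor k n := by
  ext ⟨a, p⟩ ⟨a', r⟩
  have : (fuse s n * laxFactor k n) (a, p) (a', r)
      = (fuseBlock s n a * shift (n + 1) n (a' : ℤ) (fun _ => (1 : k))) p r := by
    simp [laxFactor, fuse, Matrix.mul_apply]
  rw [this, fuseBlock, shift_mul]
  · simp only [lax, ofBlocks, laxBlock, shift, Matrix.of_apply]
    have hn : s ^ n ≠ 0 := pow_ne_zero _ hs
    have hr : s ^ (r : ℕ) ≠ 0 := pow_ne_zero _ hs
    fin_cases a <;> fin_cases a' <;>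
      simp [laxCoef, fuseCoef, nq, zpow_add₀ hs, zpow_sub₀ hs, ← Fin.ext_iff, pow_succ s n]
    all_goals
      generalize s ^ n = ν at *
      generalize s ^ (r : ℕ) = β at *
      split_ifs
      · field_simp
      · rfl
  · intro b h0 h1 _
    fin_cases a' <;> simp <;> omega

/-- The difference of the Lax operators at the two degeneration points. -/
theorem lax_sub_lax {s : k} (hs : s ≠ 0) (n : ℕ) :
    lax s n (s ^ (n + 1)) - lax s n (s ^ (n + 1))⁻¹
      = Matrix.diagonal fun i => nq s (i.2 + i.1 : ℤ) + nq s (n + 1 - (i.2 + i.1) : ℤ) := by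
  ext ⟨a, p⟩ ⟨a', r⟩
  simp only [lax, ofBlocks, laxBlock, shift, Matrix.of_apply, Matrix.sub_apply,
    Matrix.diagonal_apply, Prod.mk.injEq]
  have hn : s ^ n ≠ 0 := pow_ne_zero _ hs
  have hr : s ^ (r : ℕ) ≠ 0 := pow_ne_zero _ hs
  have hp : s ^ (p : ℕ) ≠ 0 := pow_ne_zero _ hs
  -- The off-diagonal blocks do not contain the spectral parameter and cancel in the difference.
  fin_cases a <;> fin_cases a' <;>
    simp [laxCoef, nq, zpow_add₀ hs, zpow_sub₀ hs, ← Fin.ext_iff, pow_succ s n]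
  all_goals
    by_cases hpr : p = r
    · subst hpr
      generalize s ^ n = ν at *
      generalize s ^ (p : ℕ) = β at *
      simp only [if_true]
      field_simp
      ring
    · simp [hpr]

end Lax

/-! ### Change of basis and the image of the fusion map -/

section Gauge

variable {k : Type*} [Field k]

/-- A change of basis in every representation, together with a normalisation of the fusion maps. -/
structure Gauge (k : Type*) [Field k] where
  D : ∀ n : ℕ, Matrix (Fin (n + 1)) (Fin (n + 1)) k
  D' : ∀ n : ℕ, Matrix (Fin (n + 1)) (Fin (n + 1)) k
  lam : ℕ → k
  mul_inv : ∀ n, D n * D' n = 1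
  inv_mul : ∀ n, D' n * D n = 1
  lam_ne : ∀ n, lam n ≠ 0

variable (g : Gauge k)

/-- The Lax operator in the new basis. -/
def Gauge.lax (s : k) (n : ℕ) (y : k) : Matrix (Fin 2 × Fin (n + 1)) (Fin 2 × Fin (n + 1)) k :=
  site2 (Fin 2) (g.D n) * FusedK.lax s n y * site2 (Fin 2) (g.D' n)

/-- The fusion map in the new basis. -/
def Gauge.fuse (s : k) (n : ℕ) : Matrix (Fin 2 × Fin (n + 1)) (Fin (n + 2)) k :=
  g.lam n • (site2 (Fin 2) (g.D n) * FusedK.fuse s n * g.D' (n + 1))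

theorem Gauge.site2_inv_mul (n : ℕ) {a : Type*} [Fintype a] [DecidableEq a] :
    site2 a (g.D' n) * site2 a (g.D n) = 1 := by
  rw [← site2_mul, g.inv_mul, site2_one]

theorem Gauge.site2_mul_inv (n : ℕ) {a : Type*} [Fintype a] [DecidableEq a] :
    site2 a (g.D n) * site2 a (g.D' n) = 1 := by
  rw [← site2_mul, g.mul_inv, site2_one]

theorem Gauge.lax_mul_lax_inv {s y : k} (hs : s ≠ 0) (hy : y ≠ 0) (n : ℕ) :
    g.lax s n y * g.lax s n y⁻¹
      = ((y * s ^ (n + 1) - (y * s ^ (n + 1))⁻¹)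
          * (y⁻¹ * s ^ (n + 1) - (y⁻¹ * s ^ (n + 1))⁻¹)) • 1 := by
  have : g.lax s n y * g.lax s n y⁻¹
      = site2 (Fin 2) (g.D n) * FusedK.lax s n y * (site2 (Fin 2) (g.D' n) * site2 (Fin 2) (g.D n))
        * FusedK.lax s n y⁻¹ * site2 (Fin 2) (g.D' n) := by
    simp only [Gauge.lax, Matrix.mul_assoc]
  rw [this, g.site2_inv_mul, Matrix.mul_one, Matrix.mul_assoc (site2 (Fin 2) (g.D n)),
    FusedK.lax_mul_lax_inv hs hy, Matrix.mul_smul, Matrix.smul_mul, Matrix.mul_one, g.site2_mul_inv]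

theorem site01_mul_site2_site2 {a b d : Type*} [Fintype a] [Fintype b] [Fintype d] [DecidableEq a]
    [DecidableEq b] [DecidableEq d] (P : Matrix (a × b) (a × b) k) (D : Matrix d d k) :
    site01 d P * site2 a (site2 b D) = site2 a (site2 b D) * site01 d P := by
  simpa using site01_scalar_mul_site2 (A := k) P D

theorem Gauge.site02_lax (s : k) (n : ℕ) (y : k) :
    site02 (Fin 2) (g.lax s n y)
      = site2 (Fin 2) (site2 (Fin 2) (g.D n)) * site02 (Fin 2) (FusedK.lax s n y)
        * site2 (Fin 2) (site2 (Fin 2) (g.D' n)) := by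
  simp only [Gauge.lax, site02_mul, site02_site2]

theorem Gauge.site2_lax (s : k) (n : ℕ) (y : k) :
    site2 (Fin 2) (g.lax s n y)
      = site2 (Fin 2) (site2 (Fin 2) (g.D n)) * site2 (Fin 2) (FusedK.lax s n y)
        * site2 (Fin 2) (site2 (Fin 2) (g.D' n)) := by
  simp only [Gauge.lax, site2_mul]

theorem Gauge.site2_site2_cancel (n : ℕ) {α : Type*}
    (M : Matrix (Fin 2 × Fin 2 × Fin (n + 1)) α k) :
    site2 (Fin 2) (site2 (Fin 2) (g.D' n)) * (site2 (Fin 2) (site2 (Fin 2) (g.D n)) * M) = M := by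
  rw [← Matrix.mul_assoc, ← site2_mul, g.site2_inv_mul, site2_one, Matrix.one_mul]

theorem Gauge.yangBaxter {s x y : k} (hs : s ≠ 0) (hx : x ≠ 0) (hy : y ≠ 0) (n : ℕ) :
    site01 (Fin (n + 1)) (sixVertex (s ^ 2) x) * site02 (Fin 2) (g.lax s n y)
        * site2 (Fin 2) (g.lax s n (y / x))
      = site2 (Fin 2) (g.lax s n (y / x)) * site02 (Fin 2) (g.lax s n y)
        * site01 (Fin (n + 1)) (sixVertex (s ^ 2) x) := by
  have h := congrArg (fun M => site2 (Fin 2) (site2 (Fin 2) (g.D n)) * M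
    * site2 (Fin 2) (site2 (Fin 2) (g.D' n))) (yangBaxter_lax hs hx hy n)
  simp only [g.site02_lax, g.site2_lax, Matrix.mul_assoc, g.site2_site2_cancel] at h ⊢
  rw [← site01_mul_site2_site2, ← Matrix.mul_assoc (site01 _ _), site01_mul_site2_site2,
    Matrix.mul_assoc]
  exact h

theorem site2_smul {a b d : Type*} [DecidableEq a] (c : k) (M : Matrix b d k) :
    site2 a (c • M) = c • site2 a M := by
  ext i j; by_cases h : i.1 = j.1 <;> simp [site2, h]

/-- The Yang–Baxter equation with the last R-matrix inverted. -/
theorem Gauge.yangBaxter_inv {s x y : k} (hs : s ≠ 0) (hx : x ≠ 0) (hy : y ≠ 0) (n : ℕ)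
    (h1 : (y / x * s ^ (n + 1)) ^ 2 ≠ 1) (h2 : (x / y * s ^ (n + 1)) ^ 2 ≠ 1) :
    site02 (Fin 2) (g.lax s n y) * site01 (Fin (n + 1)) (sixVertex (s ^ 2) x)
        * site2 (Fin 2) (g.lax s n (x / y))
      = site2 (Fin 2) (g.lax s n (x / y)) * site01 (Fin (n + 1)) (sixVertex (s ^ 2) x)
        * site02 (Fin 2) (g.lax s n y) := by
  have hne : ∀ z : k, z ≠ 0 → z ^ 2 ≠ 1 → z - z⁻¹ ≠ 0 := by
    intro z hz hz2 h0
    apply hz2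
    field_simp at h0
    linear_combination h0
  have hsn : s ^ (n + 1) ≠ 0 := pow_ne_zero _ hs
  set ρ : k := (y / x * s ^ (n + 1) - (y / x * s ^ (n + 1))⁻¹)
    * (x / y * s ^ (n + 1) - (x / y * s ^ (n + 1))⁻¹) with hρ
  have hρ0 : ρ ≠ 0 := mul_ne_zero
    (hne _ (mul_ne_zero (div_ne_zero hy hx) hsn) h1) (hne _ (mul_ne_zero (div_ne_zero hx hy) hsn) h2)
  have u1 : site2 (Fin 2) (g.lax s n (y / x)) * site2 (Fin 2) (g.lax s n (x / y)) = ρ • 1 := by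
    have := g.lax_mul_lax_inv hs (div_ne_zero hy hx) n
    rw [inv_div] at this
    rw [← site2_mul, this, ← hρ, site2_smul, site2_one]
  have u2 : site2 (Fin 2) (g.lax s n (x / y)) * site2 (Fin 2) (g.lax s n (y / x)) = ρ • 1 := by
    have := g.lax_mul_lax_inv hs (div_ne_zero hx hy) n
    rw [inv_div] at this
    rw [← site2_mul, this, mul_comm (x / y * _ - _), ← hρ, site2_smul, site2_one]
  have h := g.yangBaxter hs hx hy n
  -- The Yang–Baxter equation is multiplied on both sides by the Lax operator at `x / y`, which up
  -- to `ρ` is the inverse of the one at `y / x`.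
  have key := congrArg (fun M => ρ⁻¹ • (site2 (Fin 2) (g.lax s n (x / y)) * M
    * site2 (Fin 2) (g.lax s n (x / y)))) h
  have e1 : site2 (Fin 2) (g.lax s n (x / y)) * (site01 (Fin (n + 1)) (sixVertex (s ^ 2) x)
      * site02 (Fin 2) (g.lax s n y) * site2 (Fin 2) (g.lax s n (y / x)))
        * site2 (Fin 2) (g.lax s n (x / y))
      = ρ • (site2 (Fin 2) (g.lax s n (x / y)) * site01 (Fin (n + 1)) (sixVertex (s ^ 2) x)
        * site02 (Fin 2) (g.lax s n y)) := by
    rw [Matrix.mul_assoc, Matrix.mul_assoc _ (site2 _ _) (site2 _ _), u1]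
    simp [Matrix.mul_assoc]
  have e2 : site2 (Fin 2) (g.lax s n (x / y)) * (site2 (Fin 2) (g.lax s n (y / x))
      * site02 (Fin 2) (g.lax s n y) * site01 (Fin (n + 1)) (sixVertex (s ^ 2) x))
        * site2 (Fin 2) (g.lax s n (x / y))
      = ρ • (site02 (Fin 2) (g.lax s n y) * site01 (Fin (n + 1)) (sixVertex (s ^ 2) x)
        * site2 (Fin 2) (g.lax s n (x / y))) := by
    rw [← Matrix.mul_assoc, ← Matrix.mul_assoc, u2]
    simp [Matrix.mul_assoc]
  simp only [e1, e2, smul_smul, inv_mul_cancel₀ hρ0, one_smul] at key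
  exact key.symm

theorem Gauge.site01_mul_site02_fuse {s y : k} (hs : s ≠ 0) (hy : y ≠ 0) (n : ℕ) :
    site01 (Fin (n + 1)) (sixVertex (s ^ 2) (y / s ^ n)) * site02 (Fin 2) (g.lax s n (y * s))
        * site2 (Fin 2) (g.fuse s n)
      = (y * s ^ 2 / s ^ n - (y * s ^ 2 / s ^ n)⁻¹)
        • (site2 (Fin 2) (g.fuse s n) * g.lax s (n + 1) y) := by
  have h := congrArg (fun M => g.lam n • (site2 (Fin 2) (site2 (Fin 2) (g.D n)) * M
    * site2 (Fin 2) (g.D' (n + 1)))) (FusedK.site01_mul_site02_fuse hs hy n)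
  rw [g.site02_lax]
  simp only [Gauge.fuse, Gauge.lax, site2_mul, site2_smul, Matrix.mul_assoc,
    g.site2_site2_cancel, Matrix.mul_smul, Matrix.smul_mul] at h ⊢
  rw [← Matrix.mul_assoc (site2 _ (g.D' (n + 1))), g.site2_inv_mul, Matrix.one_mul,
    ← Matrix.mul_assoc (site01 _ _), site01_mul_site2_site2, Matrix.mul_assoc, h, smul_comm]

theorem Gauge.site02_mul_site01_fuse {s y : k} (hs : s ≠ 0) (hy : y ≠ 0) (n : ℕ) :
    site02 (Fin 2) (g.lax s n (y / s)) * site01 (Fin (n + 1)) (sixVertex (s ^ 2) (y * s ^ n))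
        * site2 (Fin 2) (g.fuse s n)
      = (y * s ^ n - (y * s ^ n)⁻¹) • (site2 (Fin 2) (g.fuse s n) * g.lax s (n + 1) y) := by
  have h := congrArg (fun M => g.lam n • (site2 (Fin 2) (site2 (Fin 2) (g.D n)) * M
    * site2 (Fin 2) (g.D' (n + 1)))) (FusedK.site02_mul_site01_fuse hs hy n)
  rw [g.site02_lax]
  simp only [Gauge.fuse, Gauge.lax, site2_mul, site2_smul, Matrix.mul_assoc,
    Matrix.mul_smul, Matrix.smul_mul] at h ⊢
  rw [← Matrix.mul_assoc (site2 _ (g.D' (n + 1))), g.site2_inv_mul, Matrix.one_mul,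
    ← Matrix.mul_assoc (site01 _ _), site01_mul_site2_site2, Matrix.mul_assoc (site2 _ _),
    g.site2_site2_cancel, h, smul_comm]

/-- The eigenvalues of the Lax operator on the image of the fusion map. -/
def fuseEigen (s : k) (n : ℕ) (w : ℤ) : k := nq s w + nq s (n + 1 - w)

/-- With `α = s ^ w` and `β = s ^ (n + 1 - w)` the eigenvalue is `(α² + β²)(α²β² - 1) / (α²β²)`. The
second factor vanishes only if `q ^ (n + 1) = 1`. If the first one vanishes, either a power of `q`
with positive exponent is `-1`, so that its square is `1`, or `α = β` and `2α² = 0`. -/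
theorem fuseEigen_ne_zero {s : k} (hs : s ≠ 0) (h2 : (2 : k) ≠ 0)
    (hr : ∀ m : ℕ, 1 ≤ m → s ^ (2 * m) ≠ 1) {n w : ℕ} (hw : w ≤ n + 1) :
    fuseEigen s n w ≠ 0 := by
  obtain ⟨v, hv⟩ := Nat.exists_eq_add_of_le hw
  have e : ((n : ℤ) + 1 - w) = v := by omega
  intro h0
  simp only [fuseEigen, nq, e, zpow_natCast] at h0
  have hα : s ^ w ≠ 0 := pow_ne_zero _ hs
  have hβ : s ^ v ≠ 0 := pow_ne_zero _ hs
  have h1 : (s ^ w * s ^ v) ^ 2 ≠ 1 := by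
    rw [← pow_add, ← pow_mul, mul_comm]
    exact hr _ (by omega)
  have h3 : ((s ^ w) ^ 2 + (s ^ v) ^ 2) * ((s ^ w * s ^ v) ^ 2 - 1) = 0 := by
    field_simp at h0
    linear_combination h0
  rcases mul_eq_zero.mp h3 with h | h
  · have key : ∀ i j : ℕ, i < j → (s ^ i) ^ 2 + (s ^ j) ^ 2 ≠ 0 := by
      intro i j hij h
      obtain ⟨l, rfl⟩ := Nat.exists_eq_add_of_lt hij
      have hi : s ^ i ≠ 0 := pow_ne_zero _ hs
      have : (s ^ (l + 1)) ^ 2 = -1 := by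
        have : (s ^ i) ^ 2 * ((s ^ (l + 1)) ^ 2 + 1) = 0 := by
          rw [add_assoc, pow_add] at h
          linear_combination h
        rcases mul_eq_zero.mp this with h | h
        · exact absurd h (pow_ne_zero _ hi)
        · linear_combination h
      apply hr (2 * (l + 1)) (by omega)
      rw [show 2 * (2 * (l + 1)) = (l + 1) * 2 * 2 by ring, pow_mul, pow_mul, this]
      ring
    rcases lt_trichotomy w v with h' | h' | h'
    · exact key _ _ h' h
    · subst h'
      have : (2 : k) * (s ^ w) ^ 2 = 0 := by linear_combination h
      exact mul_ne_zero h2 (pow_ne_zero _ hα) this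
    · exact key _ _ h' (by linear_combination h)
  · exact h1 (by linear_combination h)

theorem diagonal_mul_fuse (s : k) (n : ℕ) (f : ℤ → k) :
    (Matrix.diagonal fun i : Fin 2 × Fin (n + 1) => f (i.2 + i.1 : ℤ)) * fuse s n
      = fuse s n * Matrix.diagonal fun i : Fin (n + 2) => f (i : ℤ) := by
  ext ⟨a, p⟩ r
  simp only [Matrix.diagonal_mul, Matrix.mul_diagonal, fuse, fuseBlock, shift, Matrix.of_apply]
  split_ifs with h
  · rw [h, mul_comm]; simp
  · simp

variable {g}

/-- Hence the kernel of the Lax operator `L₋` at `s^{-(n+1)}` lies in the image of the fusion map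
`E`. Let `L₊` be the operator at `s^{n+1}`. The difference `L₊ - L₋` is diagonal and invertible;
with inverse `Δ`, `1 = Δ L₊ - Δ L₋`. Since `L₊` factors through `E` and `Δ` depends on the weight
only, `Δ L₊` also has its image in that of `E` and is annihilated by `1 - E F`. There remains `1 - E
F = -(1 - E F) Δ L₋`. -/
theorem Gauge.exists_sub_eq_mul {s : k} (hs : s ≠ 0) (h2 : (2 : k) ≠ 0)
    (hr : ∀ m : ℕ, 1 ≤ m → s ^ (2 * m) ≠ 1) (n : ℕ)
    {F : Matrix (Fin (n + 2)) (Fin 2 × Fin (n + 1)) k} (hF : F * g.fuse s n = 1) :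
    ∃ M : Matrix (Fin 2 × Fin (n + 1)) (Fin 2 × Fin (n + 1)) k, 1 - g.fuse s n * F = M * g.lax s n (s ^ (n + 1))⁻¹ := by
  set Δ : Matrix (Fin 2 × Fin (n + 1)) (Fin 2 × Fin (n + 1)) k :=
    Matrix.diagonal fun i => (fuseEigen s n (i.2 + i.1 : ℤ))⁻¹ with hΔ
  have hΔ1 : Δ * (FusedK.lax s n (s ^ (n + 1)) - FusedK.lax s n (s ^ (n + 1))⁻¹) = 1 := by
    rw [lax_sub_lax hs, hΔ, Matrix.diagonal_mul_diagonal, ← Matrix.diagonal_one]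
    congr 1
    funext i
    have := fuseEigen_ne_zero hs h2 hr (n := n) (w := i.2 + i.1) (by omega)
    push_cast at this
    exact inv_mul_cancel₀ this
  have hΔE := diagonal_mul_fuse s n fun w => (fuseEigen s n w)⁻¹
  rw [← hΔ] at hΔE
  refine ⟨-((1 - g.fuse s n * F) * (site2 (Fin 2) (g.D n) * Δ * site2 (Fin 2) (g.D' n))), ?_⟩
  have e0 : (1 - g.fuse s n * F) * g.fuse s n = 0 := by
    rw [Matrix.sub_mul, Matrix.mul_assoc, hF]; simp
  have e1 : (1 - g.fuse s n * F) * (site2 (Fin 2) (g.D n) * FusedK.fuse s n) = 0 := by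
    have : site2 (Fin 2) (g.D n) * FusedK.fuse s n
        = (g.lam n)⁻¹ • (g.fuse s n * g.D (n + 1)) := by
      rw [Gauge.fuse, Matrix.smul_mul, smul_smul, inv_mul_cancel₀ (g.lam_ne n), one_smul,
        Matrix.mul_assoc, g.inv_mul, Matrix.mul_one]
    rw [this, Matrix.mul_smul, ← Matrix.mul_assoc, e0]; simp
  have e2 : site2 (Fin 2) (g.D n) * Δ * site2 (Fin 2) (g.D' n) * g.lax s n (s ^ (n + 1))⁻¹
      = site2 (Fin 2) (g.D n) * FusedK.fuse s n *
          ((Matrix.diagonal fun i : Fin (n + 2) => (fuseEigen s n (i : ℤ))⁻¹) * laxFactor k n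
            * site2 (Fin 2) (g.D' n)) - 1 := by
    have h3 : Δ * FusedK.lax s n (s ^ (n + 1))⁻¹
        = FusedK.fuse s n * ((Matrix.diagonal fun i : Fin (n + 2) => (fuseEigen s n (i : ℤ))⁻¹)
            * laxFactor k n) - 1 := by
      rw [← hΔ1, lax_eq_fuse_mul hs, Matrix.mul_sub, ← Matrix.mul_assoc Δ, hΔE, Matrix.mul_assoc]
      simp
    calc _ = site2 (Fin 2) (g.D n) * Δ * (site2 (Fin 2) (g.D' n) * site2 (Fin 2) (g.D n))
          * FusedK.lax s n (s ^ (n + 1))⁻¹ * site2 (Fin 2) (g.D' n) := by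
          simp only [Gauge.lax, Matrix.mul_assoc]
      _ = _ := by
          rw [g.site2_inv_mul, Matrix.mul_one, Matrix.mul_assoc (site2 _ _), h3, Matrix.mul_sub,
            Matrix.sub_mul, Matrix.mul_one, g.site2_mul_inv]
          simp only [Matrix.mul_assoc]
  rw [Matrix.neg_mul, Matrix.mul_assoc, e2, Matrix.mul_sub, ← Matrix.mul_assoc, e1]
  simp

/-- On the image of the fusion map the operator at `s^{-(n+1)}` vanishes, so the one at `s^{n+1}`
acts there as the difference of the two, which is diagonal and invertible on each weight space. -/
theorem Gauge.exists_eq_mul {s : k} (hs : s ≠ 0) (h2 : (2 : k) ≠ 0)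
    (hr : ∀ m : ℕ, 1 ≤ m → s ^ (2 * m) ≠ 1) (n : ℕ) :
    ∃ N : Matrix (Fin 2 × Fin (n + 1)) (Fin (n + 2)) k, g.fuse s n = g.lax s n (s ^ (n + 1)) * N := by
  set Δ : Matrix (Fin (n + 2)) (Fin (n + 2)) k :=
    Matrix.diagonal fun i => (fuseEigen s n (i : ℤ))⁻¹ with hΔ
  have h1 : FusedK.lax s n (s ^ (n + 1)) * FusedK.fuse s n * Δ = FusedK.fuse s n := by
    have h3 := congrArg (· * FusedK.fuse s n) (lax_sub_lax hs n)
    simp only [Matrix.sub_mul, lax_mul_fuse_eq_zero hs, sub_zero] at h3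
    rw [h3]
    have h4 := diagonal_mul_fuse s n (fuseEigen s n)
    simp only [fuseEigen] at h4
    rw [h4, Matrix.mul_assoc, hΔ, Matrix.diagonal_mul_diagonal]
    convert Matrix.mul_one _
    rw [← Matrix.diagonal_one]
    congr 1
    funext i
    exact mul_inv_cancel₀ (fuseEigen_ne_zero hs h2 hr (n := n) (w := i) (by omega))
  refine ⟨g.lam n • (site2 (Fin 2) (g.D n) * FusedK.fuse s n * Δ * g.D' (n + 1)), ?_⟩
  have : g.lax s n (s ^ (n + 1)) * (site2 (Fin 2) (g.D n) * FusedK.fuse s n * Δ * g.D' (n + 1))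
      = site2 (Fin 2) (g.D n) * FusedK.lax s n (s ^ (n + 1))
        * (site2 (Fin 2) (g.D' n) * site2 (Fin 2) (g.D n)) * FusedK.fuse s n * Δ
        * g.D' (n + 1) := by
    simp only [Gauge.lax, Matrix.mul_assoc]
  rw [Matrix.mul_smul, this, g.site2_inv_mul, Matrix.mul_one, Gauge.fuse]
  congr 1
  conv_lhs => rw [← h1]
  simp only [Matrix.mul_assoc]

end Gauge

/-! ### Constants in `ℂ((u⁻¹))` -/

section Constants

theorem cst_eq (a : ℂ) : cst a = (HahnSeries.C : ℂ →+* Sc) a := rfl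

theorem cst_mul (a b : ℂ) : cst (a * b) = cst a * cst b := by simp only [cst_eq, map_mul]
theorem cst_add (a b : ℂ) : cst (a + b) = cst a + cst b := by simp only [cst_eq, map_add]
theorem cst_sub (a b : ℂ) : cst (a - b) = cst a - cst b := by simp only [cst_eq, map_sub]
theorem cst_inv (a : ℂ) : cst a⁻¹ = (cst a)⁻¹ := by simp only [cst_eq, map_inv₀]
theorem cst_div (a b : ℂ) : cst (a / b) = cst a / cst b := by simp only [cst_eq, map_div₀]
theorem cst_zpow (a : ℂ) (m : ℤ) : cst (a ^ m) = cst a ^ m := by simp only [cst_eq, map_zpow₀]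
theorem cst_pow (a : ℂ) (m : ℕ) : cst (a ^ m) = cst a ^ m := by simp only [cst_eq, map_pow]
theorem cst_zero : cst 0 = 0 := by simp only [cst_eq, map_zero]
theorem cst_one : cst 1 = 1 := by simp only [cst_eq, map_one]

theorem cst_injective : Function.Injective cst := (HahnSeries.C : ℂ →+* Sc).injective

theorem cst_ne_zero {a : ℂ} (h : a ≠ 0) : cst a ≠ 0 := by
  rw [← cst_zero]; exact cst_injective.ne h

theorem cst_nq (s : ℂ) (m : ℤ) : cst (nq s m) = nq (cst s) m := by
  simp only [nq, cst_sub, cst_inv, cst_pow, cst_zpow]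

end Constants

/-! ### The given R-matrices and fusion maps as gauge transforms -/

section RootFree

variable {s : ℂ}

/-- `s` is a square root of a nonzero complex number that is not a root of unity. -/
structure Generic (s : ℂ) : Prop where
  ne : s ≠ 0
  pow_ne : ∀ m : ℕ, 1 ≤ m → s ^ (2 * m) ≠ 1

theorem Generic.zpow_ne (h : Generic s) {m : ℤ} (hm : m ≠ 0) : s ^ (2 * m) ≠ 1 := by
  rcases Int.natAbs_eq m with e | e
  · rw [e]
    exact_mod_cast h.pow_ne _ (by omega)
  · rw [e, mul_neg, zpow_neg, ne_eq, inv_eq_one]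
    exact_mod_cast h.pow_ne _ (by omega)

theorem Generic.nq_ne (h : Generic s) {m : ℤ} (hm : m ≠ 0) : nq s m ≠ 0 := by
  intro h0
  have h1 : s ^ m ≠ 0 := zpow_ne_zero _ h.ne
  apply h.zpow_ne (m := 2 * m) (by omega)
  have : s ^ (2 * (2 * m)) = ((s ^ m) ^ 2) ^ 2 := by
    rw [← zpow_natCast, ← zpow_natCast, ← zpow_mul, ← zpow_mul]; congr 1; push_cast; ring
  rw [this]
  simp only [nq] at h0
  field_simp at h0
  linear_combination h0

theorem nq_eq (h : Generic s) (m : ℤ) : nq s m = (qq s - (qq s)⁻¹) * qnum s m := by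
  have h1 : qq s - (qq s)⁻¹ ≠ 0 := by
    have := h.nq_ne (m := 1) one_ne_zero
    simpa only [nq, qq, zpow_one] using this
  rw [qnum, mul_div_cancel₀ _ h1, nq, qq, zpow_neg]
  simp only [← zpow_natCast, ← zpow_mul, mul_comm]

theorem Generic.qnum_ne (h : Generic s) {m : ℤ} (hm : m ≠ 0) : qnum s m ≠ 0 := by
  have := h.nq_ne hm
  rw [nq_eq h] at this
  exact right_ne_zero_of_mul this

/-- The square roots enter through this identity; the choice of branch matters only for `B s 1 0 =
1` in `Generic.Rhalf_one`. -/
theorem B_sq (s : ℂ) (n p : ℕ) : B s n p ^ 2 = qnum s (n - p) * qnum s (p + 1) := by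
  simp [B]

theorem Generic.B_ne (h : Generic s) {n p : ℕ} (hp : p < n) : B s n p ≠ 0 := by
  intro h0
  have := B_sq s n p
  rw [h0] at this
  exact mul_ne_zero (h.qnum_ne (m := (n : ℤ) - p) (by omega)) (h.qnum_ne (m := (p : ℤ) + 1) (by omega))
    (by rw [← this]; ring)

/-- The rescaling of the `b`-th basis vector that removes the square roots. -/
def rescale (s : ℂ) (n b : ℕ) : ℂ := ∏ p ∈ Finset.range b, B s n p / qnum s (n - p)

theorem rescale_succ (s : ℂ) (n b : ℕ) :
    rescale s n (b + 1) = rescale s n b * (B s n b / qnum s (n - b)) :=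
  Finset.prod_range_succ _ _

theorem Generic.rescale_ne (h : Generic s) {n b : ℕ} (hb : b ≤ n) : rescale s n b ≠ 0 := by
  refine Finset.prod_ne_zero_iff.mpr fun p hp => ?_
  rw [Finset.mem_range] at hp
  exact div_ne_zero (h.B_ne (by omega)) (h.qnum_ne (m := (n : ℤ) - p) (by omega))

/-- The gauge in which the Lax operators are the R-matrices. -/
def Generic.gauge (h : Generic s) : Gauge Sc where
  D n := Matrix.diagonal fun b => cst (rescale s n b)
  D' n := Matrix.diagonal fun b => cst (rescale s n b)⁻¹
  lam n := cst (nq s (n + 1))⁻¹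
  mul_inv n := by
    rw [Matrix.diagonal_mul_diagonal, ← Matrix.diagonal_one]
    congr 1; funext b
    rw [← cst_mul, mul_inv_cancel₀ (h.rescale_ne (by omega)), cst_one]
  inv_mul n := by
    rw [Matrix.diagonal_mul_diagonal, ← Matrix.diagonal_one]
    congr 1; funext b
    rw [← cst_mul, inv_mul_cancel₀ (h.rescale_ne (by omega)), cst_one]
  lam_ne n := cst_ne_zero (inv_ne_zero (h.nq_ne (by omega)))

theorem site2_diagonal {k a b : Type*} [Zero k] [DecidableEq a] [DecidableEq b] (f : b → k) :
    site2 a (Matrix.diagonal f) = Matrix.diagonal fun i => f i.2 := by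
  ext ⟨i, j⟩ ⟨i', j'⟩
  by_cases h : i = i' <;> by_cases h' : j = j' <;> simp [site2, Matrix.diagonal_apply, h, h']

theorem Generic.gauge_lax_apply (h : Generic s) (n : ℕ) (x : Sc) (a a' : Fin 2)
    (p r : Fin (n + 1)) :
    h.gauge.lax (cst s) n x (a, p) (a', r)
      = if (p : ℤ) = r + ((a' : ℤ) - a)
        then cst (rescale s n p / rescale s n r) * laxCoef (cst s) n x a a' r else 0 := by
  simp only [Gauge.lax, Generic.gauge, site2_diagonal, Matrix.mul_diagonal, Matrix.diagonal_mul,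
    lax, ofBlocks, laxBlock, shift, Matrix.of_apply]
  split_ifs
  · rw [div_eq_mul_inv, cst_mul]; ring
  · ring

theorem Generic.rescale_div_succ (h : Generic s) {n b : ℕ} (hb : b ≤ n) :
    rescale s n (b + 1) / rescale s n b = B s n b / qnum s (n - b) := by
  rw [rescale_succ, mul_div_cancel_left₀ _ (h.rescale_ne hb)]

theorem Generic.rescale_succ_mul_nq (h : Generic s) {n b : ℕ} (hb : b < n) :
    rescale s n (b + 1) / rescale s n b * nq s (n - b) = (qq s - (qq s)⁻¹) * B s n b := by
  have h1 := h.qnum_ne (m := (n : ℤ) - b) (by omega)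
  rw [h.rescale_div_succ hb.le, nq_eq h]
  field_simp

theorem Generic.rescale_mul_nq_succ (h : Generic s) {n b : ℕ} (hb : b < n) :
    rescale s n b / rescale s n (b + 1) * nq s (b + 1) = (qq s - (qq s)⁻¹) * B s n b := by
  have h1 := h.qnum_ne (m := (n : ℤ) - b) (by omega)
  have h2 := h.B_ne hb
  rw [← inv_div, h.rescale_div_succ hb.le, nq_eq h, inv_div]
  rw [div_mul_eq_mul_div, div_eq_iff h2, mul_assoc _ (B s n b), ← sq, B_sq]
  ring

/-- The R-matrix is a scalar multiple of a gauge transform of the Lax operator. -/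
theorem Rhalf_eq (h : Generic s) (n : ℕ) (x : Sc) :
    Rhalf s n x = (∏ k ∈ Finset.range (n - 1), c (cst (s ^ ((n : ℤ) - 1 - 2 * k)) * x))
      • h.gauge.lax (cst s) n x := by
  rw [Rhalf]
  congr 1
  have hs : cst s ≠ 0 := cst_ne_zero h.ne
  refine Matrix.ext fun ⟨a, p⟩ ⟨a', r⟩ => ?_
  rw [h.gauge_lax_apply]
  simp only [Matrix.add_apply, Matrix.map_apply, piF, piE, sigmaP, sigmaM, Matrix.of_apply,
    Matrix.smul_apply, Matrix.kroneckerMap_apply, Matrix.diagonal_apply, Prod.mk.injEq, laxCoef]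
  have hp := p.isLt
  have hr := r.isLt
  have hinv : ∀ e : ℤ, cst (s ^ (-e)) = (cst (s ^ e))⁻¹ := fun e => by rw [zpow_neg, cst_inv]
  fin_cases a <;> fin_cases a'
  · have e : cst s * cst s ^ n / (cst s ^ (r : ℕ)) ^ 2 = cst (s ^ (1 + ((n : ℤ) - 2 * r))) := by
      rw [cst_zpow, zpow_add₀ hs, zpow_sub₀ hs, mul_comm 2, zpow_mul]
      simp [zpow_natCast]
      ring
    by_cases hpr : p = r
    · subst hpr
      have hd := h.rescale_ne (n := n) (b := p) (by omega)
      have e' := hinv (1 + ((n : ℤ) - 2 * p))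
      rw [show -(1 + ((n : ℤ) - 2 * p)) = 2 * p - n + -1 by ring, ← e] at e'
      simp [hexp, hd, cst_zero, cst_one, ← e, e']
      ring
    · have : (p : ℕ) ≠ r := fun h => hpr (Fin.ext h)
      simp [hpr, this, cst_zero]
  · by_cases hpr : (p : ℕ) = r + 1
    · have := congrArg cst (h.rescale_succ_mul_nq (n := n) (b := r) (by omega))
      rw [cst_mul, cst_nq] at this
      simp [hpr, this]
    · have : (p : ℤ) ≠ r + 1 := by omega
      simp [hpr, this, cst_zero]
  · by_cases hpr : (r : ℕ) = p + 1
    · have := congrArg cst (h.rescale_mul_nq_succ (n := n) (b := p) (by omega))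
      rw [cst_mul, cst_nq] at this
      simp [hpr, this]
    · have : (p : ℤ) ≠ r + -1 := by omega
      simp [hpr, this, cst_zero]
  · have e : cst s * (cst s ^ (r : ℕ)) ^ 2 / cst s ^ n = cst (s ^ (1 - ((n : ℤ) - 2 * r))) := by
      rw [cst_zpow, zpow_sub₀ hs, zpow_sub₀ hs, mul_comm 2, zpow_mul]
      simp [zpow_natCast]
      field_simp
    by_cases hpr : p = r
    · subst hpr
      have hd := h.rescale_ne (n := n) (b := p) (by omega)
      have e' := hinv (1 - ((n : ℤ) - 2 * p))
      rw [show -(1 - ((n : ℤ) - 2 * p)) = n - 2 * p + -1 by ring, ← e] at e'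
      rw [show 1 - ((n : ℤ) - 2 * p) = 1 + (2 * p - n) by ring] at e
      simp [hexp, hd, cst_zero, cst_one, ← e, e']
      ring
    · have : (p : ℕ) ≠ r := fun h => hpr (Fin.ext h)
      simp [hpr, this, cst_zero]

/-- The square roots are absorbed by the quotient of the rescalings, and the remaining product of
`[n - p] / [n + 1 - p]` telescopes to `[n + 1 - b] / [n + 1]`. -/
theorem Generic.eUp_eq (h : Generic s) {n b : ℕ} (hb : b ≤ n) :
    eUp s n b = (nq s (n + 1))⁻¹ * (rescale s n b / rescale s (n + 1) b) * nq s (n + 1 - b) := by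
  have h0 : nq s (n + 1) ≠ 0 := h.nq_ne (by omega)
  induction b with
  | zero => simp [eUp, rescale, h0]
  | succ b ih =>
    have e : eUp s n (b + 1) = eUp s n b * (B s n b / B s (n + 1) b) := Finset.prod_range_succ _ _
    have h1 := h.qnum_ne (m := (n : ℤ) - b) (by omega)
    have h2 := h.qnum_ne (m := (n : ℤ) + 1 - b) (by omega)
    have h3 := h.B_ne (n := n + 1) (p := b) (by omega)
    have h4 := h.rescale_ne (n := n + 1) (b := b) (by omega)
    rw [e, ih (by omega), rescale_succ, rescale_succ, nq_eq h (n + 1 - b),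
      nq_eq h (n + 1 - (b + 1 : ℕ))]
    push_cast
    rw [show (n : ℤ) + 1 - (b + 1) = n - b by ring]
    field_simp

theorem Generic.eDown_eq (h : Generic s) {n b : ℕ} (hb : b ≤ n) :
    eDown s n (b + 1)
      = (nq s (n + 1))⁻¹ * (rescale s n b / rescale s (n + 1) (b + 1)) * nq s (b + 1) := by
  have h0 : nq s (n + 1) ≠ 0 := h.nq_ne (by omega)
  have h2 := h.qnum_ne (m := (n : ℤ) + 1 - b) (by omega)
  have h3 := h.B_ne (n := n + 1) (p := b) (by omega)
  have h4 := h.rescale_ne (n := n + 1) (b := b) (by omega)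
  rw [eDown, Nat.add_sub_cancel, h.eUp_eq hb, rescale_succ, nq_eq h (n + 1 - b), nq_eq h (b + 1)]
  push_cast
  field_simp

theorem Generic.calE_map (h : Generic s) (n : ℕ) :
    (calE s n).map cst = h.gauge.fuse (cst s) n := by
  have key : ∀ a p r, h.gauge.fuse (cst s) n (a, p) r = if (p : ℤ) = r + -(a : ℤ)
      then cst ((nq s (n + 1))⁻¹ * (rescale s n p / rescale s (n + 1) r))
        * fuseCoef (cst s) n a r else 0 := by
    intro a p r
    simp only [Gauge.fuse, Generic.gauge, site2_diagonal, Matrix.mul_diagonal, Matrix.diagonal_mul,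
      fuse, fuseBlock, shift, Matrix.of_apply, Matrix.smul_apply]
    split_ifs
    · rw [div_eq_mul_inv, cst_mul, cst_mul, smul_eq_mul]; ring
    · simp
  refine Matrix.ext fun ⟨a, p⟩ r => ?_
  have hp := p.isLt
  have hr := r.isLt
  rw [key]
  simp only [calE, Matrix.map_apply, Matrix.of_apply, fuseCoef]
  fin_cases a
  · by_cases hpr : (r : ℕ) = p
    · have := congrArg cst (h.eUp_eq (n := n) (b := p) (by omega))
      rw [cst_mul, cst_nq] at this
      simp [hpr, this]
    · have : (p : ℤ) ≠ r := by omega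
      simp [hpr, this, cst_zero]
  · by_cases hpr : (r : ℕ) = p + 1
    · have := congrArg cst (h.eDown_eq (n := n) (b := p) (by omega))
      rw [cst_mul, cst_nq] at this
      simp [hpr, this]
    · have : (p : ℤ) ≠ r + -1 := by omega
      simp [hpr, this, cst_zero]

/-- A diagonal entry is a sum over at most two vectors, `↑ ⊗ |b⟩` and `↓ ⊗ |b - 1⟩`. The second is
missing for `b = 0` and the first for `b = n + 1`, which explains the special values of `fUp` and
`fDown`. In between, `fUp` is defined so that the two contributions add up to `1` whatever `fDown`
is; only `eUp ≠ 0` is needed, not `eUp² + eDown² ≠ 0`. -/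
theorem Generic.calF_mul_calE (h : Generic s) (n : ℕ) : calF s n * calE s n = 1 := by
  refine Matrix.ext fun b r => ?_
  have hb := b.isLt
  have hr := r.isLt
  have hup : ∀ {i : ℕ}, i ≤ n → eUp s n i ≠ 0 := fun {i} hi => by
    refine Finset.prod_ne_zero_iff.mpr fun p hp => ?_
    rw [Finset.mem_range] at hp
    exact div_ne_zero (h.B_ne (by omega)) (h.B_ne (by omega))
  simp only [Matrix.mul_apply, Fintype.sum_prod_type, Fin.sum_univ_two, calF, calE, Matrix.of_apply]
  by_cases hbr : b = r
  · subst hbr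
    have h1 : (∑ p : Fin (n + 1), (if (b : ℕ) = p then fUp s n b else 0)
        * (if (b : ℕ) = p then eUp s n b else 0))
          = if (b : ℕ) ≤ n then fUp s n b * eUp s n b else 0 := by
      split_ifs with hbn
      · rw [Finset.sum_eq_single (⟨b, by omega⟩ : Fin (n + 1))]
        · simp
        · intro p _ hp
          rw [if_neg fun e => hp (Fin.ext e.symm), zero_mul]
        · simp
      · refine Finset.sum_eq_zero fun p _ => ?_
        rw [if_neg (by omega), zero_mul]
    have h2 : (∑ p : Fin (n + 1), (if (b : ℕ) = p + 1 then fDown s n b else 0)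
        * (if (b : ℕ) = p + 1 then eDown s n b else 0))
          = if 1 ≤ (b : ℕ) then fDown s n b * eDown s n b else 0 := by
      split_ifs with hbn
      · rw [Finset.sum_eq_single (⟨b - 1, by omega⟩ : Fin (n + 1))]
        · rw [if_pos (by simp; omega), if_pos (by simp; omega)]
        · intro p _ hp
          rw [if_neg fun e => hp (Fin.ext (by simp; omega)), zero_mul]
        · simp
      · refine Finset.sum_eq_zero fun p _ => ?_
        rw [if_neg (by omega), zero_mul]
    simp only [if_true, one_ne_zero, if_false, h1, h2, Matrix.one_apply_eq]
    rcases Nat.eq_zero_or_pos b with hb0 | hb0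
    · simp [hb0, fUp, eUp]
    · rw [if_pos (show 1 ≤ (b : ℕ) from hb0)]
      by_cases hbn : (b : ℕ) ≤ n
      · rw [if_pos hbn, fUp, if_neg (by omega), div_mul_cancel₀ _ (hup hbn)]
        ring
      · have hbn : (b : ℕ) = n + 1 := by omega
        have hd : eDown s n (n + 1) ≠ 0 :=
          div_ne_zero (mul_ne_zero (h.qnum_ne (by omega)) (hup (by simp))) (h.B_ne (by simp))
        rw [if_neg (by omega), fDown, if_pos hbn, zero_add, hbn, inv_mul_cancel₀ hd]
  · have hbr' : (b : ℕ) ≠ r := fun e => hbr (Fin.ext e)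
    rw [Matrix.one_apply_ne hbr]
    simp only [if_true, one_ne_zero, if_false]
    rw [Finset.sum_eq_zero fun p _ => ?_, Finset.sum_eq_zero fun p _ => ?_, add_zero]
    · split_ifs <;> first | omega | simp
    · split_ifs <;> first | omega | simp

theorem Generic.Rhalf_one (h : Generic s) (x : Sc) : Rhalf s 1 x = sixVertex (cst (qq s)) x := by
  have hq : qq s - (qq s)⁻¹ ≠ 0 := by
    have := h.nq_ne (m := 1) one_ne_zero
    simpa [nq, qq] using this
  have hB : B s 1 0 = 1 := by simp [B, qnum, hq]
  refine Matrix.ext fun ⟨a, p⟩ ⟨a', r⟩ => ?_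
  fin_cases a <;> fin_cases a' <;> fin_cases p <;> fin_cases r <;>
    simp [Rhalf, sixVertex, piF, piE, sigmaP, sigmaM, hexp, hB, cst_zero, cst_one, cst_sub,
      cst_inv, qq, mul_comm]

end RootFree

/-! ### Substitution of central series into formal power series -/

section Evaluation

open PowerSeries

variable {S A : Type*} [Ring S] [Ring A] [Algebra ℂ A]

/-- The series `y`, with complex coefficients, as a central series over `A`. -/
def central (A : Type*) [Ring A] [Algebra ℂ A] : PowerSeries ℂ →+* PowerSeries A :=
  PowerSeries.map (algebraMap ℂ A)

theorem central_commute (y : PowerSeries ℂ) (f : PowerSeries A) :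
    central A y * f = f * central A y := by
  ext n
  rw [coeff_mul, coeff_mul, ← Finset.Nat.sum_antidiagonal_swap]
  refine Finset.sum_congr rfl fun p _ => ?_
  simp only [central, coeff_map, Prod.fst_swap, Prod.snd_swap, Algebra.commutes]

theorem coeff_mul_central_pow {y : PowerSeries ℂ} (hy : constantCoeff y = 0) (f : PowerSeries A)
    {n N : ℕ} (h : n < N) : coeff n (f * central A y ^ N) = 0 := by
  rw [coeff_mul]
  refine Finset.sum_eq_zero fun p hp => ?_
  have := X_pow_dvd_iff.mp (pow_dvd_pow_of_dvd (X_dvd_iff.mpr hy) N) p.2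
    (by have := Finset.HasAntidiagonal.mem_antidiagonal.mp hp; omega)
  rw [← map_pow, central, coeff_map, this, map_zero, mul_zero]

/-- The partial sums of the evaluation. -/
def evalPartial (θ : S →+* PowerSeries A) (y : PowerSeries ℂ) (N : ℕ) (f : PowerSeries S) :
    PowerSeries A :=
  ∑ j ∈ Finset.range N, θ (coeff j f) * central A y ^ j

theorem coeff_evalPartial (θ : S →+* PowerSeries A) {y : PowerSeries ℂ}
    (hy : constantCoeff y = 0) (f : PowerSeries S) {n N : ℕ} (h : n < N) :
    coeff n (evalPartial θ y N f) = coeff n (evalPartial θ y (n + 1) f) := by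
  simp only [evalPartial, map_sum]
  symm
  refine Finset.sum_subset (by intro j; simp; omega) fun j _ hj => ?_
  exact coeff_mul_central_pow hy _ (by simpa using hj)

/-- The truncation of the product runs over the triangle `p.1 + p.2 < N`, the product of the
truncations over the square. The additional terms contain `y ^ j` with `j ≥ N > n` and do not reach
degree `n`. -/
theorem coeff_evalPartial_mul (θ : S →+* PowerSeries A) {y : PowerSeries ℂ}
    (hy : constantCoeff y = 0) (f g : PowerSeries S) {n N : ℕ} (h : n < N) :
    coeff n (evalPartial θ y N (f * g))
      = coeff n (evalPartial θ y N f * evalPartial θ y N g) := by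
  have e1 : evalPartial θ y N (f * g)
      = ∑ p ∈ (Finset.range N ×ˢ Finset.range N).filter (fun p => p.1 + p.2 < N),
          θ (coeff p.1 f) * θ (coeff p.2 g) * central A y ^ (p.1 + p.2) := by
    simp only [evalPartial, coeff_mul, map_sum, map_mul, Finset.sum_mul]
    rw [← Finset.sum_fiberwise_of_maps_to (t := Finset.range N) (g := fun p : ℕ × ℕ => p.1 + p.2)
      (by intro p hp; exact Finset.mem_range.mpr (Finset.mem_filter.mp hp).2)]
    refine Finset.sum_congr rfl fun m hm => ?_
    have hs : ((Finset.range N ×ˢ Finset.range N).filter (fun p => p.1 + p.2 < N)).filter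
        (fun p => p.1 + p.2 = m) = Finset.HasAntidiagonal.antidiagonal m := by
      ext p
      have := Finset.mem_range.mp hm
      simp only [Finset.mem_filter, Finset.mem_product, Finset.mem_range,
        Finset.HasAntidiagonal.mem_antidiagonal]
      omega
    rw [hs]
    refine Finset.sum_congr rfl fun p hp => ?_
    rw [Finset.HasAntidiagonal.mem_antidiagonal.mp hp]
  have e2 : evalPartial θ y N f * evalPartial θ y N g
      = ∑ p ∈ Finset.range N ×ˢ Finset.range N,
          θ (coeff p.1 f) * θ (coeff p.2 g) * central A y ^ (p.1 + p.2) := by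
    simp only [evalPartial]
    rw [Finset.sum_mul_sum, ← Finset.sum_product']
    refine Finset.sum_congr rfl fun p _ => ?_
    rw [pow_add, ← map_pow, ← map_pow, mul_assoc, ← mul_assoc (central A _) (θ _),
      central_commute]
    simp only [mul_assoc]
  rw [e1, e2, map_sum, map_sum]
  refine Finset.sum_subset (Finset.filter_subset _ _) fun p hp hp' => ?_
  refine coeff_mul_central_pow hy _ ?_
  have : N ≤ p.1 + p.2 := by
    by_contra h
    exact hp' (Finset.mem_filter.mpr ⟨hp, by omega⟩)
  omega

/-- Evaluation at a central series without constant term, the coefficients being mapped by `θ`. -/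
def evalAt (θ : S →+* PowerSeries A) (y : PowerSeries ℂ) (hy : constantCoeff y = 0) :
    PowerSeries S →+* PowerSeries A where
  -- Since `y` has no constant term, the coefficient of degree `n` is already final after `n + 1`
  -- terms.
  toFun f := PowerSeries.mk fun n => coeff n (evalPartial θ y (n + 1) f)
  map_one' := by
    ext n
    rw [coeff_mk, evalPartial, Finset.sum_eq_single 0]
    · simp
    · intro j _ hj; simp [coeff_one, hj]
    · simp
  map_zero' := by ext n; simp [evalPartial]
  map_add' f g := by ext n; simp [evalPartial, add_mul, Finset.sum_add_distrib]
  map_mul' f g := by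
    ext n
    rw [coeff_mk, coeff_evalPartial_mul θ hy _ _ (Nat.lt_succ_self n), coeff_mul, coeff_mul]
    refine Finset.sum_congr rfl fun p hp => ?_
    have := Finset.HasAntidiagonal.mem_antidiagonal.mp hp
    rw [coeff_mk, coeff_mk, coeff_evalPartial θ hy f (by omega : p.1 < n + 1),
      coeff_evalPartial θ hy g (by omega : p.2 < n + 1)]

theorem evalAt_C (θ : S →+* PowerSeries A) (y : PowerSeries ℂ) (hy : constantCoeff y = 0) (a : S) :
    evalAt θ y hy (C a) = θ a := by
  ext n
  simp only [evalAt, RingHom.coe_mk, MonoidHom.coe_mk, OneHom.coe_mk, coeff_mk, evalPartial]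
  rw [Finset.sum_eq_single 0]
  · simp
  · intro j _ hj; simp [coeff_C, hj]
  · simp

theorem evalAt_X (θ : S →+* PowerSeries A) (y : PowerSeries ℂ) (hy : constantCoeff y = 0) :
    evalAt θ y hy X = central A y := by
  ext n
  simp only [evalAt, RingHom.coe_mk, MonoidHom.coe_mk, OneHom.coe_mk, coeff_mk]
  rw [← coeff_evalPartial θ hy _ (by omega : n < n + 2), evalPartial, Finset.sum_eq_single 1]
  · simp
  · intro j _ hj; simp [coeff_X, hj]
  · simp

/-- The bridge from the ring homomorphism `evalAt` to the truncated sums by which `genAt` is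
defined. -/
theorem evalAt_X_mul_mk (y : PowerSeries ℂ) (hy : constantCoeff y = 0)
    (θ : S →+* PowerSeries A) (w : ℕ → S) (w' : ℕ → A) (h : ∀ j, θ (w j) = C (w' j)) :
    evalAt θ y hy (X * PowerSeries.mk w) = PowerSeries.mk fun n =>
      ∑ k ∈ Finset.range n, (coeff n (y ^ (k + 1))) • w' k := by
  ext n
  simp only [evalAt, RingHom.coe_mk, MonoidHom.coe_mk, OneHom.coe_mk, coeff_mk, evalPartial,
    Finset.sum_range_succ', coeff_succ_X_mul, coeff_zero_X_mul]
  simp only [map_zero, zero_mul, add_zero, h, ← map_pow, map_sum]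
  refine Finset.sum_congr rfl fun k _ => ?_
  rw [coeff_C_mul, central, coeff_map, ← Algebra.commutes, Algebra.smul_def]

end Evaluation

/-! ### Homogeneous form of the relations -/

section Homogenise

variable {k A : Type*} [Field k] [Ring A] [Algebra k A]

-- `Y` and `Z` stand for `U⁻¹` and `V⁻¹`; multiplication by `Y⁻¹ Z⁻¹` undoes the clearing of
-- denominators. The constants added to the rescaled series `G_±` are those of the K-operator, and
-- they absorb the terms linear in the generators, so that all relations become quadratic.
set_option maxHeartbeats 1000000 in
theorem RelAt.of_relations {q kp km Y Z : k} (hq : q ≠ 0) (hq1 : q ^ 2 + 1 ≠ 0)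
    (hq2 : q ^ 2 - 1 ≠ 0) (hkp : kp ≠ 0) (hkm : km ≠ 0) (hY : Y ≠ 0) (hZ : Z ≠ 0)
    {w g w' g' : Bool → A}
    (h1 : ∀ e, w e * w' e - w' e * w e = 0)
    (h2 : w true * w' false - w' false * w true + (w false * w' true - w' true * w false) = 0)
    (h3 : ∀ d e, g d * w' e - w' e * g d + (w e * g' d - g' d * w e) = 0)
    (h4 : ∀ e, g e * g' e - g' e * g e = 0)
    (h5 : g true * g' false - g' false * g true + (g false * g' true - g' true * g false) = 0)
    (h6 : (Z - Y) • (w true * w' false - w' false * w true)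
        - (Y * Z) • (((q - q⁻¹) / (kp * km * (q + q⁻¹) ^ 2 * (q + q⁻¹))) •
              (g true * g' false - g' true * g false)
            + (1 / (q + q⁻¹)) • (g true - g false + g' false - g' true)) = 0)
    (h7 : (Z - Y) • (w true * w' true - w false * w' false
            + (1 / (kp * km * (q + q⁻¹) ^ 2 * (q ^ 2 - q⁻¹ ^ 2)))
              • (g true * g' false - g' false * g true))
        + (Y * Z - 1) • (w true * w' false - w' true * w false) = 0)
    (h8 : ∀ e, Z • (q • (g' (!e) * w e) - q⁻¹ • (w e * g' (!e)))
          - Y • (q • (g (!e) * w' e) - q⁻¹ • (w' e * g (!e)))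
        - (q - q⁻¹) • (Y * Z) • (w (!e) * g' (!e) - w' (!e) * g (!e))
        + (kp * km * (q + q⁻¹) ^ 2) • (Z • w e - Y • w' e - (Y * Z) • w (!e) + (Y * Z) • w' (!e))
          = 0)
    (h9 : ∀ e, Z • (q • (w (!e) * g' (!e)) - q⁻¹ • (g' (!e) * w (!e)))
          - Y • (q • (w' (!e) * g (!e)) - q⁻¹ • (g (!e) * w' (!e)))
        - (q - q⁻¹) • (Y * Z) • (w e * g' (!e) - w' e * g (!e))
        + (kp * km * (q + q⁻¹) ^ 2) • (Z • w (!e) - Y • w' (!e) - (Y * Z) • w e + (Y * Z) • w' e)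
          = 0) :
    RelAt q Y⁻¹ Z⁻¹ (w true) (w false)
      ((1 / (km * (q + q⁻¹))) • g true + (kp * (q + q⁻¹) / (q - q⁻¹)) • 1)
      ((1 / (kp * (q + q⁻¹))) • g false + (km * (q + q⁻¹) / (q - q⁻¹)) • 1)
      (w' true) (w' false)
      ((1 / (km * (q + q⁻¹))) • g' true + (kp * (q + q⁻¹) / (q - q⁻¹)) • 1)
      ((1 / (kp * (q + q⁻¹))) • g' false + (km * (q + q⁻¹) / (q - q⁻¹)) • 1) := by
  have hs : q + q⁻¹ ≠ 0 := by
    intro h; apply hq1; field_simp at h; linear_combination h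
  have hd : q - q⁻¹ ≠ 0 := by
    intro h; apply hq2; field_simp at h; linear_combination h
  have h7' := h7
  obtain ⟨h8t, h8f⟩ := And.intro (h8 true) (h8 false)
  obtain ⟨h9t, h9f⟩ := And.intro (h9 true) (h9 false)
  have e1 : q ^ 2 - q⁻¹ ^ 2 = (q - q⁻¹) * (q + q⁻¹) := by ring
  rw [e1] at h7'
  simp only [Bool.not_true, Bool.not_false] at h8t h8f h9t h9f
  have ma : ∀ a b c : A, a * (b + c) = a * b + a * c := mul_add
  have am : ∀ a b c : A, (a + b) * c = a * c + b * c := add_mul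
  constructor
  · exact h1 true
  · exact h1 false
  · exact h2
  all_goals simp only [ma, am, smul_mul_assoc, mul_smul_comm, mul_one, one_mul]
  · linear_combination (norm := skip) (1 / (km * (q + q⁻¹))) • h3 true true
    simp only [smul_add, smul_sub, smul_zero]
    module
  · linear_combination (norm := skip) (1 / (km * (q + q⁻¹))) • h3 true false
    simp only [smul_add, smul_sub, smul_zero]
    module
  · linear_combination (norm := skip) (1 / (kp * (q + q⁻¹))) • h3 false true
    simp only [smul_add, smul_sub, smul_zero]
    module
  · linear_combination (norm := skip) (1 / (kp * (q + q⁻¹))) • h3 false false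
    simp only [smul_add, smul_sub, smul_zero]
    module
  · linear_combination (norm := skip) ((1 / (km * (q + q⁻¹))) * (1 / (km * (q + q⁻¹)))) • h4 true
    simp only [smul_sub, smul_zero, smul_smul]
    module
  · linear_combination (norm := skip) ((1 / (kp * (q + q⁻¹))) * (1 / (kp * (q + q⁻¹)))) • h4 false
    simp only [smul_sub, smul_zero, smul_smul]
    module
  · linear_combination (norm := skip) ((1 / (km * (q + q⁻¹))) * (1 / (kp * (q + q⁻¹)))) • h5
    simp only [smul_add, smul_sub, smul_zero, smul_smul]
    module
  · linear_combination (norm := skip) (Y⁻¹ * Z⁻¹) • h6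
    match_scalars <;> field_simp <;> ring
  · linear_combination (norm := skip) (Y⁻¹ * Z⁻¹) • h7'
    match_scalars <;> field_simp <;> ring
  · linear_combination (norm := skip) ((1 / (kp * (q + q⁻¹))) * Y⁻¹ * Z⁻¹) • h8t
    match_scalars <;> field_simp <;> ring
  · linear_combination (norm := skip) ((1 / (km * (q + q⁻¹))) * Y⁻¹ * Z⁻¹) • h8f
    match_scalars <;> field_simp <;> ring
  · linear_combination (norm := skip) ((1 / (kp * (q + q⁻¹))) * Y⁻¹ * Z⁻¹) • h9t
    match_scalars <;> field_simp <;> ring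
  · linear_combination (norm := skip) ((1 / (km * (q + q⁻¹))) * Y⁻¹ * Z⁻¹) • h9f
    match_scalars <;> field_simp <;> ring

end Homogenise

section

variable {s kp km : ℂ}

/-! ### `A_q((u⁻¹))` as an algebra over the field `ℂ((u⁻¹))` -/

section Scalars

variable (s kp km) in
/-- The inclusion of the scalar Laurent series as a ring homomorphism. -/
def toAqHom : Sc →+* AqL s kp km where
  toFun := toAq s kp km
  map_one' := (HahnSeries.map_single (algebraMap ℂ (Aq s kp km) : ZeroHom ℂ (Aq s kp km))).trans
    (congrArg _ (map_one (algebraMap ℂ (Aq s kp km))))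
  map_zero' := HahnSeries.map_zero (algebraMap ℂ (Aq s kp km) : ZeroHom ℂ (Aq s kp km))
  map_mul' _ _ := HahnSeries.map_mul (algebraMap ℂ (Aq s kp km) : ℂ →ₙ+* Aq s kp km)
  map_add' _ _ := HahnSeries.map_add (algebraMap ℂ (Aq s kp km) : ℂ →+ Aq s kp km)

theorem laurent_mul_comm {R : Type*} [Semiring R] {f g : LaurentSeries R}
    (h : ∀ m n, f.coeff m * g.coeff n = g.coeff n * f.coeff m) : f * g = g * f := by
  ext n
  rw [HahnSeries.coeff_mul, HahnSeries.coeff_mul]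
  refine Finset.sum_bij' (fun p _ => p.swap) (fun p _ => p.swap) ?_ ?_ ?_ ?_ ?_
  · intro p hp; exact Finset.swap_mem_antidiagonal.mpr (by simpa using hp)
  · intro p hp; exact Finset.swap_mem_antidiagonal.mpr (by simpa using hp)
  · intros; rfl
  · intros; rfl
  · intro p _; exact h _ _

theorem toAq_commute (f : Sc) (g : AqL s kp km) : toAq s kp km f * g = g * toAq s kp km f :=
  laurent_mul_comm fun m n => by simp only [toAq, HahnSeries.map_coeff, Algebra.commutes]

/-- Scalar series are central, which allows the preceding results to be applied with `ℂ((u⁻¹))` as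
the base field. -/
instance : Algebra Sc (AqL s kp km) := (toAqHom s kp km).toAlgebra' toAq_commute

theorem algebraMap_eq (f : Sc) : algebraMap Sc (AqL s kp km) f = toAq s kp km f := rfl

theorem toAq_smul (f : Sc) (g : AqL s kp km) : f • g = toAq s kp km f * g := Algebra.smul_def f g

theorem toAq_cst (a : ℂ) : toAq s kp km (cst a) = HahnSeries.C (algebraMap ℂ (Aq s kp km) a) :=
  HahnSeries.map_single (algebraMap ℂ (Aq s kp km) : ZeroHom ℂ (Aq s kp km))

theorem ofPowerSeries_coeff_neg {R : Type*} [Semiring R] (f : PowerSeries R) {n : ℤ} (hn : n < 0) :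
    (HahnSeries.ofPowerSeries ℤ R f).coeff n = 0 := by
  rw [HahnSeries.ofPowerSeries_apply]
  refine HahnSeries.embDomain_of_notMem_range ?_
  rintro ⟨m, rfl⟩
  have : (0 : ℤ) ≤ m := by omega
  exact absurd hn (not_lt.mpr this)

theorem toAq_ofPowerSeries (y : PowerSeries ℂ) :
    toAq s kp km (HahnSeries.ofPowerSeries ℤ ℂ y)
      = HahnSeries.ofPowerSeries ℤ (Aq s kp km) (central (Aq s kp km) y) := by
  ext n
  rcases le_or_gt 0 n with hn | hn
  · lift n to ℕ using hn
    rw [HahnSeries.ofPowerSeries_apply_coeff]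
    simp [toAq, central]
  · rw [ofPowerSeries_coeff_neg _ hn]
    simp [toAq, ofPowerSeries_coeff_neg _ hn]

theorem liftS_eq {m n : Type*} (X : Matrix m n Sc) :
    liftS s kp km X = X.map (algebraMap Sc (AqL s kp km)) := rfl

theorem liftC_eq {m n : Type*} (X : Matrix m n ℂ) :
    liftC s kp km X = (X.map cst).map (algebraMap Sc (AqL s kp km)) := rfl

end Scalars

/-! ### Evaluation of the defining relators at spectral parameters -/

section Relations

open PowerSeries

variable (s kp km) in
/-- The projection of the free algebra onto `A_q`. -/
def proj : Free →+* Aq s kp km := (RingQuot.mkAlgHom ℂ (Rel s kp km)).toRingHom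

variable {y z : PowerSeries ℂ} (hy : constantCoeff y = 0) (hz : constantCoeff z = 0)

variable (s kp km) in
/-- The evaluation of double power series at two scalar series. -/
def evalHom : Ser →+* AqL s kp km :=
  (HahnSeries.ofPowerSeries ℤ (Aq s kp km)).comp
    ((evalAt (evalAt PowerSeries.C y hy) z hz).comp
      (PowerSeries.map (PowerSeries.map (proj s kp km))))

/-- All coefficients of a relator already vanish in `A_q`, hence so does its image under any
substitution. This turns the coefficientwise relations into relations between Laurent series. -/
theorem evalHom_relator {f : Ser} (hf : IsRelator s kp km f) : evalHom s kp km hy hz f = 0 := by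
  have : PowerSeries.map (PowerSeries.map (proj s kp km)) f = 0 := by
    ext j i
    simp only [coeff_map, map_zero]
    have := RingQuot.mkAlgHom_rel ℂ (Rel.coeff (s := s) (kp := kp) (km := km) f hf i j)
    rw [map_zero] at this
    exact this
  simp [evalHom, this]

theorem evalHom_Ui : evalHom s kp km hy hz Ui
    = algebraMap Sc _ (HahnSeries.ofPowerSeries ℤ ℂ y) := by
  rw [algebraMap_eq, toAq_ofPowerSeries]
  simp [evalHom, Ui, evalAt_C, evalAt_X]

theorem evalHom_Vi : evalHom s kp km hy hz Vi
    = algebraMap Sc _ (HahnSeries.ofPowerSeries ℤ ℂ z) := by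
  rw [algebraMap_eq, toAq_ofPowerSeries]
  simp [evalHom, Vi, evalAt_X]

theorem genAt_ofPowerSeries (w : ℕ → Aq s kp km) (y : PowerSeries ℂ) :
    genAt s kp km w (HahnSeries.ofPowerSeries ℤ ℂ y) = HahnSeries.ofPowerSeries ℤ (Aq s kp km)
      (PowerSeries.mk fun n => ∑ k ∈ Finset.range n, (coeff n (y ^ (k + 1))) • w k) := by
  simp only [genAt, ← map_pow, HahnSeries.ofPowerSeries_apply_coeff]

theorem evalHom_Wu (e : Bool) : evalHom s kp km hy hz (Wu e)
    = genAt s kp km (genW s kp km e) (HahnSeries.ofPowerSeries ℤ ℂ y) := by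
  rw [genAt_ofPowerSeries, ← evalAt_X_mul_mk y hy PowerSeries.C (genW s kp km e) _ fun _ => rfl]
  have h : PowerSeries.map (proj s kp km)
      (PowerSeries.mk fun k => FreeAlgebra.ι ℂ (Gen.W e k)) = PowerSeries.mk (genW s kp km e) := by
    ext1 j
    rw [coeff_map, coeff_mk, coeff_mk]
    rfl
  simp only [evalHom, Wu, RingHom.comp_apply, PowerSeries.map_C, evalAt_C, map_mul,
    PowerSeries.map_X, h]

theorem evalHom_Gu (e : Bool) : evalHom s kp km hy hz (Gu e)
    = genAt s kp km (genG s kp km e) (HahnSeries.ofPowerSeries ℤ ℂ y) := by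
  rw [genAt_ofPowerSeries, ← evalAt_X_mul_mk y hy PowerSeries.C (genG s kp km e) _ fun _ => rfl]
  have h : PowerSeries.map (proj s kp km)
      (PowerSeries.mk fun k => FreeAlgebra.ι ℂ (Gen.G e k)) = PowerSeries.mk (genG s kp km e) := by
    ext1 j
    rw [coeff_map, coeff_mk, coeff_mk]
    rfl
  simp only [evalHom, Gu, RingHom.comp_apply, PowerSeries.map_C, evalAt_C, map_mul,
    PowerSeries.map_X, h]

theorem evalHom_Wv (e : Bool) : evalHom s kp km hy hz (Wv e)
    = genAt s kp km (genW s kp km e) (HahnSeries.ofPowerSeries ℤ ℂ z) := by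
  rw [genAt_ofPowerSeries, ← evalAt_X_mul_mk z hz (evalAt PowerSeries.C y hy)
    (fun k => PowerSeries.C (genW s kp km e k)) _ fun _ => evalAt_C _ _ _ _]
  have h : PowerSeries.map (PowerSeries.map (proj s kp km))
      (PowerSeries.mk fun k => PowerSeries.C (FreeAlgebra.ι ℂ (Gen.W e k)))
        = PowerSeries.mk fun k => PowerSeries.C (genW s kp km e k) := by
    ext1 j
    rw [coeff_map, coeff_mk, coeff_mk, PowerSeries.map_C]
    rfl
  simp only [evalHom, Wv, RingHom.comp_apply, map_mul, PowerSeries.map_X, h]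

theorem evalHom_Gv (e : Bool) : evalHom s kp km hy hz (Gv e)
    = genAt s kp km (genG s kp km e) (HahnSeries.ofPowerSeries ℤ ℂ z) := by
  rw [genAt_ofPowerSeries, ← evalAt_X_mul_mk z hz (evalAt PowerSeries.C y hy)
    (fun k => PowerSeries.C (genG s kp km e k)) _ fun _ => evalAt_C _ _ _ _]
  have h : PowerSeries.map (PowerSeries.map (proj s kp km))
      (PowerSeries.mk fun k => PowerSeries.C (FreeAlgebra.ι ℂ (Gen.G e k)))
        = PowerSeries.mk fun k => PowerSeries.C (genG s kp km e k) := by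
    ext1 j
    rw [coeff_map, coeff_mk, coeff_mk, PowerSeries.map_C]
    rfl
  simp only [evalHom, Gv, RingHom.comp_apply, map_mul, PowerSeries.map_X, h]

theorem evalHom_smul (a : ℂ) (f : Ser) : evalHom s kp km hy hz (a • f)
    = cst a • evalHom s kp km hy hz f := by
  have : a • f = PowerSeries.C (PowerSeries.C (algebraMap ℂ Free a)) * f := by
    ext1 j; ext1 i
    rw [coeff_C_mul, coeff_C_mul, ← Algebra.smul_def]
    rfl
  rw [this, map_mul, toAq_smul, toAq_cst]
  congr 1
  simp only [evalHom, RingHom.comp_apply, PowerSeries.map_C, evalAt_C, HahnSeries.ofPowerSeries_C]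
  congr 1
  exact AlgHom.commutes _ a

end Relations

end

section

variable {s kp km : ℂ}

/-! ### Monomial spectral parameters -/

section Monomials

theorem Generic.qq_ne (h : Generic s) : qq s ≠ 0 := pow_ne_zero _ h.ne

theorem Generic.qq_sq_sub_ne (h : Generic s) : qq s ^ 2 - 1 ≠ 0 := by
  have := h.pow_ne 2 (by norm_num)
  intro h0
  apply this
  rw [qq] at h0
  linear_combination h0

theorem Generic.qq_sq_add_ne (h : Generic s) : qq s ^ 2 + 1 ≠ 0 := by
  have := h.pow_ne 4 (by norm_num)
  intro h0
  apply this
  rw [qq] at h0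
  linear_combination (s ^ 4 - 1) * h0

theorem Generic.qq_add_inv_ne (h : Generic s) : qq s + (qq s)⁻¹ ≠ 0 := by
  have := h.qq_ne
  intro h0; apply h.qq_sq_add_ne; field_simp at h0; linear_combination h0

theorem Generic.qq_sub_inv_ne (h : Generic s) : qq s - (qq s)⁻¹ ≠ 0 := by
  have := h.qq_ne
  intro h0; apply h.qq_sq_sub_ne; field_simp at h0; linear_combination h0

/-- Spectral parameters `a u ^ m` with `a ≠ 0` and `m ≠ 0`. -/
def IsMonomial (x : Sc) : Prop := ∃ m : ℤ, m ≠ 0 ∧ ∃ a : ℂ, a ≠ 0 ∧ x = HahnSeries.single m a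

theorem IsMonomial.ne_zero {x : Sc} (hx : IsMonomial x) : x ≠ 0 := by
  obtain ⟨m, hm, a, ha, rfl⟩ := hx
  exact HahnSeries.single_ne_zero ha

theorem IsMonomial.inv {x : Sc} (hx : IsMonomial x) : IsMonomial x⁻¹ := by
  obtain ⟨m, hm, a, ha, rfl⟩ := hx
  exact ⟨-m, by omega, a⁻¹, inv_ne_zero ha, HahnSeries.inv_single _ _⟩

theorem IsMonomial.cst_mul {x : Sc} (hx : IsMonomial x) {b : ℂ} (hb : b ≠ 0) :
    IsMonomial (cst b * x) := by
  obtain ⟨m, hm, a, ha, rfl⟩ := hx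
  refine ⟨m, hm, b * a, mul_ne_zero hb ha, ?_⟩
  rw [cst, HahnSeries.C_apply, HahnSeries.single_mul_single, zero_add]

theorem IsMonomial.mul_cst {x : Sc} (hx : IsMonomial x) {b : ℂ} (hb : b ≠ 0) :
    IsMonomial (x * cst b) := by
  rw [mul_comm]; exact hx.cst_mul hb

theorem IsMonomial.pow {x : Sc} (hx : IsMonomial x) {n : ℕ} (hn : n ≠ 0) : IsMonomial (x ^ n) := by
  obtain ⟨m, hm, a, ha, rfl⟩ := hx
  refine ⟨n • m, ?_, a ^ n, pow_ne_zero _ ha, HahnSeries.single_pow _ _ _⟩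
  simp [hn, hm]

theorem IsMonomial.ne_cst {x : Sc} (hx : IsMonomial x) (b : ℂ) : x ≠ cst b := by
  obtain ⟨m, hm, a, ha, rfl⟩ := hx
  intro h
  have := congrArg (fun f : Sc => f.coeff m) h
  simp [cst, HahnSeries.coeff_single_of_ne hm] at this
  exact ha this

theorem isMonomial_u : IsMonomial u := ⟨-1, by norm_num, 1, one_ne_zero, rfl⟩

theorem IsMonomial.c_ne_zero {x : Sc} (hx : IsMonomial x) : c x ≠ 0 := by
  intro h
  have h0 := hx.ne_zero
  apply (hx.pow two_ne_zero).ne_cst 1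
  rw [c] at h
  field_simp at h
  rw [cst_one]; linear_combination h

theorem U_eq_ufun (s : ℂ) (x : Sc) : U s x = ufun (cst (qq s)) x := by
  rw [U, ufun, cst_inv, cst_add, cst_inv]

/-- The substitution exchanges the two terms of `U`. This symmetry reduces positive powers of `u` to
negative ones, and it explains the shift by `q⁻¹` in the argument of the quantum determinant. -/
theorem ufun_inv {k : Type*} [Field k] {q x : k} (hq : q ≠ 0) :
    ufun q (x⁻¹ * q⁻¹) = ufun q x := by
  rw [ufun, ufun]
  congr 1
  by_cases hx : x = 0
  · simp [hx]
  · field_simp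
    ring

/-- `U(x)` is nonzero and its inverse is a power series without constant term. -/
def UInvSmall (s : ℂ) (x : Sc) : Prop :=
  U s x ≠ 0 ∧ ∃ y : PowerSeries ℂ, PowerSeries.constantCoeff y = 0 ∧
    HahnSeries.ofPowerSeries ℤ ℂ y = (U s x)⁻¹

/-- The reason is `U(x)⁻¹ = x² (q + q⁻¹) / (q⁻¹ + q x⁴)`. For `x = a u^{-m}` the denominator is a
power series in `u⁻¹` with nonzero constant term, and `x²` supplies the factor of degree `2 m`. -/
theorem Generic.exists_U_inv (h : Generic s) {m : ℕ} (hm : m ≠ 0) {a : ℂ} (ha : a ≠ 0) :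
    U s (HahnSeries.single (m : ℤ) a) ≠ 0 ∧ ∃ y : PowerSeries ℂ, PowerSeries.X ^ (2 * m) ∣ y ∧
      HahnSeries.ofPowerSeries ℤ ℂ y = (U s (HahnSeries.single (m : ℤ) a))⁻¹ := by
  set x : Sc := HahnSeries.single (m : ℤ) a with hx
  have hx0 : x ≠ 0 := HahnSeries.single_ne_zero ha
  set p : PowerSeries ℂ := PowerSeries.C (qq s)⁻¹
    + PowerSeries.C (qq s) * (PowerSeries.C a * PowerSeries.X ^ m) ^ 4 with hp
  have hxe : HahnSeries.ofPowerSeries ℤ ℂ (PowerSeries.C a * PowerSeries.X ^ m) = x := by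
    rw [map_mul, HahnSeries.ofPowerSeries_C, HahnSeries.ofPowerSeries_X_pow, HahnSeries.C_apply,
      HahnSeries.single_mul_single, zero_add, mul_one]
  have hpe : HahnSeries.ofPowerSeries ℤ ℂ p = cst (qq s)⁻¹ + cst (qq s) * x ^ 4 := by
    rw [hp, map_add, map_mul, map_pow, hxe, HahnSeries.ofPowerSeries_C, HahnSeries.ofPowerSeries_C]
    rfl
  have hp0 : PowerSeries.constantCoeff p ≠ 0 := by
    simp [hp, hm, h.qq_ne]
  have hpi := PowerSeries.mul_inv_cancel p hp0
  have hpi' := congrArg (HahnSeries.ofPowerSeries ℤ ℂ) hpi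
  rw [map_mul, map_one] at hpi'
  have hpne : HahnSeries.ofPowerSeries ℤ ℂ p ≠ 0 := left_ne_zero_of_mul (hpi'.trans_ne one_ne_zero)
  have hUe : U s x = HahnSeries.ofPowerSeries ℤ ℂ p / (x ^ 2 * cst (qq s + (qq s)⁻¹)) := by
    rw [hpe, U]
    have := cst_ne_zero h.qq_add_inv_ne
    field_simp
    ring
  have hne := cst_ne_zero h.qq_add_inv_ne
  refine ⟨?_, (PowerSeries.C a * PowerSeries.X ^ m) ^ 2 * PowerSeries.C (qq s + (qq s)⁻¹) * p⁻¹,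
    ⟨PowerSeries.C a ^ 2 * PowerSeries.C (qq s + (qq s)⁻¹) * p⁻¹,
      by ring⟩, ?_⟩
  · rw [hUe]
    exact div_ne_zero hpne (mul_ne_zero (pow_ne_zero _ hx0) hne)
  · rw [map_mul, map_mul, map_pow, hxe, HahnSeries.ofPowerSeries_C, hUe, inv_div, div_eq_mul_inv,
      eq_inv_of_mul_eq_one_right hpi']
    rfl

theorem Generic.U_single_neg (h : Generic s) (m : ℤ) (a : ℂ) :
    U s (HahnSeries.single (-m) a) = U s (HahnSeries.single m (a⁻¹ * (qq s)⁻¹)) := by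
  rw [U_eq_ufun, U_eq_ufun, ← ufun_inv (cst_ne_zero h.qq_ne)]
  congr 1
  rw [← cst_inv, cst, HahnSeries.C_apply, HahnSeries.inv_single, HahnSeries.single_mul_single,
    add_zero, neg_neg]

theorem Generic.exists_U_inv_natAbs (h : Generic s) {m : ℤ} (hm : m ≠ 0) {a : ℂ} (ha : a ≠ 0) :
    U s (HahnSeries.single m a) ≠ 0 ∧ ∃ y : PowerSeries ℂ, PowerSeries.X ^ (2 * m.natAbs) ∣ y ∧
      HahnSeries.ofPowerSeries ℤ ℂ y = (U s (HahnSeries.single m a))⁻¹ := by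
  rcases m.natAbs_eq with e | e
  · have := h.exists_U_inv (by omega : m.natAbs ≠ 0) ha
    rwa [← e] at this
  · have := h.exists_U_inv (by omega : m.natAbs ≠ 0)
      (mul_ne_zero (inv_ne_zero ha) (inv_ne_zero h.qq_ne))
    rw [← h.U_single_neg, ← e] at this
    exact this

theorem Generic.uInvSmall (h : Generic s) {x : Sc} (hx : IsMonomial x) : UInvSmall s x := by
  obtain ⟨m, hm, a, ha, rfl⟩ := hx
  obtain ⟨hU, y, hy, hyU⟩ := h.exists_U_inv_natAbs hm ha
  exact ⟨hU, y, PowerSeries.X_dvd_iff.mp ((dvd_pow_self _ (by omega)).trans hy), hyU⟩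

end Monomials

/-! ### The relations for the fundamental K-operator -/

section KOperator

variable (s kp km) in
/-- The upper right entry of the fundamental K-operator. -/
def Kb (x : Sc) : AqL s kp km :=
  (1 / (cst km * (cst (qq s) + (cst (qq s))⁻¹))) • Gx s kp km true x
    + (cst kp * (cst (qq s) + (cst (qq s))⁻¹) / (cst (qq s) - (cst (qq s))⁻¹)) • 1

variable (s kp km) in
/-- The lower left entry of the fundamental K-operator. -/
def Kc (x : Sc) : AqL s kp km :=
  (1 / (cst kp * (cst (qq s) + (cst (qq s))⁻¹))) • Gx s kp km false x
    + (cst km * (cst (qq s) + (cst (qq s))⁻¹) / (cst (qq s) - (cst (qq s))⁻¹)) • 1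

theorem Khalf_eq (x : Sc) : Khalf s kp km x
    = kmat (cst (qq s)) x (Wx s kp km true x) (Wx s kp km false x) (Kb s kp km x) (Kc s kp km x) := by
  refine Matrix.ext fun i j => ?_
  fin_cases i <;> fin_cases j <;>
    simp [Khalf, kmat, Kb, Kc, toAq_smul, cst_mul, cst_add, cst_sub, cst_inv, cst_div]

/-- The two parameters are independent monomials in the same variable, possibly of different
degrees; centrality of the determinant makes use of this freedom. -/
theorem Generic.relAt (h : Generic s) (hkp : kp ≠ 0) (hkm : km ≠ 0) {x y : Sc}
    (hx : IsMonomial x) (hy : IsMonomial y) :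
    RelAt (cst (qq s)) (ufun (cst (qq s)) x) (ufun (cst (qq s)) y)
      (Wx s kp km true x) (Wx s kp km false x) (Kb s kp km x) (Kc s kp km x)
      (Wx s kp km true y) (Wx s kp km false y) (Kb s kp km y) (Kc s kp km y) := by
  obtain ⟨hU, Y, hY, hYU⟩ := h.uInvSmall hx
  obtain ⟨hV, Z, hZ, hZV⟩ := h.uInvSmall hy
  have hq1 : cst (qq s) ^ 2 + 1 ≠ 0 := by
    rw [← cst_one, ← cst_pow, ← cst_add]; exact cst_ne_zero h.qq_sq_add_ne
  have hq2 : cst (qq s) ^ 2 - 1 ≠ 0 := by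
    rw [← cst_one, ← cst_pow, ← cst_sub]; exact cst_ne_zero h.qq_sq_sub_ne
  have R := fun f hf => evalHom_relator (s := s) (kp := kp) (km := km) hY hZ (f := f) hf
  have r1 := fun e => R _ (.r1 e)
  have r2 := R _ .r2
  have r3 := fun d e => R _ (.r3 d e)
  have r4 := fun e => R _ (.r4 e)
  have r5 := R _ .r5
  have r6 := R _ (.r6 true)
  have r7 := R _ (.r7 true)
  have r8 := fun e => R _ (.r8 e)
  have r9 := fun e => R _ (.r9 e)
  simp only [comm, qcomm, map_add, map_sub, map_mul, map_one, evalHom_smul, evalHom_Ui, evalHom_Vi,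
    evalHom_Wu, evalHom_Wv, evalHom_Gu, evalHom_Gv, hYU, hZV, Bool.not_true,
    rho, cst_mul, cst_add, cst_sub, cst_inv, cst_div,
    cst_one, cst_pow] at r1 r2 r3 r4 r5 r6 r7 r8 r9
  rw [← U_eq_ufun, ← U_eq_ufun, ← inv_inv (U s x), ← inv_inv (U s y)]
  refine RelAt.of_relations (q := cst (qq s)) (kp := cst kp) (km := cst km)
    (w := fun e => Wx s kp km e x) (g := fun e => Gx s kp km e x)
    (w' := fun e => Wx s kp km e y) (g' := fun e => Gx s kp km e y)
    (cst_ne_zero h.qq_ne) hq1 hq2 (cst_ne_zero hkp) (cst_ne_zero hkm) (inv_ne_zero hU)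
    (inv_ne_zero hV) r1 r2 r3 r4 r5 ?_ ?_ ?_ ?_
  · convert r6 using 1
    simp only [Wx, Gx, Algebra.smul_def, map_mul, map_sub, mul_assoc]
  · convert r7 using 1
    simp only [Wx, Gx, Algebra.smul_def, map_mul, map_sub, map_one, mul_assoc]
  · intro e
    convert r8 e using 1
    simp only [Wx, Gx, Algebra.smul_def, map_mul, map_sub, mul_assoc]
  · intro e
    convert r9 e using 1
    simp only [Wx, Gx, Algebra.smul_def, map_mul, map_sub, mul_assoc]

end KOperator

end

section

theorem Gauge.lax_mul_fuse {k : Type*} [Field k] (g : Gauge k) {s : k} (hs : s ≠ 0) (n : ℕ) :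
    g.lax s n (s ^ (n + 1))⁻¹ * g.fuse s n = 0 := by
  have : g.lax s n (s ^ (n + 1))⁻¹ * g.fuse s n = g.lam n • (site2 (Fin 2) (g.D n)
      * (FusedK.lax s n (s ^ (n + 1))⁻¹ * (site2 (Fin 2) (g.D' n) * site2 (Fin 2) (g.D n)
        * FusedK.fuse s n)) * g.D' (n + 1)) := by
    simp only [Gauge.lax, Gauge.fuse, Matrix.mul_smul, Matrix.mul_assoc]
  rw [this, g.site2_inv_mul, Matrix.one_mul, lax_mul_fuse_eq_zero hs]
  simp

/-! ### Operators that preserve the image of the fusion map -/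

section Restriction

variable {k A : Type*} [Field k] [Ring A] [Algebra k A]
variable {g : Gauge k} {s : k} {n : ℕ} {F : Matrix (Fin (n + 2)) (Fin 2 × Fin (n + 1)) k}

/-- An operator that intertwines with the singular Lax operator preserves the image of the
fusion map. -/
theorem Gauge.mul_fuse_of_lax_mul (hs : s ≠ 0) (h2 : (2 : k) ≠ 0)
    (hr : ∀ m : ℕ, 1 ≤ m → s ^ (2 * m) ≠ 1) (hF : F * g.fuse s n = 1)
    {X X' : Matrix (Fin 2 × Fin (n + 1)) (Fin 2 × Fin (n + 1)) A}
    (hX : (g.lax s n (s ^ (n + 1))⁻¹).map (algebraMap k A) * X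
      = X' * (g.lax s n (s ^ (n + 1))⁻¹).map (algebraMap k A)) :
    X * (g.fuse s n).map (algebraMap k A) = (g.fuse s n).map (algebraMap k A)
      * (F.map (algebraMap k A) * X * (g.fuse s n).map (algebraMap k A)) := by
  obtain ⟨M, hM⟩ := g.exists_sub_eq_mul hs h2 hr n hF
  have hM' := congrArg (fun Z => Z.map (algebraMap k A)) hM
  have hL := congrArg (fun Z => Z.map (algebraMap k A)) (g.lax_mul_fuse hs n)
  simp only [Matrix.map_sub _ (map_sub _), Matrix.map_mul,
    Matrix.map_one _ (map_zero (algebraMap k A)) (map_one _),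
    Matrix.map_zero _ (map_zero (algebraMap k A))] at hM' hL
  -- With `L` the singular operator and `1 - E F = M L`, this is `(1 - E F) X E = M L X E = M X' L E
  -- = 0`.
  have : (1 - (g.fuse s n).map (algebraMap k A) * F.map (algebraMap k A)) * X
      * (g.fuse s n).map (algebraMap k A) = 0 := by
    rw [hM', Matrix.mul_assoc (M.map _), hX, Matrix.mul_assoc, Matrix.mul_assoc, hL]
    simp
  rw [Matrix.sub_mul, Matrix.sub_mul, Matrix.one_mul, sub_eq_zero] at this
  rw [this]
  simp only [Matrix.mul_assoc]

/-- An operator that intertwines with the Lax operator whose image is the image of the fusion map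
preserves this image. -/
theorem Gauge.mul_fuse_of_mul_lax (hs : s ≠ 0) (h2 : (2 : k) ≠ 0)
    (hr : ∀ m : ℕ, 1 ≤ m → s ^ (2 * m) ≠ 1) (hF : F * g.fuse s n = 1)
    {X X' : Matrix (Fin 2 × Fin (n + 1)) (Fin 2 × Fin (n + 1)) A}
    (hX : X * (g.lax s n (s ^ (n + 1))).map (algebraMap k A)
      = (g.lax s n (s ^ (n + 1))).map (algebraMap k A) * X') :
    X * (g.fuse s n).map (algebraMap k A) = (g.fuse s n).map (algebraMap k A)
      * (F.map (algebraMap k A) * X * (g.fuse s n).map (algebraMap k A)) := by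
  obtain ⟨M, hM⟩ := g.exists_sub_eq_mul hs h2 hr n hF
  obtain ⟨N, hN⟩ := g.exists_eq_mul hs h2 hr n
  have hM' := congrArg (fun Z => Z.map (algebraMap k A)) hM
  have hN' := congrArg (fun Z => Z.map (algebraMap k A)) hN
  have hu : g.lax s n (s ^ (n + 1))⁻¹ * g.lax s n (s ^ (n + 1)) = 0 := by
    have h := g.lax_mul_lax_inv hs (inv_ne_zero (pow_ne_zero (n + 1) hs)) n
    rw [inv_inv, inv_mul_cancel₀ (pow_ne_zero _ hs)] at h
    rw [h]; simp
  have hL := congrArg (fun Z => Z.map (algebraMap k A)) hu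
  simp only [Matrix.map_sub _ (map_sub _), Matrix.map_mul,
    Matrix.map_one _ (map_zero (algebraMap k A)) (map_one _),
    Matrix.map_zero _ (map_zero (algebraMap k A))] at hM' hL hN'
  -- With `E = L₊ N` and `1 - E F = M L₋`, this is `(1 - E F) X L₊ N = M L₋ L₊ X' N = 0`. The
  -- rewriting with `hN'` also hits the `E` inside the projector, which `← hN'` restores.
  have : (1 - (g.fuse s n).map (algebraMap k A) * F.map (algebraMap k A)) * X
      * (g.fuse s n).map (algebraMap k A) = 0 := by
    rw [Matrix.mul_assoc, hN', ← Matrix.mul_assoc X, hX, ← hN', hM', Matrix.mul_assoc (M.map _),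
      Matrix.mul_assoc _ X', ← Matrix.mul_assoc _ _ (X' * _), hL]
    simp
  rw [Matrix.sub_mul, Matrix.sub_mul, Matrix.one_mul, sub_eq_zero] at this
  rw [this]
  simp only [Matrix.mul_assoc]

end Restriction

section ReflectsScaled

variable {k A a b : Type*} [Field k] [Ring A] [Algebra k A] [Fintype a] [Fintype b]
  [DecidableEq a] [DecidableEq b]

theorem Reflects.mul_chain {L L' R : Matrix (a × b) (a × b) k} {K : Matrix a a A}
    {K' : Matrix b b A} (h : Reflects L L' K K') {c : k} (hR : R = c • L') :
    L.map (algebraMap k A) * (site1 b K * R.map (algebraMap k A) * site2 a K')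
        = site2 a K' * R.map (algebraMap k A) * site1 b K * L.map (algebraMap k A) := by
  rw [Reflects] at h
  rw [hR, map_smul_algebraMap]
  simp only [Matrix.mul_smul, Matrix.smul_mul, ← Matrix.mul_assoc, h]

set_option linter.unusedSectionVars false in
theorem mul_site2_smul {d : Type*} [Fintype d] [DecidableEq d] {P Q : Matrix (a × b × d) (a × b × d) k}
    {S S' : Matrix (b × d) (b × d) k} {c : k} (hS : S = c • S')
    (h : P * Q * site2 a S' = site2 a S' * Q * P) :
    P * Q * site2 a S = site2 a S * Q * P := by
  rw [hS, site2_smul, Matrix.mul_smul, h, Matrix.smul_mul, Matrix.smul_mul]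

end ReflectsScaled

variable {s kp km : ℂ}

theorem cst_qq (s : ℂ) : cst (qq s) = cst s ^ 2 := cst_pow s 2

theorem sc_two_ne_zero : (2 : Sc) ≠ 0 := by
  have : (2 : Sc) = cst 2 := by
    rw [cst_eq, map_ofNat]
  rw [this]; exact cst_ne_zero two_ne_zero

theorem Generic.cst_pow_ne (h : Generic s) (m : ℕ) (hm : 1 ≤ m) : cst s ^ (2 * m) ≠ 1 := by
  rw [← cst_pow, ← cst_one]; exact cst_injective.ne (h.pow_ne m hm)

theorem Generic.cst_ne (h : Generic s) : cst s ≠ 0 := cst_ne_zero h.ne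

/-! ### Reflection equations for the fused K-operators -/

section Fused

theorem IsMonomial.mul_cst_pow {x : Sc} (hx : IsMonomial x) (h : Generic s) (m : ℕ) :
    IsMonomial (x * cst s ^ m) := by
  rw [← cst_pow]; exact hx.mul_cst (pow_ne_zero _ h.ne)

theorem IsMonomial.div_cst_pow {x : Sc} (hx : IsMonomial x) (h : Generic s) (m : ℕ) :
    IsMonomial (x / cst s ^ m) := by
  rw [div_eq_mul_inv, ← cst_pow, ← cst_inv]; exact hx.mul_cst (inv_ne_zero (pow_ne_zero _ h.ne))

/-- The product of K-operators that is restricted to the image of the fusion map. -/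
def preK (s kp km : ℂ) (n : ℕ) (x : Sc) :
    Matrix (Fin 2 × Fin (n + 1)) (Fin 2 × Fin (n + 1)) (AqL s kp km) :=
  site1 (Fin (n + 1)) (Khalf s kp km (x / cst s ^ n))
    * (Rhalf s n (x ^ 2 * cst s / cst s ^ n)).map (algebraMap Sc (AqL s kp km))
    * site2 (Fin 2) (Kop s kp km n (x * cst s))

/-- The product of K-operators in the opposite order. -/
def preKhat (s kp km : ℂ) (n : ℕ) (x : Sc) :
    Matrix (Fin 2 × Fin (n + 1)) (Fin 2 × Fin (n + 1)) (AqL s kp km) :=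
  site2 (Fin 2) (Khat s kp km n (x / cst s))
    * (Rhalf s n (x ^ 2 * cst s ^ n / cst s)).map (algebraMap Sc (AqL s kp km))
    * site1 (Fin (n + 1)) (Khalf s kp km (x * cst s ^ n))

theorem Kop_succ (h : Generic s) {n : ℕ} (hn : 1 ≤ n) (x : Sc) :
    Kop s kp km (n + 1) x = ((calF s n).map cst).map (algebraMap Sc (AqL s kp km))
      * preK s kp km n x * (h.gauge.fuse (cst s) n).map (algebraMap Sc (AqL s kp km)) := by
  obtain ⟨m, rfl⟩ := Nat.exists_eq_add_of_le' hn
  have hs := h.cst_ne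
  rw [Kop, preK, ← h.calE_map, liftC_eq, liftC_eq, liftS_eq, leg1_eq, leg2_eq]
  have e1 : x * cst (s ^ (-((m : ℤ) + 1))) = x / cst s ^ (m + 1) := by
    rw [cst_zpow, zpow_neg, div_eq_mul_inv]; norm_cast
  have e2 : x ^ 2 * cst (s ^ (-((m : ℤ) + 1) + 1)) = x ^ 2 * cst s / cst s ^ (m + 1) := by
    rw [show -((m : ℤ) + 1) + 1 = -m by ring, cst_zpow, zpow_neg, zpow_natCast]; field_simp; ring
  rw [e1, e2]
  simp only [Matrix.mul_assoc]

theorem Khat_succ (h : Generic s) {n : ℕ} (hn : 1 ≤ n) (x : Sc) :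
    Khat s kp km (n + 1) x = ((calF s n).map cst).map (algebraMap Sc (AqL s kp km))
      * preKhat s kp km n x * (h.gauge.fuse (cst s) n).map (algebraMap Sc (AqL s kp km)) := by
  obtain ⟨m, rfl⟩ := Nat.exists_eq_add_of_le' hn
  have hs := h.cst_ne
  rw [Khat, preKhat, ← h.calE_map, liftC_eq, liftC_eq, liftS_eq, leg1_eq, leg2_eq]
  have e1 : x * cst (s ^ ((m : ℤ) + 1)) = x * cst s ^ (m + 1) := by
    rw [cst_zpow]; norm_cast
  have e2 : x ^ 2 * cst (s ^ ((m : ℤ) + 1 - 1)) = x ^ 2 * cst s ^ (m + 1) / cst s := by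
    rw [show ((m : ℤ) + 1) - 1 = m by ring, cst_zpow, zpow_natCast]; field_simp; ring
  rw [e1, e2, cst_inv, ← div_eq_mul_inv]
  simp only [Matrix.mul_assoc]

theorem Generic.calF_fuse (h : Generic s) (n : ℕ) :
    (calF s n).map cst * h.gauge.fuse (cst s) n = 1 := by
  rw [← h.calE_map]
  have := congrArg (fun M => M.map (HahnSeries.C : ℂ →+* Sc)) (h.calF_mul_calE n)
  simp only [Matrix.map_mul, Matrix.map_one _ (map_zero (HahnSeries.C : ℂ →+* Sc)) (map_one _)] at this
  exact this

theorem Generic.lax_one (h : Generic s) (x : Sc) :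
    h.gauge.lax (cst s) 1 x = sixVertex (cst s ^ 2) x := by
  rw [← cst_qq, ← h.Rhalf_one, Rhalf_eq h]
  simp

theorem Generic.reflects_half (h : Generic s) (hkp : kp ≠ 0) (hkm : km ≠ 0) {x y : Sc}
    (hx : IsMonomial x) (hy : IsMonomial y) :
    Reflects (sixVertex (cst s ^ 2) (x / y)) (sixVertex (cst s ^ 2) (x * y)) (Khalf s kp km x)
      (Khalf s kp km y) := by
  have hq1 : cst (qq s) ^ 2 + 1 ≠ 0 := by
    rw [← cst_one, ← cst_pow, ← cst_add]; exact cst_ne_zero h.qq_sq_add_ne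
  have hq2 : cst (qq s) ^ 2 - 1 ≠ 0 := by
    rw [← cst_one, ← cst_pow, ← cst_sub]; exact cst_ne_zero h.qq_sq_sub_ne
  have := RelAt.reflection (cst_ne_zero h.qq_ne) hq1 hq2 hx.ne_zero hy.ne_zero
    (h.relAt hkp hkm hx hy)
  rw [Reflects, Khalf_eq, Khalf_eq, ← cst_qq]
  simpa only [leg1_eq, leg2_eq] using this

/-- The parameters `x s^{-n}` and `x s` of the two K-operators have ratio `s^{-(n+1)}`, where the
Lax operator annihilates the image of the fusion map. The reflection equation says that this
operator intertwines `preK` with the product in reverse order. -/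
theorem Generic.preK_mul_fuse (h : Generic s) {n : ℕ} {x : Sc}
    (hr : Reflects (h.gauge.lax (cst s) n (cst s ^ (n + 1))⁻¹)
      (h.gauge.lax (cst s) n (x ^ 2 * cst s / cst s ^ n))
      (Khalf s kp km (x / cst s ^ n)) (Kop s kp km n (x * cst s))) :
    preK s kp km n x * (h.gauge.fuse (cst s) n).map (algebraMap Sc (AqL s kp km))
      = (h.gauge.fuse (cst s) n).map (algebraMap Sc (AqL s kp km))
        * (((calF s n).map cst).map (algebraMap Sc (AqL s kp km)) * preK s kp km n x
          * (h.gauge.fuse (cst s) n).map (algebraMap Sc (AqL s kp km))) := by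
  have key := hr.mul_chain (Rhalf_eq h n _)
  have := Gauge.mul_fuse_of_lax_mul (g := h.gauge) (F := (calF s n).map cst) h.cst_ne sc_two_ne_zero
    h.cst_pow_ne (h.calF_fuse n) (X := preK s kp km n x) key
  exact this

/-- Here the ratio is `s^{n+1}`, the other degeneration point, and the reflection equation is read
from right to left: `preKhat` now stands to the left of a Lax operator whose image is that of the
fusion map. -/
theorem Generic.preKhat_mul_fuse (h : Generic s) {n : ℕ} {x : Sc}
    (hr : Reflects (h.gauge.lax (cst s) n (cst s ^ (n + 1)))
      (h.gauge.lax (cst s) n (x ^ 2 * cst s ^ n / cst s))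
      (Khalf s kp km (x * cst s ^ n)) (Khat s kp km n (x / cst s))) :
    preKhat s kp km n x * (h.gauge.fuse (cst s) n).map (algebraMap Sc (AqL s kp km))
      = (h.gauge.fuse (cst s) n).map (algebraMap Sc (AqL s kp km))
        * (((calF s n).map cst).map (algebraMap Sc (AqL s kp km)) * preKhat s kp km n x
          * (h.gauge.fuse (cst s) n).map (algebraMap Sc (AqL s kp km))) := by
  have key := hr.mul_chain (Rhalf_eq h n _)
  have := Gauge.mul_fuse_of_mul_lax (g := h.gauge) (F := (calF s n).map cst) h.cst_ne sc_two_ne_zero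
    h.cst_pow_ne (h.calF_fuse n) (X := preKhat s kp km n x) key.symm
  exact this

theorem Generic.cst_zpow_sub_inv_ne (h : Generic s) {m : ℤ} (hm : m ≠ 0) :
    cst s ^ m - (cst s ^ m)⁻¹ ≠ 0 := by
  rw [← cst_zpow, ← cst_inv, ← cst_sub]
  refine cst_ne_zero fun h0 => h.zpow_ne hm ?_
  have : s ^ m ≠ 0 := zpow_ne_zero _ h.ne
  rw [mul_comm, zpow_mul]
  field_simp at h0
  have e : (s ^ m) ^ (2 : ℤ) = (s ^ m) ^ 2 := by norm_cast
  rw [e]; linear_combination h0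

/-- The fused reflection equation. -/
theorem Generic.reflects_Kop (h : Generic s) (hkp : kp ≠ 0) (hkm : km ≠ 0) (n : ℕ) :
    ∀ (a b : Sc) (j : ℕ), IsMonomial a → n + 2 ≤ j → b = a * cst s ^ j →
      Reflects (h.gauge.lax (cst s) (n + 1) (a / b)) (h.gauge.lax (cst s) (n + 1) (a * b))
        (Khalf s kp km a) (Kop s kp km (n + 1) b) := by
  -- The ratio `a / b = s^{-j}` is kept constant because the invariance of the image needs the
  -- degenerate ratio with `j = n + 2`. The bound `n + 2 ≤ j` includes this value, is preserved by
  -- the shifts in the induction, and keeps the fusion scalar away from its zero.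
  induction n with
  | zero =>
    rintro a _ j ha _ rfl
    rw [h.lax_one, h.lax_one]
    exact h.reflects_half hkp hkm ha (ha.mul_cst_pow h j)
  | succ n ih =>
    intro a b j ha hj hb
    have hs := h.cst_ne
    have hbm : IsMonomial b := by rw [hb]; exact ha.mul_cst_pow h j
    have ha0 := ha.ne_zero
    have hb0 := hbm.ne_zero
    have hab : IsMonomial (a * b) := by
      rw [hb, ← mul_assoc, ← sq]; exact (ha.pow two_ne_zero).mul_cst_pow h j
    have hbb : IsMonomial (b ^ 2 * cst s / cst s ^ (n + 1)) := by
      exact ((hbm.pow two_ne_zero).mul_cst h.ne).div_cst_pow h _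
    have hsq : ∀ z : Sc, IsMonomial z → z ^ 2 ≠ 1 := fun z hz => by
      rw [← cst_one]; exact (hz.pow two_ne_zero).ne_cst 1
    have A1 : a / (b / cst s ^ (n + 1)) = a / b * cst s ^ (n + 1) := by field_simp
    have A2 : a * (b / cst s ^ (n + 1)) = a * b / cst s ^ (n + 1) := by ring
    have B1 : a / (b * cst s) = a / b / cst s := by field_simp
    have B2 : a * (b * cst s) = a * b * cst s := by ring
    have h1 := h.reflects_half hkp hkm ha (hbm.div_cst_pow h (n + 1))
    have h2 := ih a (b * cst s) (j + 1) ha (by omega) (by rw [hb, pow_succ, mul_assoc])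
    rw [A1, A2] at h1
    rw [B1, B2] at h2
    have hσ : cst s ^ (n + 1) ≠ 0 := pow_ne_zero _ hs
    have hdiv : a / b ≠ 0 := div_ne_zero ha0 hb0
    have e1 : a * b * cst s / (a / b * cst s ^ (n + 1)) = b ^ 2 * cst s / cst s ^ (n + 1) := by
      field_simp
    have e2 : a * b / cst s ^ (n + 1) / (a / b / cst s) = b ^ 2 * cst s / cst s ^ (n + 1) := by
      field_simp
    have e3 : a / b / cst s / (a * b / cst s ^ (n + 1)) = (b ^ 2 * cst s / cst s ^ (n + 1))⁻¹ := by
      rw [← e2, inv_div]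
    have y1 := h.gauge.yangBaxter hs (x := a / b * cst s ^ (n + 1)) (y := a * b * cst s)
      (mul_ne_zero hdiv hσ) (mul_ne_zero hab.ne_zero hs) (n + 1)
    have y2 := h.gauge.yangBaxter_inv hs (x := a * b / cst s ^ (n + 1)) (y := a / b / cst s)
      (div_ne_zero hab.ne_zero hσ) (div_ne_zero hdiv hs) (n + 1)
      -- The ratios in this Yang–Baxter equation are nonconstant monomials, so the third Lax
      -- operator is invertible although `a / b` is a constant.
      (by rw [e3]; exact hsq _ (hbb.inv.mul_cst_pow h _))
      (by rw [e2]; exact hsq _ (hbb.mul_cst_pow h _))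
    rw [e1] at y1
    rw [e2] at y2
    have f := (h1.fuse h2 (S := Rhalf s (n + 1) (b ^ 2 * cst s / cst s ^ (n + 1)))
      (mul_site2_smul (Rhalf_eq h _ _) y1)
      (mul_site2_smul (Rhalf_eq h _ _) y2)).1
    -- The induction hypothesis at the smallest admissible exponent gives the invariance of the
    -- image under the product to be restricted.
    have hinv : Reflects (h.gauge.lax (cst s) (n + 1) (cst s ^ (n + 1 + 1))⁻¹)
        (h.gauge.lax (cst s) (n + 1) (b ^ 2 * cst s / cst s ^ (n + 1)))
        (Khalf s kp km (b / cst s ^ (n + 1))) (Kop s kp km (n + 1) (b * cst s)) := by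
      convert ih (b / cst s ^ (n + 1)) (b * cst s) (n + 2) (hbm.div_cst_pow h _) le_rfl
        (by field_simp; ring) using 2
      · field_simp; ring
      · ring
    have hX := h.preK_mul_fuse hinv
    rw [← Kop_succ h (by omega)] at hX
    refine Reflects.restrict (h.calF_fuse (n + 1))
      (h.gauge.site02_mul_site01_fuse hs (y := a / b) hdiv (n + 1))
      (h.gauge.site01_mul_site02_fuse hs (y := a * b) hab.ne_zero (n + 1)) ?_ ?_ f hX
    -- The scalar of the first fusion is a constant, which vanishes only for `j = n + 1`. The other
    -- one contains `a b`, a nonconstant monomial, and cannot vanish.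
    · have e4 : a / b * cst s ^ (n + 1) = cst s ^ ((n : ℤ) + 1 - j) := by
        rw [hb, zpow_sub₀ hs]
        have : cst s ^ ((n : ℤ) + 1) = cst s ^ (n + 1) := by norm_cast
        rw [this, zpow_natCast]
        field_simp
      rw [e4]
      exact h.cst_zpow_sub_inv_ne (by omega)
    · have := (((hab.mul_cst_pow h 2).div_cst_pow h (n + 1))).c_ne_zero
      exact this

/-- The fused reflection equation for the fusion in the opposite order. -/
theorem Generic.reflects_Khat (h : Generic s) (hkp : kp ≠ 0) (hkm : km ≠ 0) (n : ℕ) :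
    ∀ (a b : Sc) (j : ℕ), IsMonomial b → n + 2 ≤ j → a = b * cst s ^ j →
      Reflects (h.gauge.lax (cst s) (n + 1) (a / b)) (h.gauge.lax (cst s) (n + 1) (a * b))
        (Khalf s kp km a) (Khat s kp km (n + 1) b) := by
  -- The mirror image of the preceding induction: the ratio is `s^j`, the shifts are inverted, the
  -- second conclusion of `Reflects.fuse` is used, and the two fusion identities exchange their
  -- roles.
  induction n with
  | zero =>
    rintro _ b j hb _ rfl
    rw [h.lax_one, h.lax_one]
    exact h.reflects_half hkp hkm (hb.mul_cst_pow h j) hb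
  | succ n ih =>
    intro a b j hbm hj ha
    have hs := h.cst_ne
    have ham : IsMonomial a := by rw [ha]; exact hbm.mul_cst_pow h j
    have ha0 := ham.ne_zero
    have hb0 := hbm.ne_zero
    have hab : IsMonomial (a * b) := by
      rw [ha, mul_right_comm, ← sq]; exact (hbm.pow two_ne_zero).mul_cst_pow h j
    have hbs : IsMonomial (b / cst s) := by
      have := hbm.div_cst_pow h 1
      rwa [pow_one] at this
    have hbb : IsMonomial (b ^ 2 * cst s ^ (n + 1) / cst s) := by
      have := ((hbm.pow two_ne_zero).mul_cst_pow h (n + 1)).div_cst_pow h 1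
      rwa [pow_one] at this
    have hsq : ∀ z : Sc, IsMonomial z → z ^ 2 ≠ 1 := fun z hz => by
      rw [← cst_one]; exact (hz.pow two_ne_zero).ne_cst 1
    have A1 : a / (b * cst s ^ (n + 1)) = a / b / cst s ^ (n + 1) := by field_simp
    have A2 : a * (b * cst s ^ (n + 1)) = a * b * cst s ^ (n + 1) := by ring
    have B1 : a / (b / cst s) = a / b * cst s := by field_simp
    have B2 : a * (b / cst s) = a * b / cst s := by ring
    have h1 := h.reflects_half hkp hkm ham (hbm.mul_cst_pow h (n + 1))
    have h2 := ih a (b / cst s) (j + 1) hbs (by omega) (by rw [ha, pow_succ]; field_simp)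
    rw [A1, A2] at h1
    rw [B1, B2] at h2
    have hσ : cst s ^ (n + 1) ≠ 0 := pow_ne_zero _ hs
    have hdiv : a / b ≠ 0 := div_ne_zero ha0 hb0
    have e1 : a * b / cst s / (a / b / cst s ^ (n + 1)) = b ^ 2 * cst s ^ (n + 1) / cst s := by
      field_simp
    have e2 : a * b * cst s ^ (n + 1) / (a / b * cst s) = b ^ 2 * cst s ^ (n + 1) / cst s := by
      field_simp
    have e3 : a / b * cst s / (a * b * cst s ^ (n + 1)) = (b ^ 2 * cst s ^ (n + 1) / cst s)⁻¹ := by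
      rw [← e2, inv_div]
    have y1 := h.gauge.yangBaxter hs (x := a / b / cst s ^ (n + 1)) (y := a * b / cst s)
      (div_ne_zero hdiv hσ) (div_ne_zero hab.ne_zero hs) (n + 1)
    have y2 := h.gauge.yangBaxter_inv hs (x := a * b * cst s ^ (n + 1)) (y := a / b * cst s)
      (mul_ne_zero hab.ne_zero hσ) (mul_ne_zero hdiv hs) (n + 1)
      (by rw [e3]; exact hsq _ (hbb.inv.mul_cst_pow h _))
      (by rw [e2]; exact hsq _ (hbb.mul_cst_pow h _))
    rw [e1] at y1
    rw [e2] at y2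
    have f := (h1.fuse h2 (S := Rhalf s (n + 1) (b ^ 2 * cst s ^ (n + 1) / cst s))
      (mul_site2_smul (Rhalf_eq h _ _) y1)
      (mul_site2_smul (Rhalf_eq h _ _) y2)).2
    have hinv : Reflects (h.gauge.lax (cst s) (n + 1) (cst s ^ (n + 1 + 1)))
        (h.gauge.lax (cst s) (n + 1) (b ^ 2 * cst s ^ (n + 1) / cst s))
        (Khalf s kp km (b * cst s ^ (n + 1))) (Khat s kp km (n + 1) (b / cst s)) := by
      convert ih (b * cst s ^ (n + 1)) (b / cst s) (n + 2) hbs le_rfl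
        (by field_simp; ring) using 2
      · field_simp; ring
      · ring
    have hX := h.preKhat_mul_fuse hinv
    rw [← Khat_succ h (by omega)] at hX
    refine Reflects.restrict (h.calF_fuse (n + 1))
      (h.gauge.site01_mul_site02_fuse hs (y := a / b) hdiv (n + 1))
      (h.gauge.site02_mul_site01_fuse hs (y := a * b) hab.ne_zero (n + 1)) ?_ ?_ f hX
    · have e4 : a / b * cst s ^ 2 / cst s ^ (n + 1) = cst s ^ ((j : ℤ) + 1 - n) := by
        rw [ha, zpow_sub₀ hs]
        have : cst s ^ ((j : ℤ) + 1) = cst s ^ (j + 1) := by norm_cast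
        rw [this, zpow_natCast]
        field_simp
        ring
      rw [e4]
      exact h.cst_zpow_sub_inv_ne (by omega)
    · exact (hab.mul_cst_pow h (n + 1)).c_ne_zero

end Fused

end

section

variable {s kp km : ℂ}

/-! ### The normalised quantum determinant -/

section Determinant

variable (s kp km) in
/-- The quantum determinant with the normalisation for which it is `K(x) K(x⁻¹)`. -/
def gam (x : Sc) : AqL s kp km :=
  Gam s kp km (x * (cst (qq s))⁻¹) * toAq s kp km (c (x ^ 2)⁻¹)⁻¹

/-- The series at `x q⁻¹` and at `x⁻¹` coincide because `U` takes the same value there, so the trace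
defining `Γ(x q⁻¹)` is the one in `qdet`. -/
theorem Generic.gam_eq (h : Generic s) (x : Sc) :
    gam s kp km x = qdet (cst (qq s)) x (Wx s kp km true x) (Wx s kp km false x) (Kb s kp km x)
      (Kc s kp km x) (Wx s kp km true x⁻¹) (Wx s kp km false x⁻¹) (Kb s kp km x⁻¹)
      (Kc s kp km x⁻¹) := by
  have hq := cst_ne_zero h.qq_ne
  have hU : U s (x * (cst (qq s))⁻¹) = U s x⁻¹ := by
    rw [U_eq_ufun, U_eq_ufun, ← ufun_inv hq (x := x⁻¹), inv_inv]
  have hW : ∀ e, Wx s kp km e (x * (cst (qq s))⁻¹) = Wx s kp km e x⁻¹ := fun e => by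
    rw [Wx, Wx, hU]
  have hG : ∀ e, Gx s kp km e (x * (cst (qq s))⁻¹) = Gx s kp km e x⁻¹ := fun e => by
    rw [Gx, Gx, hU]
  have hb : Kb s kp km (x * (cst (qq s))⁻¹) = Kb s kp km x⁻¹ := by rw [Kb, Kb, hG]
  have hc : Kc s kp km (x * (cst (qq s))⁻¹) = Kc s kp km x⁻¹ := by rw [Kc, Kc, hG]
  have hP : liftC s kp km projM = ((1 / 2 : Sc) • (1 - Matrix.of fun a b =>
      if a = b.swap then 1 else 0) : Matrix (Fin 2 × Fin 2) (Fin 2 × Fin 2) Sc).map (algebraMap Sc (AqL s kp km)) := by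
    rw [liftC_eq]
    congr 1
    ext a b : 2
    simp only [projM, Matrix.map_apply, Matrix.smul_apply, Matrix.sub_apply, Matrix.of_apply,
      Matrix.one_apply, smul_eq_mul, cst_mul, cst_sub, cst_div, cst_one, apply_ite cst, cst_zero]
    rw [show cst 2 = 2 by rw [cst_eq, map_ofNat]]
  rw [gam, ← toAq_commute, ← toAq_smul, qdet, Gam, hP, Khalf_eq, Khalf_eq, hW, hW, hb, hc,
    h.Rhalf_one, mul_assoc x, inv_mul_cancel₀ hq, mul_one, c, inv_inv, liftS_eq]

theorem IsMonomial.pow_four_sub_one_ne {x : Sc} (hx : IsMonomial x) : x ^ 4 - 1 ≠ 0 := by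
  rw [← cst_one]
  exact sub_ne_zero.mpr ((hx.pow four_ne_zero).ne_cst 1)

theorem Generic.Khalf_mul_inv (h : Generic s) (hkp : kp ≠ 0) (hkm : km ≠ 0) {x : Sc}
    (hx : IsMonomial x) :
    Khalf s kp km x * Khalf s kp km x⁻¹ = Matrix.scalar (Fin 2) (gam s kp km x) ∧
      Khalf s kp km x⁻¹ * Khalf s kp km x = Matrix.scalar (Fin 2) (gam s kp km x) := by
  have hq1 : cst (qq s) ^ 2 + 1 ≠ 0 := by
    rw [← cst_one, ← cst_pow, ← cst_add]; exact cst_ne_zero h.qq_sq_add_ne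
  have hq2 : cst (qq s) ^ 2 - 1 ≠ 0 := by
    rw [← cst_one, ← cst_pow, ← cst_sub]; exact cst_ne_zero h.qq_sq_sub_ne
  have hr := h.relAt hkp hkm hx hx.inv
  rw [Khalf_eq, Khalf_eq, h.gam_eq]
  exact ⟨hr.kmat_mul_kmat_inv sc_two_ne_zero (cst_ne_zero h.qq_ne) hq1 hq2 hx.ne_zero
    hx.pow_four_sub_one_ne, hr.kmat_inv_mul_kmat sc_two_ne_zero (cst_ne_zero h.qq_ne) hq1 hq2
      hx.ne_zero hx.pow_four_sub_one_ne⟩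

end Determinant

/-! ### Commutation of the quantum determinant with K-operators -/

section Central

variable {k A a b : Type*} [Field k] [Ring A] [Algebra k A] [Fintype a] [Fintype b]
  [Nonempty a] [DecidableEq a] [DecidableEq b]

/-- If `K K̂` is a scalar and both factors satisfy the reflection equation with `K'`, then
this scalar commutes with `K'`. -/
theorem Reflects.scalar_commute {L L' M M' : Matrix (a × b) (a × b) k} {K Kh : Matrix a a A}
    {K' : Matrix b b A} {γ : A} {r r' : k} (h : Reflects L L' K K') (h' : Reflects M' M Kh K')
    (hK : K * Kh = Matrix.scalar a γ)
    (hL : L * M = r • 1) (hL' : L' * M' = r' • 1) (hr : r ≠ 0) (hr' : r' ≠ 0) (i j : b) :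
    γ * K' i j = K' i j * γ := by
  let φ := algebraMap k A
  set S := site2 a (Matrix.scalar b γ) with hS
  have hS1 : site1 b (Matrix.scalar a γ) = S := by
    ext ⟨i, j⟩ ⟨i', j'⟩
    by_cases h1 : i = i' <;> by_cases h2 : j = j' <;>
      simp [hS, site1, site2, Matrix.diagonal_apply, h1, h2]
  have hSd : S = Matrix.diagonal fun _ => γ := by
    ext ⟨i, j⟩ ⟨i', j'⟩
    by_cases h1 : i = i' <;> by_cases h2 : j = j' <;>
      simp [hS, site2, Matrix.diagonal_apply, h1, h2]
  have hSL : ∀ N : Matrix (a × b) (a × b) k, S * N.map φ = N.map φ * S := fun N => by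
    ext i j
    simp [hSd, φ, Algebra.commutes]
  have hmap1 : (1 : Matrix (a × b) (a × b) k).map φ = 1 :=
    Matrix.map_one _ (map_zero φ) (map_one φ)
  have eL : L.map φ * M.map φ = r • 1 := by
    rw [← Matrix.map_mul, hL, map_smul_algebraMap, hmap1]
  have eL' : L'.map φ * M'.map φ = r' • 1 := by
    rw [← Matrix.map_mul, hL', map_smul_algebraMap, hmap1]
  -- The dressed operators `L K L'` and `M' K̂ M` multiply to a multiple of the scalar. Moving `K'`
  -- through both of them by the two reflection equations moves it through the scalar.
  have e1 : L.map φ * site1 b K * L'.map φ * (M'.map φ * site1 b Kh * M.map φ)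
      = (r * r') • S := by
    calc _ = L.map φ * site1 b K * (L'.map φ * M'.map φ) * site1 b Kh * M.map φ := by
          simp only [Matrix.mul_assoc]
      _ = r' • (L.map φ * (site1 b K * site1 b Kh) * M.map φ) := by
          rw [eL']; simp only [Matrix.mul_smul, Matrix.smul_mul, Matrix.mul_one, Matrix.mul_assoc]
      _ = _ := by
          rw [← site1_mul, hK, hS1, ← hSL, Matrix.mul_assoc, eL, Matrix.mul_smul, Matrix.mul_one,
            smul_smul, mul_comm]
  have e2 : L'.map φ * site1 b K * L.map φ * (M.map φ * site1 b Kh * M'.map φ)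
      = (r * r') • S := by
    calc _ = L'.map φ * site1 b K * (L.map φ * M.map φ) * site1 b Kh * M'.map φ := by
          simp only [Matrix.mul_assoc]
      _ = r • (L'.map φ * (site1 b K * site1 b Kh) * M'.map φ) := by
          rw [eL]; simp only [Matrix.mul_smul, Matrix.smul_mul, Matrix.mul_one, Matrix.mul_assoc]
      _ = _ := by
          rw [← site1_mul, hK, hS1, ← hSL, Matrix.mul_assoc, eL', Matrix.mul_smul, Matrix.mul_one,
            smul_smul]
  rw [Reflects] at h h'
  have e3 : L.map φ * site1 b K * L'.map φ * (M'.map φ * site1 b Kh * M.map φ) * site2 a K'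
      = site2 a K' * (L'.map φ * site1 b K * L.map φ * (M.map φ * site1 b Kh * M'.map φ)) := by
    calc _ = L.map φ * site1 b K * L'.map φ * (M'.map φ * site1 b Kh * M.map φ * site2 a K') := by
          simp only [Matrix.mul_assoc]
      _ = L.map φ * site1 b K * L'.map φ * site2 a K' * (M.map φ * site1 b Kh * M'.map φ) := by
          rw [h']; simp only [Matrix.mul_assoc, φ]
      _ = _ := by rw [h]; simp only [Matrix.mul_assoc, φ]
  rw [e1, e2, Matrix.smul_mul, Matrix.mul_smul] at e3
  have e4 := congrArg (fun Z => (r * r')⁻¹ • Z) e3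
  simp only [smul_smul, inv_mul_cancel₀ (mul_ne_zero hr hr'), one_smul] at e4
  obtain ⟨x⟩ := ‹Nonempty a›
  have e5 := congrFun (congrFun e4 (x, i)) (x, j)
  rw [hSd] at e5
  simpa [site2] using e5

theorem commute_of_smul_add_smul_one {g f : A} {κ κ' : k} (hκ : κ ≠ 0)
    (h : Commute g (κ • f + κ' • 1)) : Commute g f := by
  have h1 : Commute g (κ' • (1 : A)) := (Commute.one_right g).smul_right κ'
  have h2 := (h.sub_right h1).smul_right κ⁻¹
  rwa [add_sub_cancel_right, smul_smul, inv_mul_cancel₀ hκ, one_smul] at h2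

/-- The two diagonal entries of the K-operator form a linear system for `W_±` with determinant `z² -
z⁻²`. -/
theorem commute_of_smul_sub_smul {g f f' : A} {z : k} (hd : z ^ 2 - (z ^ 2)⁻¹ ≠ 0)
    (h1 : Commute g (z • f - z⁻¹ • f')) (h2 : Commute g (z • f' - z⁻¹ • f)) : Commute g f := by
  have h3 := ((h1.smul_right z).add_right (h2.smul_right z⁻¹)).smul_right (z ^ 2 - (z ^ 2)⁻¹)⁻¹
  have : (z ^ 2 - (z ^ 2)⁻¹)⁻¹ • (z • (z • f - z⁻¹ • f') + z⁻¹ • (z • f' - z⁻¹ • f)) = f := by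
    rw [inv_smul_eq_iff₀ hd]
    module
  rwa [this] at h3

end Central

section Entries

theorem Generic.sixVertex_mul_inv (h : Generic s) {y : Sc} (hy : y ≠ 0) :
    sixVertex (cst s ^ 2) y * sixVertex (cst s ^ 2) y⁻¹
      = ((c (y * cst s ^ 2)) * c (y⁻¹ * cst s ^ 2)) • 1 := by
  have := h.gauge.lax_mul_lax_inv h.cst_ne hy 1
  rwa [h.lax_one, h.lax_one] at this

/-- `K(x) K(x⁻¹)` commutes with the K-operator at other points. -/
theorem Generic.gam_commute_Khalf (h : Generic s) (hkp : kp ≠ 0) (hkm : km ≠ 0) {x y : Sc}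
    (hx : IsMonomial x) (hy : IsMonomial y) (hxy : IsMonomial (x * y)) (hxy' : IsMonomial (x / y))
    (i j : Fin 2) :
    Commute (gam s kp km x) (Khalf s kp km y i j) := by
  have h1 := h.reflects_half hkp hkm hx hy
  have h2 := h.reflects_half hkp hkm hx.inv hy
  rw [show x⁻¹ / y = (x * y)⁻¹ by rw [mul_inv]; rfl,
    show x⁻¹ * y = (x / y)⁻¹ by rw [inv_div, mul_comm]; rfl] at h2
  have hK := h.Khalf_mul_inv hkp hkm hx
  exact h1.scalar_commute h2 hK.1 (h.sixVertex_mul_inv hxy'.ne_zero)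
    (h.sixVertex_mul_inv hxy.ne_zero)
    (mul_ne_zero (hxy'.mul_cst_pow h 2).c_ne_zero (hxy'.inv.mul_cst_pow h 2).c_ne_zero)
    (mul_ne_zero (hxy.mul_cst_pow h 2).c_ne_zero (hxy.inv.mul_cst_pow h 2).c_ne_zero) i j

theorem Generic.commute_of_commute_Khalf (h : Generic s) (hkp : kp ≠ 0) (hkm : km ≠ 0) {y : Sc}
    (hy : IsMonomial y) {g : AqL s kp km} (hg : ∀ i j, Commute g (Khalf s kp km y i j))
    (e : Bool) : Commute g (Wx s kp km e y) ∧ Commute g (Gx s kp km e y) := by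
  have hm : IsMonomial (cst (qq s) * y) := hy.cst_mul h.qq_ne
  set z := cst (qq s) * y with hz
  have hz0 := hm.ne_zero
  have hd : z ^ 2 - (z ^ 2)⁻¹ ≠ 0 := (hm.pow two_ne_zero).c_ne_zero
  have h00 := hg 0 0
  have h01 := hg 0 1
  have h10 := hg 1 0
  have h11 := hg 1 1
  rw [Khalf_eq] at h00 h01 h10 h11
  simp only [kmat, Matrix.of_apply, Matrix.cons_val', Matrix.cons_val_zero, Matrix.cons_val_one,
    Matrix.empty_val', Matrix.cons_val_fin_one, ← hz] at h00 h01 h10 h11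
  have hs0 : cst (qq s) + (cst (qq s))⁻¹ ≠ 0 := by
    rw [← cst_inv, ← cst_add]; exact cst_ne_zero h.qq_add_inv_ne
  have hkp' := cst_ne_zero hkp
  have hkm' := cst_ne_zero hkm
  cases e
  · exact ⟨commute_of_smul_sub_smul (A := AqL s kp km) hd h11 h00,
      commute_of_smul_add_smul_one (A := AqL s kp km) (one_div_ne_zero (mul_ne_zero hkp' hs0)) h10⟩
  · exact ⟨commute_of_smul_sub_smul (A := AqL s kp km) hd h00 h11,
      commute_of_smul_add_smul_one (A := AqL s kp km) (one_div_ne_zero (mul_ne_zero hkm' hs0)) h01⟩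

end Entries

end

section

variable {s kp km : ℂ}

/-! ### Centrality of the quantum determinant -/

section Centrality

open PowerSeries

/-- A Horner step: after cancellation of `y` the first generator is isolated up to a remainder of
high degree. -/
theorem genAt_eq_smul {y : PowerSeries ℂ} (hy : constantCoeff y = 0) (w : ℕ → Aq s kp km) :
    genAt s kp km w (HahnSeries.ofPowerSeries ℤ ℂ y) = HahnSeries.ofPowerSeries ℤ ℂ y •
      (HahnSeries.C (w 0) + genAt s kp km (fun k => w (k + 1)) (HahnSeries.ofPowerSeries ℤ ℂ y)) := by
  have e : PowerSeries.mk w = C (w 0) + X * PowerSeries.mk fun k => w (k + 1) := by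
    ext n
    cases n <;> simp [coeff_succ_X_mul]
  rw [toAq_smul, toAq_ofPowerSeries, genAt_ofPowerSeries, genAt_ofPowerSeries,
    ← evalAt_X_mul_mk y hy C w _ fun _ => rfl, ← evalAt_X_mul_mk y hy C (fun k => w (k + 1)) _ fun _ => rfl,
    map_mul, evalAt_X, map_mul, e, map_add, evalAt_C, map_add, HahnSeries.ofPowerSeries_C, map_mul,
    evalAt_X, map_mul]

theorem genAt_coeff_of_lt {y : PowerSeries ℂ} {m : ℕ} (hy : X ^ m ∣ y) (w : ℕ → Aq s kp km) {n : ℤ}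
    (hn : n < m) : (genAt s kp km w (HahnSeries.ofPowerSeries ℤ ℂ y)).coeff n = 0 := by
  rw [genAt_ofPowerSeries]
  rcases lt_or_ge n 0 with h | h
  · exact ofPowerSeries_coeff_neg _ h
  · lift n to ℕ using h
    rw [HahnSeries.ofPowerSeries_apply_coeff, coeff_mk]
    refine Finset.sum_eq_zero fun k _ => ?_
    rw [X_pow_dvd_iff.mp (hy.trans (dvd_pow_self y k.succ_ne_zero)) n (by omega), zero_smul]

/-- Commutation passes to the limit. -/
theorem commute_of_forall_exists {R : Type*} [Ring R] {g a : LaurentSeries R}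
    (h : ∀ N : ℕ, ∃ ε : LaurentSeries R, (∀ n : ℤ, n < N → ε.coeff n = 0) ∧
      g * (a + ε) = (a + ε) * g) : g * a = a * g := by
  ext n
  obtain ⟨ε, hε, hc⟩ := h (n - g.order + 1).toNat
  have h1 : (g * ε).coeff n = 0 := by
    rw [HahnSeries.coeff_mul]
    refine Finset.sum_eq_zero fun p hp => ?_
    have hp' : p.1 + p.2 = n := (Finset.mem_antidiagonal.mp hp).2.2
    rcases lt_or_ge p.1 g.order with h | h
    · rw [HahnSeries.coeff_eq_zero_of_lt_order h, zero_mul]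
    · rw [hε p.2 (by omega), mul_zero]
  have h2 : (ε * g).coeff n = 0 := by
    rw [HahnSeries.coeff_mul]
    refine Finset.sum_eq_zero fun p hp => ?_
    have hp' : p.1 + p.2 = n := (Finset.mem_antidiagonal.mp hp).2.2
    rcases lt_or_ge p.2 g.order with h | h
    · rw [HahnSeries.coeff_eq_zero_of_lt_order h, mul_zero]
    · rw [hε p.1 (by omega), zero_mul]
  have h3 := congrArg (fun f : LaurentSeries R => f.coeff n) hc
  simpa [mul_add, add_mul, h1, h2] using h3

theorem mul_comm_of_add {R : Type*} [Ring R] {g a b : R} (ha : g * a = a * g)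
    (h : g * (a + b) = (a + b) * g) : g * b = b * g := by
  rw [mul_add, add_mul, ha] at h
  exact add_left_cancel h

/-- The series `g` contains `u` itself, so coefficients in `u⁻¹` cannot be compared directly. The
family of points `u^{-m}` replaces a second variable: after division by `y = U(u^{-m})⁻¹` the
element `g` commutes with `w 0` plus a remainder of degree at least `2 m`. Letting `m` grow gives
commutation with `w 0`; subtracting it leaves the shifted sequence, and induction on `k` applies. -/
theorem Generic.commute_C_of_genAt (h : Generic s) {g : AqL s kp km} (k : ℕ) :
    ∀ w : ℕ → Aq s kp km, (∀ m : ℕ, 3 ≤ m → g * genAt s kp km w (U s (HahnSeries.single (m : ℤ) 1))⁻¹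
      = genAt s kp km w (U s (HahnSeries.single (m : ℤ) 1))⁻¹ * g) →
      g * HahnSeries.C (w k) = HahnSeries.C (w k) * g := by
  have key : ∀ w : ℕ → Aq s kp km,
      (∀ m : ℕ, 3 ≤ m → g * genAt s kp km w (U s (HahnSeries.single (m : ℤ) 1))⁻¹
        = genAt s kp km w (U s (HahnSeries.single (m : ℤ) 1))⁻¹ * g) →
      ∀ m : ℕ, 3 ≤ m → g * (HahnSeries.C (w 0)
          + genAt s kp km (fun k => w (k + 1)) (U s (HahnSeries.single (m : ℤ) 1))⁻¹)
        = (HahnSeries.C (w 0)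
          + genAt s kp km (fun k => w (k + 1)) (U s (HahnSeries.single (m : ℤ) 1))⁻¹) * g := by
    intro w hw m hm
    obtain ⟨hU, y, hy, hyU⟩ := h.exists_U_inv (m := m) (by omega) one_ne_zero
    have hy0 : constantCoeff y = 0 := X_dvd_iff.mp ((dvd_pow_self _ (by omega)).trans hy)
    have hne : HahnSeries.ofPowerSeries ℤ ℂ y ≠ 0 := by rw [hyU]; exact inv_ne_zero hU
    have hw' := hw m hm
    rw [← hyU, genAt_eq_smul hy0, mul_smul_comm, smul_mul_assoc] at hw'
    have := congrArg (fun f => (HahnSeries.ofPowerSeries ℤ ℂ y)⁻¹ • f) hw'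
    simp only [smul_smul, inv_mul_cancel₀ hne, one_smul] at this
    rwa [hyU] at this
  have zero : ∀ w : ℕ → Aq s kp km,
      (∀ m : ℕ, 3 ≤ m → g * genAt s kp km w (U s (HahnSeries.single (m : ℤ) 1))⁻¹
        = genAt s kp km w (U s (HahnSeries.single (m : ℤ) 1))⁻¹ * g) →
      g * HahnSeries.C (w 0) = HahnSeries.C (w 0) * g := by
    intro w hw
    refine commute_of_forall_exists fun N => ⟨_, ?_, key w hw (N + 3) (by omega)⟩
    intro n hn
    obtain ⟨hU, y, hy, hyU⟩ := h.exists_U_inv (m := N + 3) (by omega) one_ne_zero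
    rw [← hyU]
    exact genAt_coeff_of_lt hy _ (by push_cast; omega)
  induction k with
  | zero => exact zero
  | succ k ih =>
    intro w hw
    refine ih (fun k => w (k + 1)) fun m hm => ?_
    -- With the contribution of `w 0` removed, the shifted sequence satisfies the same hypothesis.
    exact mul_comm_of_add (R := AqL s kp km) (zero w hw) (key w hw m hm)

/-- Commuting with a constant series means that every coefficient of `g` commutes with it. These
coefficients then commute with the generators, hence with all of `A_q`. -/
theorem mul_comm_of_commute_generators {g : AqL s kp km}
    (hW : ∀ e k, g * HahnSeries.C (genW s kp km e k) = HahnSeries.C (genW s kp km e k) * g)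
    (hG : ∀ e k, g * HahnSeries.C (genG s kp km e k) = HahnSeries.C (genG s kp km e k) * g)
    (f : AqL s kp km) : g * f = f * g := by
  have hc : ∀ a : Aq s kp km, g * HahnSeries.C a = HahnSeries.C a * g →
      ∀ n, g.coeff n * a = a * g.coeff n := by
    intro a ha n
    have := congrArg (fun f : AqL s kp km => f.coeff n) ha
    simpa only [HahnSeries.C_apply, HahnSeries.coeff_mul_single_zero,
      HahnSeries.coeff_single_zero_mul] using this
  refine laurent_mul_comm fun m n => ?_
  obtain ⟨a, ha⟩ := RingQuot.mkAlgHom_surjective ℂ (Rel s kp km) (f.coeff n)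
  rw [← ha]
  clear ha
  induction a using FreeAlgebra.induction with
  | grade0 r => rw [AlgHom.commutes, Algebra.commutes]
  | grade1 x =>
    cases x with
    | W e k => exact hc _ (hW e k) m
    | G e k => exact hc _ (hG e k) m
  | mul a b iha ihb => rw [map_mul, ← mul_assoc, iha, mul_assoc, ihb, mul_assoc]
  | add a b iha ihb => rw [map_add, mul_add, add_mul, iha, ihb]

theorem Generic.gam_mul_comm (h : Generic s) (hkp : kp ≠ 0) (hkm : km ≠ 0) {a : ℂ} (ha : a ≠ 0)
    (f : AqL s kp km) :
    gam s kp km (u * cst a) * f = f * gam s kp km (u * cst a) := by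
  have hx : u * cst a = HahnSeries.single (-1) a := by
    rw [u, cst, HahnSeries.C_apply, HahnSeries.single_mul_single, one_mul, add_zero]
  have hxm : IsMonomial (u * cst a) := isMonomial_u.mul_cst ha
  -- In the variable `u⁻¹` the determinant sits at degree `-1`. For these `m` the product and the
  -- quotient of the two parameters have nonzero degrees `m - 1` and `-1 - m`, so the R-matrices
  -- involved are invertible.
  have key : ∀ m : ℕ, 3 ≤ m → ∀ e,
      Commute (gam s kp km (u * cst a)) (Wx s kp km e (HahnSeries.single (m : ℤ) 1)) ∧
      Commute (gam s kp km (u * cst a)) (Gx s kp km e (HahnSeries.single (m : ℤ) 1)) := by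
    intro m hm e
    have hy : IsMonomial (HahnSeries.single (m : ℤ) (1 : ℂ)) := ⟨m, by omega, 1, one_ne_zero, rfl⟩
    refine h.commute_of_commute_Khalf hkp hkm hy (fun i j => h.gam_commute_Khalf hkp hkm hxm hy
      ?_ ?_ i j) e
    · rw [hx, HahnSeries.single_mul_single]
      exact ⟨_, by omega, _, by simpa using ha, rfl⟩
    · rw [hx, div_eq_mul_inv, HahnSeries.inv_single, HahnSeries.single_mul_single]
      exact ⟨_, by omega, _, by simpa using ha, rfl⟩
  exact mul_comm_of_commute_generators
    (fun e k => h.commute_C_of_genAt k _ fun m hm => (key m hm e).1)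
    (fun e k => h.commute_C_of_genAt k _ fun m hm => (key m hm e).2) f

end Centrality

end

section

/-! ### Recursion for the scalar factors -/

section DoubleProduct

variable {R : Type*} [CommRing R]

/-- The double product in the unitarity scalar. -/
def doubleProd (f g : ℤ → R) (n : ℕ) : R :=
  ∏ k ∈ Finset.range (n - 1), ∏ l ∈ Finset.range (n - 1 - k),
    f ((n : ℤ) - 1 - 2 * k - l) * g ((1 : ℤ) - k + l)

/-- The factors `f` lose the last `l` of each row and the factors `g` lose the row `k = 0`. What
remains is the smaller double product with exponents shifted by `1` and `-1`, as produced by `x ↦ x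
q^{1/2}`. -/
theorem doubleProd_succ (f g : ℤ → R) (n : ℕ) (hn : 1 ≤ n) :
    doubleProd f g (n + 1) = (∏ k ∈ Finset.range n, f (1 - k)) * (∏ l ∈ Finset.range n, g (1 + l))
      * doubleProd (fun e => f (e + 1)) (fun e => g (e - 1)) n := by
  obtain ⟨m, rfl⟩ := Nat.exists_eq_add_of_le' hn
  simp only [doubleProd, Finset.prod_mul_distrib, Nat.add_sub_cancel]
  have hf : ∏ k ∈ Finset.range (m + 1), ∏ l ∈ Finset.range (m + 1 - k),
        f (((m + 1 + 1 : ℕ) : ℤ) - 1 - 2 * k - l)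
      = (∏ k ∈ Finset.range (m + 1), f (1 - k)) * ∏ k ∈ Finset.range m, ∏ l ∈ Finset.range (m - k),
        f (((m + 1 : ℕ) : ℤ) - 1 - 2 * k - l + 1) := by
    have h1 : ∀ k ∈ Finset.range (m + 1), ∏ l ∈ Finset.range (m + 1 - k),
          f (((m + 1 + 1 : ℕ) : ℤ) - 1 - 2 * k - l)
        = f (1 - k) * ∏ l ∈ Finset.range (m - k), f (((m + 1 : ℕ) : ℤ) - 1 - 2 * k - l + 1) := by
      intro k hk
      have hk' := Finset.mem_range.mp hk
      rw [show m + 1 - k = m - k + 1 by omega, Finset.prod_range_succ, mul_comm]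
      congr 1
      · congr 1; omega
      · refine Finset.prod_congr rfl fun l _ => ?_
        congr 1; push_cast; ring
    rw [Finset.prod_congr rfl h1, Finset.prod_mul_distrib]
    congr 1
    rw [Finset.prod_range_succ]
    simp
  have hg : ∏ k ∈ Finset.range (m + 1), ∏ l ∈ Finset.range (m + 1 - k), g ((1 : ℤ) - k + l)
      = (∏ l ∈ Finset.range (m + 1), g (1 + l)) * ∏ k ∈ Finset.range m, ∏ l ∈ Finset.range (m - k),
        g ((1 : ℤ) - k + l - 1) := by
    rw [Finset.prod_range_succ', mul_comm]
    congr 1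
    · refine Finset.prod_congr rfl fun k _ => ?_
      rw [show m + 1 - (k + 1) = m - k by omega]
      refine Finset.prod_congr rfl fun l _ => ?_
      congr 1; push_cast; ring
  rw [hf, hg]
  ring

end DoubleProduct

variable {s kp km : ℂ}

section ScalarFactors

theorem smul_mul_smul_one {k m : Type*} [Field k] [Fintype m] [DecidableEq m] {P Q : Matrix m m k}
    {e : k} (h : P * Q = e • 1) (a b : k) : (a • P) * (b • Q) = (a * b * e) • (1 : Matrix m m k) := by
  rw [Matrix.smul_mul, Matrix.mul_smul, h, smul_smul, smul_smul]

/-- The scalar `R(y) R(y⁻¹)`. -/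
def rhoR (s : ℂ) (n : ℕ) (y : Sc) : Sc :=
  (∏ k ∈ Finset.range (n - 1), c (cst (s ^ ((n : ℤ) - 1 - 2 * k)) * y))
    * (∏ k ∈ Finset.range (n - 1), c (cst (s ^ ((n : ℤ) - 1 - 2 * k)) * y⁻¹))
    * (c (y * cst s ^ (n + 1)) * c (y⁻¹ * cst s ^ (n + 1)))

theorem Generic.Rhalf_mul_inv (h : Generic s) (n : ℕ) {y : Sc} (hy : y ≠ 0) :
    Rhalf s n y * Rhalf s n y⁻¹ = rhoR s n y • 1 := by
  rw [Rhalf_eq h, Rhalf_eq h]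
  exact smul_mul_smul_one (h.gauge.lax_mul_lax_inv h.cst_ne hy n) _ _

theorem rhoR_inv (s : ℂ) (n : ℕ) (y : Sc) : rhoR s n y⁻¹ = rhoR s n y := by
  simp only [rhoR, inv_inv]; ring

/-- The second factor of the unitarity scalar, with spectral parameter `x`. -/
def cProdAt (s : ℂ) (n : ℕ) (x : Sc) : Sc :=
  doubleProd (fun e => c (x ^ 2 * cst (qq s ^ e))) (fun e => c ((x ^ 2)⁻¹ * cst (qq s ^ e))) n

/-- The factors split off by `doubleProd_succ` are those of `R(y) R(y⁻¹)`: the `f` with `k = 0` and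
the `g` with `l = n - 1` come from unitarity of the Lax operator, the others from the prefactors of
the two R-matrices. The `g` occur in reverse order, hence the reflection of the product. -/
theorem Generic.cProdAt_succ (h : Generic s) (n : ℕ) (hn : 1 ≤ n) {x : Sc} (hx : x ≠ 0) :
    cProdAt s (n + 1) x = rhoR s n (x ^ 2 * cst s / cst s ^ n) * cProdAt s n (x * cst s) := by
  have hs := h.cst_ne
  have hq : qq s ≠ 0 := h.qq_ne
  have hz : ∀ e : ℤ, cst (qq s ^ e) = cst s ^ (2 * e) := fun e => by
    rw [zpow_mul, cst_zpow, cst_qq]; norm_cast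
  have e1 : cProdAt s n (x * cst s) = doubleProd (fun e => c (x ^ 2 * cst (qq s ^ (e + 1))))
      (fun e => c ((x ^ 2)⁻¹ * cst (qq s ^ (e - 1)))) n := by
    rw [cProdAt]
    refine congrArg₂ (fun f g => doubleProd f g n) (funext fun e => congrArg c ?_)
      (funext fun e => congrArg c ?_)
    · rw [zpow_add₀ hq, zpow_one, cst_mul, cst_qq]; ring
    · rw [zpow_sub₀ hq, zpow_one, cst_div, cst_qq]; field_simp
  rw [cProdAt, doubleProd_succ _ _ n hn, ← e1]
  refine congrArg (· * cProdAt s n (x * cst s)) ?_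
  obtain ⟨m, rfl⟩ := Nat.exists_eq_add_of_le' hn
  rw [rhoR, Nat.add_sub_cancel, Finset.prod_range_succ', Finset.prod_range_succ (fun l : ℕ =>
    c ((x ^ 2)⁻¹ * cst (qq s ^ ((1 : ℤ) + l)))), ← Finset.prod_range_reflect (fun l : ℕ =>
    c ((x ^ 2)⁻¹ * cst (qq s ^ ((1 : ℤ) + l))))]
  have f1 : ∀ k : ℕ, c (x ^ 2 * cst (qq s ^ ((1 : ℤ) - ((k + 1 : ℕ) : ℤ))))
      = c (cst (s ^ (((m + 1 : ℕ) : ℤ) - 1 - 2 * k)) * (x ^ 2 * cst s / cst s ^ (m + 1))) := by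
    intro k
    refine congrArg c ?_
    rw [hz, cst_zpow, ← zpow_natCast (cst s) (m + 1)]
    rw [show (2 * ((1 : ℤ) - ((k + 1 : ℕ) : ℤ))) = (((m + 1 : ℕ) : ℤ) - 1 - 2 * k) + 1 - ((m + 1 : ℕ) : ℤ) by
      push_cast; ring, zpow_sub₀ hs, zpow_add₀ hs, zpow_one]
    ring
  have f2 : ∀ k ∈ Finset.range m, c ((x ^ 2)⁻¹ * cst (qq s ^ ((1 : ℤ) + ((m - 1 - k : ℕ) : ℤ))))
      = c (cst (s ^ (((m + 1 : ℕ) : ℤ) - 1 - 2 * k)) * (x ^ 2 * cst s / cst s ^ (m + 1))⁻¹) := by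
    intro k hk
    have hk' := Finset.mem_range.mp hk
    refine congrArg c ?_
    rw [hz, cst_zpow, ← zpow_natCast (cst s) (m + 1)]
    rw [show (2 * ((1 : ℤ) + ((m - 1 - k : ℕ) : ℤ)))
      = (((m + 1 : ℕ) : ℤ) - 1 - 2 * k) + ((m + 1 : ℕ) : ℤ) - 1 by omega,
      zpow_sub₀ hs _ 1, zpow_add₀ hs, zpow_one]
    field_simp
  have f3 : c (x ^ 2 * cst (qq s ^ ((1 : ℤ) - ((0 : ℕ) : ℤ))))
      = c (x ^ 2 * cst s / cst s ^ (m + 1) * cst s ^ (m + 1 + 1)) := by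
    refine congrArg c ?_
    rw [Nat.cast_zero, sub_zero, zpow_one, cst_qq]
    field_simp
    ring
  have f4 : c ((x ^ 2)⁻¹ * cst (qq s ^ ((1 : ℤ) + (m : ℤ))))
      = c ((x ^ 2 * cst s / cst s ^ (m + 1))⁻¹ * cst s ^ (m + 1 + 1)) := by
    refine congrArg c ?_
    rw [show qq s ^ ((1 : ℤ) + (m : ℤ)) = qq s ^ (m + 1) by
      rw [← zpow_natCast]; congr 1; push_cast; ring, cst_pow, cst_qq]
    field_simp
    ring
  rw [Finset.prod_congr rfl fun k _ => f1 k, Finset.prod_congr rfl f2, f3, f4]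
  ring

end ScalarFactors

/-! ### Collapse of the product and unitarity -/

section Chain

variable {M : Type*} [Monoid M]

theorem chain_mul {K1 K1' R R' K2 K2' Γ r G : M} (h1 : K1 * K1' = Γ) (hR : R * R' = r)
    (h2 : K2 * K2' = G) (hr : ∀ z, r * z = z * r) (hG : ∀ z, G * z = z * G) :
    K1 * R * K2 * (K2' * R' * K1') = Γ * r * G := by
  calc _ = K1 * R * (K2 * K2') * R' * K1' := by simp only [mul_assoc]
    _ = K1 * (R * R') * K1' * G := by rw [h2]; simp only [mul_assoc, hG]
    _ = _ := by rw [hR, mul_assoc K1, hr, ← mul_assoc K1, h1]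

/-- In this order the innermost pair is `K1' K1`, so that `Γ` rather than `G` has to be central. -/
theorem chain_mul_rev {K1 K1' R R' K2 K2' Γ r G : M} (h1 : K1' * K1 = Γ) (hR : R' * R = r)
    (h2 : K2' * K2 = G) (hr : ∀ z, r * z = z * r) (hΓ : ∀ z, Γ * z = z * Γ) :
    K2' * R' * K1' * (K1 * R * K2) = Γ * r * G := by
  calc _ = K2' * R' * (K1' * K1) * R * K2 := by simp only [mul_assoc]
    _ = Γ * (K2' * (R' * R) * K2) := by
      rw [h1, mul_assoc _ Γ, mul_assoc _ (Γ * R), mul_assoc Γ, mul_assoc K2', ← mul_assoc R', ← hΓ, mul_assoc Γ,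
        ← mul_assoc K2', ← hΓ]
      simp only [mul_assoc]
    _ = _ := by rw [hR, ← hr, mul_assoc r, h2, mul_assoc]

end Chain

end

section

section ScalarLegs

variable {k A a b e : Type*} [Field k] [Ring A] [Algebra k A] [Fintype a] [Fintype b] [Fintype e]
  [DecidableEq a] [DecidableEq b] [DecidableEq e]

theorem site1_scalar (γ : A) : site1 b (Matrix.scalar a γ) = Matrix.scalar (a × b) γ := by
  ext ⟨i, j⟩ ⟨i', j'⟩
  by_cases h1 : i = i' <;> by_cases h2 : j = j' <;> simp [site1, Matrix.diagonal_apply, h1, h2]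

theorem site2_scalar (γ : A) : site2 a (Matrix.scalar b γ) = Matrix.scalar (a × b) γ := by
  ext ⟨i, j⟩ ⟨i', j'⟩
  by_cases h1 : i = i' <;> by_cases h2 : j = j' <;> simp [site2, Matrix.diagonal_apply, h1, h2]

theorem site1_mul_eq_scalar {X Y : Matrix a a A} {γ : A} (h : X * Y = Matrix.scalar a γ) :
    site1 b X * site1 b Y = Matrix.scalar (a × b) γ := by
  rw [← site1_mul, h, site1_scalar]

theorem site2_mul_eq_scalar {X Y : Matrix b b A} {γ : A} (h : X * Y = Matrix.scalar b γ) :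
    site2 a X * site2 a Y = Matrix.scalar (a × b) γ := by
  rw [← site2_mul, h, site2_scalar]

theorem map_mul_map_of_eq_smul_one {P Q : Matrix a a k} {r : k} (h : P * Q = r • 1) :
    P.map (algebraMap k A) * Q.map (algebraMap k A) = Matrix.scalar a (algebraMap k A r) := by
  rw [← Matrix.map_mul, h, map_smul_algebraMap,
    Matrix.map_one _ (map_zero (algebraMap k A)) (map_one _)]
  ext i j
  by_cases hij : i = j <;> simp [hij, Algebra.smul_def]

theorem mul_scalar_mul_of_mul_eq_one {F : Matrix e a k} {E : Matrix a e k} (hFE : F * E = 1)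
    (γ : A) :
    F.map (algebraMap k A) * Matrix.scalar a γ * E.map (algebraMap k A) = Matrix.scalar e γ := by
  have h1 : F.map (algebraMap k A) * E.map (algebraMap k A) = 1 := by
    rw [← Matrix.map_mul, hFE, Matrix.map_one _ (map_zero (algebraMap k A)) (map_one _)]
  have h2 : F.map (algebraMap k A) * Matrix.scalar a γ = Matrix.scalar e γ * F.map (algebraMap k A) := by
    ext i j
    simp [Algebra.commutes]
  rw [h2, Matrix.mul_assoc, h1, Matrix.mul_one]

/-- The product of two restricted operators when the second one preserves the image of the fusion
map and the product of the unrestricted operators is a scalar. -/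
theorem restrict_mul_restrict {F : Matrix e a k} {E : Matrix a e k} (hFE : F * E = 1)
    {P Q : Matrix a a A} {z : A}
    (hQ : Q * E.map (algebraMap k A) = E.map (algebraMap k A)
      * (F.map (algebraMap k A) * Q * E.map (algebraMap k A)))
    (hPQ : P * Q = Matrix.scalar a z) :
    F.map (algebraMap k A) * P * E.map (algebraMap k A)
      * (F.map (algebraMap k A) * Q * E.map (algebraMap k A)) = Matrix.scalar e z := by
  rw [Matrix.mul_assoc _ (E.map _), ← hQ, ← mul_scalar_mul_of_mul_eq_one hFE, ← hPQ]
  simp only [Matrix.mul_assoc]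

end ScalarLegs

variable {s kp km : ℂ}

section Unitarity

theorem mul_cst_div (w : Sc) (a : ℂ) (n : ℕ) : w * cst a / cst s ^ n = w * cst (a / s ^ n) := by
  rw [cst_div, cst_pow]
  exact mul_div_assoc _ _ _

theorem mul_cst_mul' (w : Sc) (a b : ℂ) : w * cst a * cst b = w * cst (a * b) := by
  rw [cst_mul]
  exact mul_assoc _ _ _

theorem mul_cst_mul (w : Sc) (a : ℂ) : w * cst a * cst s = w * cst (a * s) := by
  rw [cst_mul]
  exact mul_assoc _ _ _

variable (s kp km) in
/-- The product of normalised quantum determinants in the unitarity scalar. -/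
def gamProdAt (n : ℕ) (x : Sc) : AqL s kp km :=
  ((List.range n).map fun k : ℕ => gam s kp km (x * cst (s ^ (-(n : ℤ) + 1 + 2 * k)))).prod

theorem Generic.gamProdAt_succ (h : Generic s) (n : ℕ) (x : Sc) :
    gamProdAt s kp km (n + 1) x
      = gam s kp km (x / cst s ^ n) * gamProdAt s kp km n (x * cst s) := by
  rw [gamProdAt, gamProdAt, List.range_succ_eq_map, List.map_cons, List.prod_cons, List.map_map]
  refine congrArg₂ (· * ·) (congrArg (gam s kp km) ?_) (congrArg List.prod
    (List.map_congr_left fun k _ => congrArg (gam s kp km) ?_))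
  · rw [show -((n + 1 : ℕ) : ℤ) + 1 + 2 * ((0 : ℕ) : ℤ) = -(n : ℤ) by push_cast; ring, zpow_neg,
      zpow_natCast, cst_inv, cst_pow, div_eq_mul_inv]
  · rw [mul_cst_mul', ← zpow_one_add₀ h.ne]
    refine congrArg (fun e : ℤ => x * cst (s ^ e)) ?_
    push_cast
    ring

variable (s kp km) in
/-- The scalar in the unitarity relation. -/
def unitScalar (n : ℕ) (x : Sc) : AqL s kp km :=
  gamProdAt s kp km n x * algebraMap Sc (AqL s kp km) (cProdAt s n x)

theorem unitScalar_one (x : Sc) : unitScalar s kp km 1 x = gam s kp km x := by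
  simp [unitScalar, gamProdAt, cProdAt, doubleProd, cst_one]

theorem Generic.unitScalar_succ (h : Generic s) {n : ℕ} (hn : 1 ≤ n) {x : Sc} (hx : x ≠ 0) :
    unitScalar s kp km (n + 1) x = gam s kp km (x / cst s ^ n)
      * algebraMap Sc (AqL s kp km) (rhoR s n (x ^ 2 * cst s / cst s ^ n))
      * unitScalar s kp km n (x * cst s) := by
  rw [unitScalar, unitScalar, h.gamProdAt_succ, h.cProdAt_succ n hn hx, map_mul, mul_assoc,
    mul_assoc]
  refine congrArg _ ?_
  rw [← mul_assoc, ← mul_assoc, Algebra.commutes]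

theorem Generic.unitScalar_mul_comm (h : Generic s) (hkp : kp ≠ 0) (hkm : km ≠ 0) {n : ℕ}
    (hn : 1 ≤ n) : ∀ (a : ℂ), a ≠ 0 → ∀ f : AqL s kp km,
      unitScalar s kp km n (u * cst a) * f = f * unitScalar s kp km n (u * cst a) := by
  induction n, hn using Nat.le_induction with
  | base =>
    intro a ha f
    rw [unitScalar_one]
    exact h.gam_mul_comm hkp hkm ha f
  | succ n hn ih =>
    intro a ha f
    rw [h.unitScalar_succ hn (isMonomial_u.mul_cst ha).ne_zero, mul_cst_div, mul_cst_mul]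
    have h1 : Commute (gam s kp km (u * cst (a / s ^ n))) f :=
      h.gam_mul_comm hkp hkm (a := a / s ^ n) (div_ne_zero ha (pow_ne_zero n h.ne)) f
    exact (h1.mul_left (Algebra.commutes (A := AqL s kp km) _ f)).mul_left
      (ih _ (mul_ne_zero ha h.ne) f)

/-- The constant `a` is arbitrary because the induction moves from `x` to `x q^{1/2}`. The factors
of `preKhat` at `x⁻¹` are those of `preK` at `x` in reverse order, with inverted parameters, so the
product of the two collapses from the inside; invariance of the image of the fusion map carries this
over to the restrictions. -/
theorem Generic.Kop_mul_Khat (h : Generic s) (hkp : kp ≠ 0) (hkm : km ≠ 0) {n : ℕ} (hn : 1 ≤ n) :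
    ∀ (a : ℂ), a ≠ 0 →
      Kop s kp km n (u * cst a) * Khat s kp km n (u * cst a)⁻¹
        = Matrix.scalar (Fin (n + 1)) (unitScalar s kp km n (u * cst a)) ∧
      Khat s kp km n (u * cst a)⁻¹ * Kop s kp km n (u * cst a)
        = Matrix.scalar (Fin (n + 1)) (unitScalar s kp km n (u * cst a)) := by
  induction n, hn using Nat.le_induction with
  | base =>
    intro a ha
    rw [unitScalar_one]
    exact h.Khalf_mul_inv hkp hkm (isMonomial_u.mul_cst ha)
  | succ n hn ih =>
    intro a ha
    have hs := h.cst_ne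
    have hsn : cst s ^ n ≠ 0 := pow_ne_zero _ hs
    obtain ⟨m, rfl⟩ := Nat.exists_eq_add_of_le' hn
    have hxm : IsMonomial (u * cst a) := isMonomial_u.mul_cst ha
    have hg1 : ∀ r, unitScalar s kp km (m + 1) (u * cst a * cst s) * r
        = r * unitScalar s kp km (m + 1) (u * cst a * cst s) := fun r => by
      rw [mul_cst_mul]; exact h.unitScalar_mul_comm hkp hkm hn _ (mul_ne_zero ha h.ne) r
    have hg2 : ∀ r, gam s kp km (u * cst a / cst s ^ (m + 1)) * r
        = r * gam s kp km (u * cst a / cst s ^ (m + 1)) := fun r => by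
      rw [mul_cst_div]
      exact h.gam_mul_comm hkp hkm (a := a / s ^ (m + 1)) (div_ne_zero ha (pow_ne_zero _ h.ne)) r
    obtain ⟨i1, i2⟩ := ih (a * s) (mul_ne_zero ha h.ne)
    rw [← mul_cst_mul] at i1 i2
    -- The special form of the parameter was needed for centrality only; from here on it matters
    -- only that it is a monomial.
    generalize u * cst a = x at hxm hg1 hg2 i1 i2 ⊢
    have hx0 := hxm.ne_zero
    set y := x ^ 2 * cst s / cst s ^ (m + 1) with hy
    have hy0 : y ≠ 0 := (((hxm.pow two_ne_zero).mul_cst h.ne).div_cst_pow h _).ne_zero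
    have e1 : x⁻¹ / cst s = (x * cst s)⁻¹ := by field_simp
    have e2 : x⁻¹ ^ 2 * cst s ^ (m + 1) / cst s = y⁻¹ := by rw [hy]; field_simp
    have e3 : x⁻¹ * cst s ^ (m + 1) = (x / cst s ^ (m + 1))⁻¹ := by rw [inv_div]; field_simp
    have hr1 := h.reflects_Kop hkp hkm m (x / cst s ^ (m + 1)) (x * cst s) (m + 2)
      (hxm.div_cst_pow h _) le_rfl (by field_simp; ring)
    rw [show x / cst s ^ (m + 1) / (x * cst s) = (cst s ^ (m + 1 + 1))⁻¹ by field_simp; ring,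
      show x / cst s ^ (m + 1) * (x * cst s) = y by rw [hy]; ring] at hr1
    have hr2 := h.reflects_Khat hkp hkm m (x⁻¹ * cst s ^ (m + 1)) (x⁻¹ / cst s) (m + 2)
      (by rw [e1]; exact (hxm.mul_cst h.ne).inv) le_rfl (by field_simp; ring)
    rw [show x⁻¹ * cst s ^ (m + 1) / (x⁻¹ / cst s) = cst s ^ (m + 1 + 1) by field_simp; ring,
      show x⁻¹ * cst s ^ (m + 1) * (x⁻¹ / cst s) = x⁻¹ ^ 2 * cst s ^ (m + 1) / cst s by ring] at hr2
    have p1 := h.preK_mul_fuse hr1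
    have p2 := h.preKhat_mul_fuse hr2
    have hK := h.Khalf_mul_inv hkp hkm (hxm.div_cst_pow h (m + 1))
    have hR := map_mul_map_of_eq_smul_one (A := AqL s kp km) (h.Rhalf_mul_inv (m + 1) hy0)
    have hR' := map_mul_map_of_eq_smul_one (A := AqL s kp km)
      (h.Rhalf_mul_inv (m + 1) (inv_ne_zero hy0))
    rw [inv_inv, rhoR_inv] at hR'
    have hc1 : ∀ z : Matrix (Fin 2 × Fin (m + 1 + 1)) (Fin 2 × Fin (m + 1 + 1)) (AqL s kp km),
        Matrix.scalar _ (algebraMap Sc (AqL s kp km) (rhoR s (m + 1) y)) * z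
          = z * Matrix.scalar _ (algebraMap Sc (AqL s kp km) (rhoR s (m + 1) y)) := fun z =>
      Matrix.scalar_commute _ (fun r => Algebra.commutes _ r) z
    have hc2 : ∀ z : Matrix (Fin 2 × Fin (m + 1 + 1)) (Fin 2 × Fin (m + 1 + 1)) (AqL s kp km),
        Matrix.scalar _ (unitScalar s kp km (m + 1) (x * cst s)) * z
          = z * Matrix.scalar _ (unitScalar s kp km (m + 1) (x * cst s)) := fun z =>
      Matrix.scalar_commute _ hg1 z
    have hc3 : ∀ z : Matrix (Fin 2 × Fin (m + 1 + 1)) (Fin 2 × Fin (m + 1 + 1)) (AqL s kp km),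
        Matrix.scalar _ (gam s kp km (x / cst s ^ (m + 1))) * z
          = z * Matrix.scalar _ (gam s kp km (x / cst s ^ (m + 1))) := fun z =>
      Matrix.scalar_commute _ hg2 z
    have k1 := site1_mul_eq_scalar (A := AqL s kp km) (b := Fin (m + 1 + 1)) hK.1
    have k2 := site1_mul_eq_scalar (A := AqL s kp km) (b := Fin (m + 1 + 1)) hK.2
    have k3 := site2_mul_eq_scalar (A := AqL s kp km) (a := Fin 2) i1
    have k4 := site2_mul_eq_scalar (A := AqL s kp km) (a := Fin 2) i2
    have c1 := chain_mul k1 hR k3 hc1 hc2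
    have c2 := chain_mul_rev k2 hR' k4 hc1 hc3
    rw [← map_mul, ← map_mul] at c1 c2
    rw [Kop_succ h hn, Khat_succ h hn, h.unitScalar_succ hn hx0]
    rw [preKhat, e1, e2, e3] at p2
    rw [preK] at p1
    rw [preK, preKhat, e1, e2, e3]
    exact ⟨restrict_mul_restrict (A := AqL s kp km) (h.calF_fuse (m + 1)) p2 c1,
      restrict_mul_restrict (A := AqL s kp km) (h.calF_fuse (m + 1)) p1 c2⟩

end Unitarity

end

section

variable {s kp km : ℂ}

/-! ### Comparison with the closed form of the scalar -/

section ClosedForm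

theorem Generic.gammaProd_eq (h : Generic s) (n : ℕ) :
    gammaProd s kp km n = gamProdAt s kp km n u := by
  have hs := h.cst_ne
  -- In `gammaProd` the index is an integer, and the list of natural numbers is coerced monadically;
  -- this brings it to an ordinary map.
  have hl : (do let a ← List.range n; pure (a : ℤ)) = (List.range n).map fun k : ℕ => (k : ℤ) := by
    simp [← List.flatMap_pure_eq_map]
    rfl
  rw [gammaProd, gamProdAt, hl, List.map_map]
  refine congrArg List.prod (List.map_congr_left fun k _ => ?_)
  rw [Function.comp_apply]
  have hu : u * cst (s ^ (-(n : ℤ) - 1 + 2 * k))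
      = u * cst (s ^ (-(n : ℤ) + 1 + 2 * k)) * (cst (qq s))⁻¹ := by
    rw [← cst_inv, mul_cst_mul', qq, ← zpow_natCast, ← zpow_neg, ← zpow_add₀ h.ne]
    refine congrArg (fun e : ℤ => u * cst (s ^ e)) ?_
    push_cast
    ring
  have hc : (u ^ 2)⁻¹ * cst (qq s ^ ((n : ℤ) - 1 - 2 * k))
      = ((u * cst (s ^ (-(n : ℤ) + 1 + 2 * k))) ^ 2)⁻¹ := by
    have e : qq s ^ ((n : ℤ) - 1 - 2 * k) = ((s ^ (-(n : ℤ) + 1 + 2 * k)) ^ 2)⁻¹ := by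
      rw [qq, ← zpow_natCast, ← zpow_natCast, ← zpow_mul, ← zpow_mul, ← zpow_neg]
      congr 1
      push_cast
      ring
    rw [mul_pow, mul_inv, ← cst_pow, ← cst_inv, e]
  rw [gam, hu, hc]

theorem Generic.gammaProd_mul_cProd (h : Generic s) (n : ℕ) :
    gammaProd s kp km n * toAq s kp km (cProd s n) = unitScalar s kp km n u := by
  rw [h.gammaProd_eq, unitScalar, algebraMap_eq]
  rfl

theorem Generic.Kop_mul_Khat_u (h : Generic s) (hkp : kp ≠ 0) (hkm : km ≠ 0) {n : ℕ}
    (hn : 1 ≤ n) :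
    Kop s kp km n u * Khat s kp km n u⁻¹ = Matrix.scalar (Fin (n + 1)) (unitScalar s kp km n u) ∧
      Khat s kp km n u⁻¹ * Kop s kp km n u
        = Matrix.scalar (Fin (n + 1)) (unitScalar s kp km n u) := by
  have := h.Kop_mul_Khat hkp hkm hn 1 one_ne_zero
  rwa [cst_one, mul_one] at this

end ClosedForm

end

/-! ### Lower bounds for degrees in `u⁻¹` -/

section AtLeast

variable {R : Type*} [Ring R]

/-- A Laurent series has no terms of degree below `d`. -/
def AtLeast (d : ℤ) (f : LaurentSeries R) : Prop := ∀ n < d, f.coeff n = 0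

theorem AtLeast.mono {d e : ℤ} {f : LaurentSeries R} (hf : AtLeast d f) (h : e ≤ d) : AtLeast e f :=
  fun n hn => hf n (hn.trans_le h)

theorem atLeast_zero (d : ℤ) : AtLeast d (0 : LaurentSeries R) := fun _ _ => rfl

theorem AtLeast.add {d : ℤ} {f g : LaurentSeries R} (hf : AtLeast d f) (hg : AtLeast d g) :
    AtLeast d (f + g) := fun n hn => by
  rw [HahnSeries.coeff_add, hf n hn, hg n hn, add_zero]

theorem AtLeast.neg {d : ℤ} {f : LaurentSeries R} (hf : AtLeast d f) : AtLeast d (-f) :=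
  fun n hn => by rw [HahnSeries.coeff_neg, hf n hn, neg_zero]

theorem AtLeast.sub {d : ℤ} {f g : LaurentSeries R} (hf : AtLeast d f) (hg : AtLeast d g) :
    AtLeast d (f - g) := fun n hn => by
  rw [HahnSeries.coeff_sub, hf n hn, hg n hn, sub_zero]

theorem AtLeast.mul {d e : ℤ} {f g : LaurentSeries R} (hf : AtLeast d f) (hg : AtLeast e g) :
    AtLeast (d + e) (f * g) := fun n hn => by
  rw [HahnSeries.coeff_mul]
  refine Finset.sum_eq_zero fun p hp => ?_
  have hp' : p.1 + p.2 = n := (Finset.mem_antidiagonal.mp hp).2.2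
  rcases lt_or_ge p.1 d with h | h
  · rw [hf _ h, zero_mul]
  · rw [hg _ (by omega), mul_zero]

theorem AtLeast.sum {ι : Type*} (t : Finset ι) {d : ℤ} {f : ι → LaurentSeries R}
    (hf : ∀ i ∈ t, AtLeast d (f i)) : AtLeast d (∑ i ∈ t, f i) := by
  classical
  induction t using Finset.induction_on with
  | empty => exact atLeast_zero d
  | insert a t ha ih =>
    rw [Finset.sum_insert ha]
    exact (hf a (Finset.mem_insert_self _ _)).add (ih fun i hi => hf i (Finset.mem_insert_of_mem hi))

theorem atLeast_single (d : ℤ) (a : R) : AtLeast d (HahnSeries.single d a) := fun _ hn =>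
  HahnSeries.coeff_single_of_ne hn.ne

theorem atLeast_C (a : R) : AtLeast 0 (HahnSeries.C a : LaurentSeries R) := atLeast_single 0 a

theorem atLeast_one : AtLeast 0 (1 : LaurentSeries R) := atLeast_single 0 1

theorem atLeast_ofPowerSeries (p : PowerSeries R) : AtLeast 0 (HahnSeries.ofPowerSeries ℤ R p) :=
  fun _ hn => ofPowerSeries_coeff_neg p hn

theorem AtLeast.exists_ofPowerSeries {f : LaurentSeries R} (hf : AtLeast 0 f) :
    ∃ p : PowerSeries R, HahnSeries.ofPowerSeries ℤ R p = f := by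
  refine ⟨PowerSeries.mk fun n => f.coeff n, ?_⟩
  ext n
  rcases lt_or_ge n 0 with h | h
  · rw [ofPowerSeries_coeff_neg _ h, hf n h]
  · lift n to ℕ using h
    rw [HahnSeries.ofPowerSeries_apply_coeff, PowerSeries.coeff_mk]

variable {l m n : Type*} [Fintype m]

/-- All entries of a matrix have no terms of degree below `d`. -/
def MatAtLeast (d : ℤ) (M : Matrix l n (LaurentSeries R)) : Prop := ∀ i j, AtLeast d (M i j)

theorem MatAtLeast.mul {d e : ℤ} {M : Matrix l m (LaurentSeries R)}
    {N : Matrix m n (LaurentSeries R)} (hM : MatAtLeast d M) (hN : MatAtLeast e N) :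
    MatAtLeast (d + e) (M * N) := fun i j => by
  rw [Matrix.mul_apply]
  exact AtLeast.sum _ fun p _ => (hM i p).mul (hN p j)

/-- A Laurent series has a two-sided inverse without terms of degree below `d`. -/
def InvAtLeast (d : ℤ) (f : LaurentSeries R) : Prop := ∃ g, AtLeast d g ∧ f * g = 1 ∧ g * f = 1

theorem InvAtLeast.mono {d e : ℤ} {f : LaurentSeries R} (hf : InvAtLeast d f) (h : e ≤ d) :
    InvAtLeast e f := by
  obtain ⟨g, h1, h2⟩ := hf
  exact ⟨g, h1.mono h, h2⟩

theorem InvAtLeast.mul {d e : ℤ} {f g : LaurentSeries R} (hf : InvAtLeast d f)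
    (hg : InvAtLeast e g) : InvAtLeast (d + e) (f * g) := by
  obtain ⟨f', h1, h2, h3⟩ := hf
  obtain ⟨g', h1', h2', h3'⟩ := hg
  refine ⟨g' * f', (h1'.mul h1).mono (by omega), ?_, ?_⟩
  · rw [mul_assoc, ← mul_assoc g, h2', one_mul, h2]
  · rw [mul_assoc, ← mul_assoc f', h3, one_mul, h3']

theorem InvAtLeast.neg {d : ℤ} {f : LaurentSeries R} (hf : InvAtLeast d f) : InvAtLeast d (-f) := by
  obtain ⟨g, h1, h2, h3⟩ := hf
  exact ⟨-g, h1.neg, by rw [neg_mul_neg, h2], by rw [neg_mul_neg, h3]⟩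

theorem invAtLeast_one : InvAtLeast 0 (1 : LaurentSeries R) :=
  ⟨1, atLeast_one, mul_one 1, mul_one 1⟩

theorem InvAtLeast.list_prod (t : List (LaurentSeries R)) (h : ∀ f ∈ t, InvAtLeast 0 f) :
    InvAtLeast 0 t.prod := by
  induction t with
  | nil => exact invAtLeast_one
  | cons a t ih =>
    rw [List.prod_cons]
    exact (h a (by simp)).mul (ih fun f hf => h f (by simp [hf]))

theorem invAtLeast_C_add {a : R} (ha : IsUnit a) {f : LaurentSeries R} (hf : AtLeast 1 f) :
    InvAtLeast 0 (HahnSeries.C a + f) := by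
  obtain ⟨p, hp⟩ := ((atLeast_C a).add (hf.mono zero_le_one)).exists_ofPowerSeries
  obtain ⟨a, rfl⟩ := ha
  have hc : PowerSeries.constantCoeff p = a := by
    rw [← PowerSeries.coeff_zero_eq_constantCoeff_apply, ← HahnSeries.ofPowerSeries_apply_coeff (Γ := ℤ),
      hp, HahnSeries.coeff_add, Nat.cast_zero, hf 0 zero_lt_one, add_zero, HahnSeries.C_apply,
      HahnSeries.coeff_single_same]
  rw [← hp]
  refine ⟨HahnSeries.ofPowerSeries ℤ R (PowerSeries.invOfUnit p a), atLeast_ofPowerSeries _, ?_, ?_⟩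
  · rw [← map_mul, PowerSeries.mul_invOfUnit p a hc, map_one]
  · rw [← map_mul, PowerSeries.invOfUnit_mul p a hc, map_one]

end AtLeast

section Scalars

theorem AtLeast.toAq {s kp km : ℂ} {d : ℤ} {f : Sc} (hf : AtLeast d f) :
    AtLeast d (toAq s kp km f) := fun n hn => by
  rw [FusedK.toAq, HahnSeries.map_coeff, hf n hn]
  exact map_zero _

theorem InvAtLeast.toAq {s kp km : ℂ} {d : ℤ} {f : Sc} (hf : InvAtLeast d f) :
    InvAtLeast d (toAq s kp km f) := by
  obtain ⟨g, h1, h2, h3⟩ := hf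
  refine ⟨_, h1.toAq, ?_, ?_⟩
  · rw [← algebraMap_eq, ← algebraMap_eq, ← map_mul, h2, map_one]
  · rw [← algebraMap_eq, ← algebraMap_eq, ← map_mul, h3, map_one]

theorem InvAtLeast.prod {ι : Type*} (t : Finset ι) {d : ℤ} {f : ι → Sc}
    (hf : ∀ i ∈ t, InvAtLeast d (f i)) : InvAtLeast (t.card * d) (∏ i ∈ t, f i) := by
  classical
  induction t using Finset.induction_on with
  | empty => simpa using invAtLeast_one
  | insert a t ha ih =>
    rw [Finset.prod_insert ha, Finset.card_insert_of_notMem ha]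
    exact ((hf a (Finset.mem_insert_self _ _)).mul
      (ih fun i hi => hf i (Finset.mem_insert_of_mem hi))).mono (by push_cast; linarith)

theorem AtLeast.prod {ι : Type*} (t : Finset ι) {d : ℤ} {f : ι → Sc}
    (hf : ∀ i ∈ t, AtLeast d (f i)) : AtLeast (t.card * d) (∏ i ∈ t, f i) := by
  classical
  induction t using Finset.induction_on with
  | empty => simpa using atLeast_one
  | insert a t ha ih =>
    rw [Finset.prod_insert ha, Finset.card_insert_of_notMem ha]
    exact ((hf a (Finset.mem_insert_self _ _)).mul
      (ih fun i hi => hf i (Finset.mem_insert_of_mem hi))).mono (by push_cast; linarith)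

theorem cst_single (a b : ℂ) (m : ℤ) :
    (HahnSeries.single m a : Sc) * cst b = HahnSeries.single m (a * b) := by
  rw [cst, HahnSeries.C_apply, HahnSeries.single_mul_single, add_zero]

theorem atLeast_c {d m : ℤ} (h1 : d ≤ m) (h2 : d ≤ -m) (a : ℂ) :
    AtLeast d (c (HahnSeries.single m a)) := by
  rw [c, HahnSeries.inv_single]
  exact ((atLeast_single m a).mono h1).sub ((atLeast_single _ _).mono h2)

/-- For a monomial `x` of positive degree, `c(x⁻¹) = x⁻¹ (1 - x²)`, and the second factor is a power
series with constant term `1`. -/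
theorem invAtLeast_c_of_pos {m : ℤ} (hm : 0 < m) {a : ℂ} (ha : a ≠ 0) :
    InvAtLeast m (c (HahnSeries.single (-m) a)) := by
  set x : Sc := HahnSeries.single m a⁻¹ with hx
  have hx0 : x ≠ 0 := HahnSeries.single_ne_zero (inv_ne_zero ha)
  have hxi : HahnSeries.single (-m) a = x⁻¹ := by rw [hx, HahnSeries.inv_single, inv_inv]
  have hx1 : AtLeast m x := atLeast_single m _
  have h1 : InvAtLeast m x⁻¹ := ⟨x, hx1, inv_mul_cancel₀ hx0, mul_inv_cancel₀ hx0⟩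
  have h2 : InvAtLeast 0 (HahnSeries.C 1 + -(x * x) : Sc) :=
    invAtLeast_C_add isUnit_one ((hx1.mul hx1).neg.mono (by omega))
  have e : c x⁻¹ = x⁻¹ * (HahnSeries.C 1 + -(x * x)) := by
    rw [c, inv_inv, map_one]
    field_simp
    ring
  rw [hxi, e]
  exact (h1.mul h2).mono (by omega)

theorem invAtLeast_c {d m : ℤ} (hd : 0 < d) (hm : m = d ∨ m = -d) {a : ℂ} (ha : a ≠ 0) :
    InvAtLeast d (c (HahnSeries.single m a)) := by
  rcases hm with rfl | rfl
  · have e : c (HahnSeries.single m a) = -c (HahnSeries.single (-m) a⁻¹) := by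
      rw [c, c, HahnSeries.inv_single, HahnSeries.inv_single, neg_neg, inv_inv, neg_sub]
    rw [e]
    exact (invAtLeast_c_of_pos hd (inv_ne_zero ha)).neg
  · exact invAtLeast_c_of_pos hd ha

end Scalars

section

variable {s kp km : ℂ}

/-! ### Degrees of the K-operators and of the unitarity scalar -/

section Degrees

theorem Generic.genAt_atLeast (h : Generic s) {m : ℤ} (hm : m = 1 ∨ m = -1) {a : ℂ} (ha : a ≠ 0)
    (w : ℕ → Aq s kp km) : AtLeast 2 (genAt s kp km w (U s (HahnSeries.single m a))⁻¹) := by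
  obtain ⟨-, y, hy, hyU⟩ := h.exists_U_inv_natAbs (m := m) (by omega) ha
  rw [← hyU]
  have h1 : m.natAbs = 1 := by omega
  rw [h1] at hy
  exact fun n hn => genAt_coeff_of_lt hy w hn

theorem toAq_C_mul_atLeast {d : ℤ} (a : ℂ) {f : AqL s kp km} (hf : AtLeast d f) :
    AtLeast d (toAq s kp km (cst a) * f) := by
  have := (AtLeast.toAq (s := s) (kp := kp) (km := km) (atLeast_C a)).mul hf
  rwa [zero_add] at this

/-- The series `W_±` start at degree `2` and are multiplied by monomials of degree `±1`. Thus only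
the off-diagonal entries of the K-operator have constant terms. -/
theorem Generic.Khalf_diag_atLeast (h : Generic s) {m : ℤ} (hm : m = 1 ∨ m = -1) {a : ℂ}
    (ha : a ≠ 0) (i : Fin 2) : AtLeast 1 (Khalf s kp km (HahnSeries.single m a) i i) := by
  have hq : cst (qq s) * HahnSeries.single m a = HahnSeries.single m (a * qq s) := by
    rw [mul_comm, cst_single]
  have hx : AtLeast (-1) (toAq s kp km (cst (qq s) * HahnSeries.single m a)) := by
    rw [hq]
    exact ((atLeast_single _ _).mono (by omega)).toAq
  have hxi : AtLeast (-1) (toAq s kp km (cst (qq s) * HahnSeries.single m a)⁻¹) := by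
    rw [hq, HahnSeries.inv_single]
    exact ((atLeast_single _ _).mono (by omega)).toAq
  fin_cases i
  · exact (hx.mul (h.genAt_atLeast hm ha _)).sub (hxi.mul (h.genAt_atLeast hm ha _))
  · exact (hx.mul (h.genAt_atLeast hm ha _)).sub (hxi.mul (h.genAt_atLeast hm ha _))

theorem Generic.Khalf_zero_one (h : Generic s) {m : ℤ} (hm : m = 1 ∨ m = -1) {a : ℂ} (ha : a ≠ 0) :
    ∃ f, AtLeast 1 f ∧ Khalf s kp km (HahnSeries.single m a) 0 1
      = HahnSeries.C (algebraMap ℂ _ (kp * (qq s + (qq s)⁻¹) / (qq s - (qq s)⁻¹))) + f :=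
  ⟨_, (toAq_C_mul_atLeast _ (h.genAt_atLeast hm ha _)).mono one_le_two, by
    rw [← toAq_cst]; exact add_comm _ _⟩

theorem Generic.Khalf_one_zero (h : Generic s) {m : ℤ} (hm : m = 1 ∨ m = -1) {a : ℂ} (ha : a ≠ 0) :
    ∃ f, AtLeast 1 f ∧ Khalf s kp km (HahnSeries.single m a) 1 0
      = HahnSeries.C (algebraMap ℂ _ (km * (qq s + (qq s)⁻¹) / (qq s - (qq s)⁻¹))) + f :=
  ⟨_, (toAq_C_mul_atLeast _ (h.genAt_atLeast hm ha _)).mono one_le_two, by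
    rw [← toAq_cst]; exact add_comm _ _⟩

theorem Generic.Khalf_atLeast (h : Generic s) {m : ℤ} (hm : m = 1 ∨ m = -1) {a : ℂ} (ha : a ≠ 0) :
    MatAtLeast 0 (Khalf s kp km (HahnSeries.single m a)) := by
  obtain ⟨f, hf, e⟩ := h.Khalf_zero_one (kp := kp) (km := km) hm ha
  obtain ⟨g, hg, e'⟩ := h.Khalf_one_zero (kp := kp) (km := km) hm ha
  intro i j
  fin_cases i <;> fin_cases j
  · exact (h.Khalf_diag_atLeast hm ha 0).mono zero_le_one
  · exact e ▸ (atLeast_C _).add (hf.mono zero_le_one)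
  · exact e' ▸ (atLeast_C _).add (hg.mono zero_le_one)
  · exact (h.Khalf_diag_atLeast hm ha 1).mono zero_le_one

/-- In the upper left entry of `K(x) K(x⁻¹)` only the product of the two off-diagonal entries has a
constant term, namely `k₊ k₋ (q + q⁻¹)² / (q - q⁻¹)²`, which is nonzero. -/
theorem Generic.invAtLeast_gam (h : Generic s) (hkp : kp ≠ 0) (hkm : km ≠ 0) {a : ℂ}
    (ha : a ≠ 0) : InvAtLeast 0 (gam s kp km (HahnSeries.single (-1) a)) := by
  have hx : IsMonomial (HahnSeries.single (-1) a) := ⟨-1, by norm_num, a, ha, rfl⟩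
  have hm : (-1 : ℤ) = 1 ∨ (-1 : ℤ) = -1 := Or.inr rfl
  have hm' : (- -1 : ℤ) = 1 ∨ (- -1 : ℤ) = -1 := Or.inl rfl
  have ha' := inv_ne_zero ha
  obtain ⟨f, hf, e⟩ := h.Khalf_zero_one (kp := kp) (km := km) hm ha
  obtain ⟨g, hg, e'⟩ := h.Khalf_one_zero (kp := kp) (km := km) hm' ha'
  have key := congrFun (congrFun (h.Khalf_mul_inv hkp hkm hx).1 0) 0
  rw [HahnSeries.inv_single, Matrix.mul_apply, Fin.sum_univ_two, e, e', Matrix.scalar_apply,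
    Matrix.diagonal_apply_eq] at key
  have hd := (h.Khalf_diag_atLeast (kp := kp) (km := km) hm ha 0).mul
    (h.Khalf_diag_atLeast (kp := kp) (km := km) hm' ha' 0)
  rw [← key]
  set κ := kp * (qq s + (qq s)⁻¹) / (qq s - (qq s)⁻¹)
  set κ' := km * (qq s + (qq s)⁻¹) / (qq s - (qq s)⁻¹)
  have hκ : IsUnit (algebraMap ℂ (Aq s kp km) κ * algebraMap ℂ (Aq s kp km) κ') := by
    rw [← map_mul]
    refine (IsUnit.mk0 _ ?_).map _
    exact mul_ne_zero (div_ne_zero (mul_ne_zero hkp h.qq_add_inv_ne) h.qq_sub_inv_ne)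
      (div_ne_zero (mul_ne_zero hkm h.qq_add_inv_ne) h.qq_sub_inv_ne)
  have he := ((hd.mono (by norm_num : (1 : ℤ) ≤ 1 + 1)).add
    (((atLeast_C (algebraMap ℂ (Aq s kp km) κ)).mul hg).mono (by norm_num : (1 : ℤ) ≤ 0 + 1))).add
      (((hf.mul (atLeast_C (algebraMap ℂ (Aq s kp km) κ'))).mono (by norm_num : (1 : ℤ) ≤ 1 + 0)).add
        ((hf.mul hg).mono (by norm_num : (1 : ℤ) ≤ 1 + 1)))
  have := invAtLeast_C_add hκ he
  rw [map_mul] at this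
  convert this using 1
  noncomm_ring

theorem Generic.invAtLeast_gamProdAt (h : Generic s) (hkp : kp ≠ 0) (hkm : km ≠ 0) (n : ℕ) :
    InvAtLeast 0 (gamProdAt s kp km n u) := by
  refine InvAtLeast.list_prod _ fun f hf => ?_
  obtain ⟨k, -, rfl⟩ := List.mem_map.mp hf
  rw [u, cst_single, one_mul]
  exact h.invAtLeast_gam hkp hkm (zpow_ne_zero _ h.ne)

/-- There are `2 n` factors `c`, each with an inverse starting at degree `2`, which would give `4
n`. The weaker bound `2 n` suffices, as it matches the bound in `Rhalf_atLeast`. -/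
theorem Generic.invAtLeast_rhoR (h : Generic s) {n : ℕ} (hn : 1 ≤ n) {a : ℂ} (ha : a ≠ 0) :
    InvAtLeast (2 * n) (rhoR s n (HahnSeries.single (-2) a)) := by
  have hc : ∀ b : ℂ, b ≠ 0 → InvAtLeast 2 (c (HahnSeries.single (-2) a * cst b)) := fun b hb => by
    rw [cst_single]
    exact invAtLeast_c two_pos (Or.inr rfl) (mul_ne_zero ha hb)
  have hc' : ∀ b : ℂ, b ≠ 0 → InvAtLeast 2 (c ((HahnSeries.single (-2) a)⁻¹ * cst b)) :=
    fun b hb => by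
      rw [HahnSeries.inv_single, cst_single]
      exact invAtLeast_c two_pos (Or.inl rfl) (mul_ne_zero (inv_ne_zero ha) hb)
  have hp := InvAtLeast.prod (Finset.range (n - 1))
    (f := fun k => c (cst (s ^ ((n : ℤ) - 1 - 2 * k)) * HahnSeries.single (-2) a)) (d := 2)
    fun k _ => by rw [mul_comm]; exact hc _ (zpow_ne_zero _ h.ne)
  have hp' := InvAtLeast.prod (Finset.range (n - 1))
    (f := fun k => c (cst (s ^ ((n : ℤ) - 1 - 2 * k)) * (HahnSeries.single (-2) a)⁻¹)) (d := 2)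
    fun k _ => by rw [mul_comm]; exact hc' _ (zpow_ne_zero _ h.ne)
  have h1 := hc _ (pow_ne_zero (n + 1) h.ne)
  have h2 := hc' _ (pow_ne_zero (n + 1) h.ne)
  rw [cst_pow] at h1 h2
  refine ((hp.mul hp').mul (h1.mul h2)).mono ?_
  rw [Finset.card_range]
  omega

theorem Generic.invAtLeast_cProdAt (h : Generic s) {n : ℕ} (hn : 1 ≤ n) :
    ∀ a : ℂ, a ≠ 0 → InvAtLeast (n * (n - 1)) (cProdAt s n (HahnSeries.single (-1) a)) := by
  induction n, hn using Nat.le_induction with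
  | base =>
    intro a ha
    have : cProdAt s 1 (HahnSeries.single (-1) a) = 1 := by simp [cProdAt, doubleProd]
    rw [this]
    exact invAtLeast_one
  | succ n hn ih =>
    intro a ha
    have e1 : (HahnSeries.single (-1) a : Sc) ^ 2 * cst s / cst s ^ n
        = HahnSeries.single (-2) (a ^ 2 * s * (s ^ n)⁻¹) := by
      rw [div_eq_mul_inv, ← cst_pow, ← cst_inv, HahnSeries.single_pow, cst_single, cst_single]
      rfl
    rw [h.cProdAt_succ n hn (HahnSeries.single_ne_zero ha), e1, cst_single]
    refine ((h.invAtLeast_rhoR hn ?_).mul (ih (a * s) (mul_ne_zero ha h.ne))).mono ?_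
    · exact mul_ne_zero (mul_ne_zero (pow_ne_zero _ ha) h.ne) (inv_ne_zero (pow_ne_zero _ h.ne))
    · push_cast
      linarith [mul_comm (n : ℤ) (n + 1 - 1)]

theorem Generic.invAtLeast_unitScalar (h : Generic s) (hkp : kp ≠ 0) (hkm : km ≠ 0) {n : ℕ}
    (hn : 1 ≤ n) : InvAtLeast (n * (n - 1)) (unitScalar s kp km n u) := by
  have := (h.invAtLeast_gamProdAt hkp hkm n).mul
    (h.invAtLeast_cProdAt hn 1 one_ne_zero).toAq
  rwa [zero_add] at this

theorem Rhalf_atLeast {n : ℕ} (hn : 1 ≤ n) (a : ℂ) :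
    MatAtLeast (-(2 * n)) (Rhalf s n (HahnSeries.single 2 a)) := by
  have hp := AtLeast.prod (Finset.range (n - 1))
    (f := fun k => c (cst (s ^ ((n : ℤ) - 1 - 2 * k)) * HahnSeries.single 2 a)) (d := -2)
    fun k _ => by
      rw [mul_comm, cst_single]
      exact atLeast_c (by norm_num) le_rfl _
  intro i j
  rw [Rhalf, Matrix.smul_apply, Matrix.add_apply, Matrix.map_apply]
  refine (hp.mul (AtLeast.add (d := -2) ((atLeast_C _).mono (by norm_num)) ?_)).mono ?_
  · rw [Matrix.diagonal_apply]
    split_ifs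
    · rw [HahnSeries.inv_single, cst_single, cst_single]
      exact ((atLeast_single _ _).mono (by norm_num)).sub (atLeast_single _ _)
    · exact atLeast_zero _
  · rw [Finset.card_range]
    omega

theorem MatAtLeast.site1 {R : Type*} [Ring R] {a b e : Type*} [DecidableEq e] {d : ℤ}
    {M : Matrix a b (LaurentSeries R)} (hM : MatAtLeast d M) : MatAtLeast d (site1 e M) := by
  intro i j
  rw [FusedK.site1, Matrix.of_apply]
  split_ifs
  · exact hM _ _
  · exact atLeast_zero _

theorem MatAtLeast.site2 {R : Type*} [Ring R] {a b e : Type*} [DecidableEq e] {d : ℤ}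
    {M : Matrix a b (LaurentSeries R)} (hM : MatAtLeast d M) : MatAtLeast d (site2 e M) := by
  intro i j
  rw [FusedK.site2, Matrix.of_apply]
  split_ifs
  · exact hM _ _
  · exact atLeast_zero _

theorem liftC_atLeast {m n : Type*} (M : Matrix m n ℂ) : MatAtLeast 0 (liftC s kp km M) :=
  fun _ _ => (atLeast_C _).toAq

/-- Each fusion step from `n` to `n + 1` loses at most the degree `2 n` of its R-matrix, and these
losses sum to `n (n - 1)`. -/
theorem Generic.Khat_atLeast (h : Generic s) {n : ℕ} (hn : 1 ≤ n) :
    ∀ a : ℂ, a ≠ 0 → MatAtLeast (-(n * (n - 1))) (Khat s kp km n (HahnSeries.single 1 a)) := by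
  induction n, hn using Nat.le_induction with
  | base => exact fun a ha => h.Khalf_atLeast (Or.inl rfl) ha
  | succ n hn ih =>
    intro a ha
    obtain ⟨m, rfl⟩ := Nat.exists_eq_add_of_le' hn
    have e : (HahnSeries.single 1 a : Sc) ^ 2 * cst (s ^ (((m : ℤ) + 1) - 1))
        = HahnSeries.single 2 (a ^ 2 * s ^ (((m : ℤ) + 1) - 1)) := by
      rw [HahnSeries.single_pow, cst_single]
      rfl
    rw [Khat, cst_single, cst_single, e, leg1_eq, leg2_eq]
    have h1 := (ih (a * s⁻¹) (mul_ne_zero ha (inv_ne_zero h.ne))).site2 (e := Fin 2)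
    have h2 : MatAtLeast _ (liftS s kp km _) := fun i j =>
      (Rhalf_atLeast (s := s) hn (a ^ 2 * s ^ (((m : ℤ) + 1) - 1)) i j).toAq
    have h3 := (h.Khalf_atLeast (kp := kp) (km := km) (Or.inl rfl)
      (mul_ne_zero ha (zpow_ne_zero ((m : ℤ) + 1) h.ne))).site1 (e := Fin (m + 1 + 1))
    have h4 := ((((liftC_atLeast (calF s (m + 1))).mul h1).mul h2).mul h3).mul
      (liftC_atLeast (kp := kp) (km := km) (calE s (m + 1)))
    exact fun i j => (h4 i j).mono (by push_cast; linarith [mul_comm (m : ℤ) (m + 1)])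

end Degrees

/-! ### The inverse as a power series in `u⁻¹` -/

section Inverse

theorem Generic.exists_inverse_Kop (h : Generic s) (hkp : kp ≠ 0) (hkm : km ≠ 0) {n : ℕ}
    (hn : 1 ≤ n) : ∃ L : Matrix (Fin (n + 1)) (Fin (n + 1)) (PowerSeries (Aq s kp km)),
      Kop s kp km n u * liftP s kp km L = 1 ∧ liftP s kp km L * Kop s kp km n u = 1 := by
  obtain ⟨h1, h2⟩ := h.Kop_mul_Khat_u hkp hkm hn
  obtain ⟨g, hg, hg1, hg2⟩ := h.invAtLeast_unitScalar hkp hkm hn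
  have hu : u⁻¹ = HahnSeries.single 1 1 := by
    rw [u, HahnSeries.inv_single, inv_one]; rfl
  have hK : MatAtLeast (-(n * (n - 1))) (Khat s kp km n u⁻¹) := by
    rw [hu]; exact h.Khat_atLeast hn 1 one_ne_zero
  have hcomm : ∀ f, unitScalar s kp km n u * f = f * unitScalar s kp km n u := by
    have := h.unitScalar_mul_comm hkp hkm hn 1 one_ne_zero
    rwa [cst_one, mul_one] at this
  -- The inverse of a central element is central; this makes `K̂(u⁻¹) g` a left inverse as well.
  have hgc : ∀ f, g * f = f * g := fun f => by
    calc g * f = g * (f * unitScalar s kp km n u) * g := by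
          rw [mul_assoc, mul_assoc, hg1, mul_one]
      _ = f * g := by rw [← hcomm, ← mul_assoc, hg2, one_mul]
  have hL : ∀ i j, ∃ p : PowerSeries (Aq s kp km),
      HahnSeries.ofPowerSeries ℤ (Aq s kp km) p = Khat s kp km n u⁻¹ i j * g := fun i j =>
    -- The bounds `-n(n-1)` for `K̂(u⁻¹)` and `n(n-1)` for the inverse of the scalar cancel, so the
    -- entries are power series in `u⁻¹`.
    (((hK i j).mul hg).mono (by omega)).exists_ofPowerSeries
  choose L hL using hL
  have hLe : liftP s kp km (Matrix.of L) = Khat s kp km n u⁻¹ * Matrix.scalar (Fin (n + 1)) g := by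
    ext i j : 2
    rw [Matrix.scalar_apply, Matrix.mul_diagonal, ← hL]
    rfl
  refine ⟨Matrix.of L, ?_, ?_⟩
  · rw [hLe, ← Matrix.mul_assoc, h1, ← map_mul, hg1, map_one]
  · have hs : Matrix.scalar (Fin (n + 1)) g * Kop s kp km n u
        = Kop s kp km n u * Matrix.scalar (Fin (n + 1)) g :=
      Matrix.scalar_commute _ (fun r => hgc r) _
    rw [hLe, Matrix.mul_assoc, hs, ← Matrix.mul_assoc, h2, ← map_mul, hg1, map_one]

end Inverse

end

end FusedK

end

theorem proposition5p5 (s kp km : ℂ) (hs : s ≠ 0) (hq : ∀ m : ℕ, 1 ≤ m → (s ^ 2) ^ m ≠ 1)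
    (hkp : kp ≠ 0) (hkm : km ≠ 0) (n : ℕ) (hn : 1 ≤ n) :
    FusedK.Kop s kp km n FusedK.u * FusedK.Khat s kp km n FusedK.u⁻¹
        = Matrix.scalar (Fin (n + 1))
            (FusedK.gammaProd s kp km n * FusedK.toAq s kp km (FusedK.cProd s n)) ∧
    FusedK.Khat s kp km n FusedK.u⁻¹ * FusedK.Kop s kp km n FusedK.u
        = Matrix.scalar (Fin (n + 1))
            (FusedK.gammaProd s kp km n * FusedK.toAq s kp km (FusedK.cProd s n)) ∧
    ∃ L : Matrix (Fin (n + 1)) (Fin (n + 1)) (PowerSeries (FusedK.Aq s kp km)),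
      FusedK.Kop s kp km n FusedK.u * FusedK.liftP s kp km L = 1 ∧
        FusedK.liftP s kp km L * FusedK.Kop s kp km n FusedK.u = 1 := by
  have h : FusedK.Generic s := ⟨hs, fun m hm => by rw [pow_mul]; exact hq m hm⟩
  rw [h.gammaProd_mul_cProd]
  exact ⟨(h.Kop_mul_Khat_u hkp hkm hn).1, (h.Kop_mul_Khat_u hkp hkm hn).2,
    h.exists_inverse_Kop hkp hkm hn⟩
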